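/- **Setting.** Let $T,M\ge 0$ and $K\ge 1$ be integers, and let $G$ be a directed graph on the action set $[K]$ that contains all self-loops; write $N_{\mathrm{out}}(D)$ for the set of out-neighbours of the vertices in $D\subseteq[K]$. In each round $t=1,\dots,T$ the learner is shown a context $c_t\in[M]$, chooses an action $a_t\in[K]$, and observes the rewards $r_{t,c,a}$ for all contexts $c\in[M]$ and all $a\in N_{\mathrm{out}}(a_t)$. The reward vectors $(r_{t,c,a})_{c,a}$ of the different rounds are independent, with entries in $[0,1]$ and with means $\mathbb E[r_{t,c,a}]=\mu_{c,a}$ that are unknown and do not depend on $t$. The context sequence is fixed and *self-avoiding*: $c_s=c_t$ with $s<t$ implies $c_s=c_{s+1}=\dots=c_t$. The regret is $\mathsf R_T=\sum_{t=1}^T\big(\max_a\mu_{c_t,a}-\mu_{c_t,a_t}\big)$. Let $$\beta_M(G)=\max\Big\{\sum_{c=1}^M|I_c| : I_1,\dots,I_M\subseteq[K]\text{ independent, with no edge from } I_i \text{ to } I_j \text{ for } i<j\Big\}.$$ **Sequential game I** has $M$ steps. In step $c$ the adversary chooses $A_c\subseteq[K]$ disjoint from $N_{\mathrm{out}}(\bigcup_{c'<c}D_{c'})$,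 and the learner answers with $D_c\subseteq A_c$ such that $A_c\subseteq N_{\mathrm{out}}(D_c)$, listed in some order. The cost is $\sum_c|D_c|$. **Layered arm elimination** with a game strategy $\mathcal A$ and a parameter $\delta\in(0,1)$. When a new context $c$ arrives, start on layer $\ell=1$ with active set $A_{c,1}=[K]$. On layer $\ell$, ask $\mathcal A$ for the answer $D_{c,\ell}$ to the set $A_{c,\ell}\setminus N_{\mathrm{out}}(\bigcup_{c'}D_{c',\ell})$, the union being over the earlier contexts, in the game played on this layer so far, and choose the actions of $D_{c,\ell}$ once each, in the given order. If the context changes before all of them are chosen, then from then on $D_{c,\ell}$ stands for those that were chosen (and the adversary's set for the part that they dominate). Otherwise go to layer $\ell+1$ with $$A_{c,\ell+1}=\Big\{a\in A_{c,\ell}:\ \bar r_{c,a}\ge\max_{a'\in A_{c,\ell}}\bar r_{c,a'}-2\sqrt{\log(2MKT/\delta)/\ell}\Big\},$$ where $\bar r_{c,a}$ is the mean of all rewards of $(c,a)$ observed so far. This policy is given $T,M,K,G,\delta$, but not the future contexts. **Theorem.** There are an absolute constant $C>0$ and a (deterministic) learner's strategy $\mathcal A$ for sequential game I, defined for all graphs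 $G$ as above, with cost at most $C\,\beta_M(G)\log^2K$ against every adversary whenever $K\ge2$, such that layered arm elimination with $\mathcal A$ has the following properties. 1. It runs in polynomial time: one program of a random-access machine with integer and real registers (unit-cost addition, subtraction and comparison of natural numbers; unit-cost arithmetic, comparison, square root and logarithm of real numbers; no rounding) computes every action $a_t$ from $T,M,K,G,\delta$, the contexts $c_1,\dots,c_t$, the past actions and the past observations in a number of steps polynomial in $T+M+K$. 2. For every $\delta\in(0,1)$ and every self-avoiding context sequence, with probability at least $1-\delta$, $$\mathsf R_T\le C\sqrt{T\,\beta_M(G)\,\log^2(K)\,\log(MKT/\delta)}.$$ 3. With $\delta=1/(2T)$, for every self-avoiding context sequence, $$\mathbb E[\mathsf R_T]\le C\sqrt{T\,\beta_M(G)\,\log^2(K)\,\log(MKT)},$$ so that the worst-case expected regret over self-avoiding contexts is $\widetilde O(\sqrt{\beta_M(G)\,T})$. -/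

import Mathlib

namespace GraphBandit

noncomputable section

/-! ### Feedback graphs -/

/-- The out-neighbourhood `N_out(D)` of a set of vertices. -/
def outNbrs {K : ℕ} (G : Digraph (Fin K)) (D : Finset (Fin K)) : Finset (Fin K) :=
  open scoped Classical in Finset.univ.filter fun v => ∃ u ∈ D, G.Adj u v

/-- Independent sets: no edge between two distinct vertices (self-loops are allowed). -/
def IsIndep {K : ℕ} (G : Digraph (Fin K)) (I : Finset (Fin K)) : Prop :=
  ∀ u ∈ I, ∀ v ∈ I, u ≠ v → ¬ G.Adj u v

/-- `β_M(G)`: the maximum of `∑ c, |I_c|` over independent sets `I_1, …, I_M` such that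
no vertex of `I_i` points to a vertex of `I_j` whenever `i < j`. -/
def beta {K : ℕ} (M : ℕ) (G : Digraph (Fin K)) : ℕ :=
  open scoped Classical in
  (Finset.univ.filter fun I : Fin M → Finset (Fin K) =>
      (∀ c, IsIndep G (I c)) ∧ ∀ i j, i < j → ∀ u ∈ I i, ∀ v ∈ I j, ¬ G.Adj u v).sup
    fun I => ∑ c, (I c).card

/-! ### Sequential game I -/

/-- The moves made so far in the game, oldest first. A move is a pair `(A, D)`: the set `A` of
the adversary, and the answer `D` of the learner, listed without repetition in the order in which
the learner wants to take the actions. -/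
abbrev Transcript (K : ℕ) := List (Finset (Fin K) × List (Fin K))

/-- The vertices observed through the past answers of the learner. -/
def covered {K : ℕ} (G : Digraph (Fin K)) (h : Transcript K) : Finset (Fin K) :=
  outNbrs G (h.flatMap Prod.snd).toFinset

/-- A strategy of the learner, uniform in the graph: from the graph, the past moves and the current
set `A` of the adversary, it computes the answer `D`. -/
abbrev GameAlg := ∀ K : ℕ, Digraph (Fin K) → Transcript K → Finset (Fin K) → List (Fin K)

/-- The strategy obeys the rules: `D ⊆ A` and `D` dominates `A`. -/
def GameAlg.Legal (𝒜 : GameAlg) : Prop :=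
  ∀ (K : ℕ) (G : Digraph (Fin K)), (∀ a, G.Adj a a) →
    ∀ (h : Transcript K) (A : Finset (Fin K)),
      (𝒜 K G h A).Nodup ∧ (𝒜 K G h A).toFinset ⊆ A ∧ A ⊆ outNbrs G (𝒜 K G h A).toFinset

/-- The first `n` moves when the adversary plays `A 0, A 1, …` and the learner follows `𝒜`. -/
def gamePlay (𝒜 : GameAlg) {K : ℕ} (G : Digraph (Fin K)) (A : ℕ → Finset (Fin K)) :
    ℕ → Transcript K
  | 0 => []
  | n + 1 => gamePlay 𝒜 G A n ++ [(A n, 𝒜 K G (gamePlay 𝒜 G A n) (A n))]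

/-- Against every legal play of the adversary in the game with `M` steps, the strategy has total
cost `∑ c, |D_c|` at most `B`. -/
def GameAlg.CostLE (𝒜 : GameAlg) {K : ℕ} (G : Digraph (Fin K)) (M : ℕ) (B : ℝ) : Prop :=
  ∀ A : ℕ → Finset (Fin K),
    (∀ n < M, Disjoint (A n) (covered G (gamePlay 𝒜 G A n))) →
      (((gamePlay 𝒜 G A M).map fun p => p.2.length).sum : ℝ) ≤ B

/-! ### Contextual bandits with graph feedback -/

/-- What the learner knows of a past round: the context, the action, and the observed rewards,
with `0` in the entries that the feedback graph does not reveal. -/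
structure Round (M K : ℕ) where
  ctx : Fin M
  act : Fin K
  obs : Fin M → Fin K → ℝ

/-- A (deterministic) policy: from the past rounds, newest first, and the current context it
computes an action. -/
abbrev Policy (M K : ℕ) := List (Round M K) → Fin M → Fin K

/-- The observed part of a reward vector: action `act` reveals the rewards of its out-neighbours
under all contexts. -/
def reveal {M K : ℕ} (G : Digraph (Fin K)) (act : Fin K) (r : Fin M → Fin K → ℝ) :
    Fin M → Fin K → ℝ :=
  open scoped Classical in fun c a => if G.Adj act a then r c a else 0

/-- The history after `t` rounds under policy `π`, contexts `c` and rewards `r`. -/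
def history {T M K : ℕ} (π : Policy M K) (G : Digraph (Fin K)) (c : Fin T → Fin M)
    (r : Fin T → Fin M → Fin K → ℝ) : (t : ℕ) → t ≤ T → List (Round M K)
  | 0, _ => []
  | t + 1, ht =>
    let h := history π G c r t (Nat.le_of_succ_le ht)
    let a := π h (c ⟨t, ht⟩)
    ⟨c ⟨t, ht⟩, a, reveal G a (r ⟨t, ht⟩)⟩ :: h

/-- The action taken in round `t`. -/
def action {T M K : ℕ} (π : Policy M K) (G : Digraph (Fin K)) (c : Fin T → Fin M)
    (r : Fin T → Fin M → Fin K → ℝ) (t : Fin T) : Fin K :=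
  π (history π G c r t t.isLt.le) (c t)

/-- The regret `∑ t, (max_a μ_{c_t, a} - μ_{c_t, a_t})`. -/
def regret {T M K : ℕ} (π : Policy M K) (G : Digraph (Fin K)) (c : Fin T → Fin M)
    (μ : Fin M → Fin K → ℝ) (r : Fin T → Fin M → Fin K → ℝ) : ℝ :=
  ∑ t, ((⨆ a, μ (c t) a) - μ (c t) (action π G c r t))

/-- Contexts do not jump back. -/
def SelfAvoiding {T M : ℕ} (c : Fin T → Fin M) : Prop :=
  ∀ s t, s < t → c s = c t → ∀ u, s ≤ u → u ≤ t → c u = c s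

/-- A stochastic environment: the reward vectors of the rounds are independent random vectors with
entries in `[0, 1]` and a mean `μ` that does not depend on the round. Rewards of the same round
may be dependent. -/
structure StochasticRewards {Ω : Type*} [MeasurableSpace Ω] {T M K : ℕ}
    (P : MeasureTheory.Measure Ω) (r : Fin T → Ω → Fin M → Fin K → ℝ)
    (μ : Fin M → Fin K → ℝ) : Prop where
  measurable : ∀ t, Measurable (r t)
  indep : ProbabilityTheory.iIndepFun r P
  mem_Icc : ∀ t c a, ∀ᵐ ω ∂P, r t ω c a ∈ Set.Icc (0 : ℝ) 1
  mean : ∀ t c a, ∫ ω, r t ω c a ∂P = μ c a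

/-! ### Layered arm elimination -/

/-- The empirical reward of action `a` under context `c`: the mean over all past rounds whose
action reveals `a`. -/
def empMean {M K : ℕ} (G : Digraph (Fin K)) (h : List (Round M K)) (c : Fin M) (a : Fin K) : ℝ :=
  open scoped Classical in
  let seen := h.filter fun x => G.Adj x.act a
  (seen.map fun x => x.obs c a).sum / (seen.length : ℝ)

/-- The state of the elimination algorithm. -/
structure ElimState (M K : ℕ) where
  /-- the current context (`none` before the first round) -/
  cur : Option (Fin M)
  /-- the current layer `ℓ` -/
  layer : ℕ
  /-- the active set `A_{c,ℓ}` -/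
  active : Finset (Fin K)
  /-- the active actions not yet observed on this layer when it was entered -/
  move : Finset (Fin K)
  /-- the actions of `D_{c,ℓ}` still to be chosen, in order -/
  todo : List (Fin K)
  /-- the actions of `D_{c,ℓ}` already chosen, in order -/
  chosen : List (Fin K)
  /-- for each layer, the game played on it so far, without the move in progress -/
  record : ℕ → Transcript K

/-- The state before the first round. Layers are counted from `1`; layer `0` is never used. -/
def ElimState.init (M K : ℕ) : ElimState M K := ⟨none, 0, ∅, ∅, [], [], fun _ => []⟩

/-- End the move in progress on the current layer. If the context changed before all of `D_{c,ℓ}`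
was chosen, then the learner's answer is what was really chosen, and the adversary's set is cut
down to what this dominates; otherwise the two sets are recorded as they are. -/
def ElimState.close {M K : ℕ} (G : Digraph (Fin K)) (st : ElimState M K) : ElimState M K :=
  { st with
    record := Function.update st.record st.layer
      (st.record st.layer ++ [(st.move ∩ outNbrs G st.chosen.toFinset, st.chosen)]) }

/-- Enter layer `ℓ` with active set `A` under context `c`: the game subroutine is asked to dominate
the actions of `A` that earlier contexts did not observe on this layer. -/
def ElimState.enter {M K : ℕ} (𝒜 : GameAlg) (G : Digraph (Fin K)) (c : Fin M) (ℓ : ℕ)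
    (A : Finset (Fin K)) (st : ElimState M K) : ElimState M K :=
  { cur := some c
    layer := ℓ
    active := A
    move := A \ covered G (st.record ℓ)
    todo := 𝒜 K G (st.record ℓ) (A \ covered G (st.record ℓ))
    chosen := []
    record := st.record }

/-- The active set of the next layer: the actions of `A` whose empirical reward is at least
`max_{a' ∈ A} (empirical reward of a') - 2 √(log (2MKT/δ) / ℓ)`. -/
def eliminate {M K : ℕ} (T : ℕ) (G : Digraph (Fin K)) (δ : ℝ) (h : List (Round M K)) (c : Fin M)
    (ℓ : ℕ) (A : Finset (Fin K)) : Finset (Fin K) :=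
  open scoped Classical in
  A.filter fun a => ∀ a' ∈ A,
    empMean G h c a' - 2 * √(Real.log (2 * M * K * T / δ) / ℓ) ≤ empMean G h c a

/-- Once all of `D_{c,ℓ}` has been chosen, move to layer `ℓ + 1`. -/
def ElimState.advance {M K : ℕ} (𝒜 : GameAlg) (T : ℕ) (G : Digraph (Fin K)) (δ : ℝ)
    (h : List (Round M K)) (c : Fin M) (st : ElimState M K) : ElimState M K :=
  if st.todo = [] then
    (st.close G).enter 𝒜 G c (st.layer + 1) (eliminate T G δ h c st.layer st.active)
  else st

/-- The state in which the algorithm chooses an action under context `c`, after the past rounds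
`h`. A change of context restarts at layer `1` with all actions active. Then layers are passed
until there is an action to choose; this takes at most `h.length` steps, because at most the layers
`1, …, h.length` have been played on and a layer not played on leaves something to observe. -/
def ElimState.prepare {M K : ℕ} (𝒜 : GameAlg) (T : ℕ) (G : Digraph (Fin K)) (δ : ℝ)
    (h : List (Round M K)) (c : Fin M) (st : ElimState M K) : ElimState M K :=
  (ElimState.advance 𝒜 T G δ h c)^[h.length + 1]
    (if st.cur = some c then st else (st.close G).enter 𝒜 G c 1 Finset.univ)

/-- Choose the first remaining action of `D_{c,ℓ}`. -/
def ElimState.choose {M K : ℕ} (st : ElimState M K) : ElimState M K :=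
  { st with todo := st.todo.tail, chosen := st.chosen ++ st.todo.take 1 }

/-- The state after the past rounds (newest first). -/
def elimState {M K : ℕ} (𝒜 : GameAlg) (T : ℕ) (G : Digraph (Fin K)) (δ : ℝ) :
    List (Round M K) → ElimState M K
  | [] => ElimState.init M K
  | x :: h => ((elimState 𝒜 T G δ h).prepare 𝒜 T G δ h x.ctx).choose

/-- The layered arm-elimination policy with game subroutine `𝒜` and failure probability `δ`. -/
def armElim (𝒜 : GameAlg) (T M K : ℕ) [NeZero K] (G : Digraph (Fin K)) (δ : ℝ) : Policy M K :=
  fun h c => ((elimState 𝒜 T G δ h).prepare 𝒜 T G δ h c).todo.headD 0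

/-! ### A machine model with a step count

Programs of a real random-access machine in structured form. The memory holds arrays of natural
numbers and arrays of real numbers; a cell is given by the name of an array and three indices.
On natural numbers there are only addition and truncated subtraction; on real numbers there are the
arithmetic operations, square root and logarithm. Real numbers influence natural numbers only
through comparisons, and the only constants are natural numbers. Every operation costs one step. -/

/-- The memory. -/
structure Store where
  nat : ℕ → ℕ × ℕ × ℕ → ℕ
  real : ℕ → ℕ × ℕ × ℕ → ℝ

/-- Expressions with values in `ℕ`; `get x i j k` reads the cell `(i, j, k)` of array `x`. -/
inductive NExp where
  | lit (n : ℕ)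
  | get (x : ℕ) (i j k : NExp)
  | add (e f : NExp)
  | sub (e f : NExp)

/-- Expressions with values in `ℝ`. -/
inductive RExp where
  | ofNat (e : NExp)
  | get (x : ℕ) (i j k : NExp)
  | add (e f : RExp)
  | sub (e f : RExp)
  | mul (e f : RExp)
  | div (e f : RExp)
  | sqrt (e : RExp)
  | log (e : RExp)

/-- Tests. -/
inductive BExp where
  | nle (e f : NExp)
  | rle (e f : RExp)
  | not (b : BExp)
  | and (b d : BExp)

/-- Programs. `loop x e body` runs `body` for each value `0, …, n - 1` of the cell `(0, 0, 0)` of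
the array `x` of natural numbers, where `n` is the value of `e` at the start of the loop. -/
inductive Cmd where
  | skip
  | setNat (x : ℕ) (i j k : NExp) (e : NExp)
  | setReal (x : ℕ) (i j k : NExp) (e : RExp)
  | seq (p q : Cmd)
  | ite (b : BExp) (p q : Cmd)
  | loop (x : ℕ) (e : NExp) (body : Cmd)

def Store.setNat (σ : Store) (x : ℕ) (p : ℕ × ℕ × ℕ) (v : ℕ) : Store :=
  { σ with nat := Function.update σ.nat x (Function.update (σ.nat x) p v) }

def Store.setReal (σ : Store) (x : ℕ) (p : ℕ × ℕ × ℕ) (v : ℝ) : Store :=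
  { σ with real := Function.update σ.real x (Function.update (σ.real x) p v) }

def NExp.eval (σ : Store) : NExp → ℕ
  | lit n => n
  | get x i j k => σ.nat x (i.eval σ, j.eval σ, k.eval σ)
  | add e f => e.eval σ + f.eval σ
  | sub e f => e.eval σ - f.eval σ

def RExp.eval (σ : Store) : RExp → ℝ
  | ofNat e => (e.eval σ : ℝ)
  | get x i j k => σ.real x (i.eval σ, j.eval σ, k.eval σ)
  | add e f => e.eval σ + f.eval σ
  | sub e f => e.eval σ - f.eval σ
  | mul e f => e.eval σ * f.eval σ
  | div e f => e.eval σ / f.eval σ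
  | sqrt e => √(e.eval σ)
  | log e => Real.log (e.eval σ)

def BExp.holds (σ : Store) : BExp → Prop
  | nle e f => e.eval σ ≤ f.eval σ
  | rle e f => e.eval σ ≤ f.eval σ
  | not b => ¬ b.holds σ
  | and b d => b.holds σ ∧ d.holds σ

/-- The number of steps to evaluate an expression. -/
def NExp.cost : NExp → ℕ
  | lit _ => 1
  | get _ i j k => i.cost + j.cost + k.cost + 1
  | add e f => e.cost + f.cost + 1
  | sub e f => e.cost + f.cost + 1

def RExp.cost : RExp → ℕ
  | ofNat e => e.cost + 1
  | get _ i j k => i.cost + j.cost + k.cost + 1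
  | add e f => e.cost + f.cost + 1
  | sub e f => e.cost + f.cost + 1
  | mul e f => e.cost + f.cost + 1
  | div e f => e.cost + f.cost + 1
  | sqrt e => e.cost + 1
  | log e => e.cost + 1

def BExp.cost : BExp → ℕ
  | nle e f => e.cost + f.cost + 1
  | rle e f => e.cost + f.cost + 1
  | not b => b.cost + 1
  | and b d => b.cost + d.cost + 1

/-- Run a program: the final memory and the number of steps. -/
def Cmd.exec : Cmd → Store → Store × ℕ
  | skip, σ => (σ, 1)
  | setNat x i j k e, σ =>
    (σ.setNat x (i.eval σ, j.eval σ, k.eval σ) (e.eval σ),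
      i.cost + j.cost + k.cost + e.cost + 1)
  | setReal x i j k e, σ =>
    (σ.setReal x (i.eval σ, j.eval σ, k.eval σ) (e.eval σ),
      i.cost + j.cost + k.cost + e.cost + 1)
  | seq p q, σ => ((q.exec (p.exec σ).1).1, (p.exec σ).2 + (q.exec (p.exec σ).1).2)
  | ite b p q, σ =>
    open scoped Classical in
    if b.holds σ then ((p.exec σ).1, b.cost + (p.exec σ).2 + 1)
    else ((q.exec σ).1, b.cost + (q.exec σ).2 + 1)
  | loop x e body, σ =>
    Nat.rec (motive := fun _ => Store × ℕ) (σ, e.cost + 1)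
      (fun i s =>
        ((body.exec (s.1.setNat x (0, 0, 0) i)).1,
          s.2 + (body.exec (s.1.setNat x (0, 0, 0) i)).2 + 1))
      (e.eval σ)

/-- The input of a policy program. Natural numbers: `T`, `M`, `K`, the adjacency matrix, the number
of past rounds, the contexts of the past rounds and of the current one, the past actions.
Real numbers: `δ` and the observed rewards. All other cells are `0`.
The past rounds `h` are given newest first and stored oldest first. -/
def encodeInput (T : ℕ) {M K : ℕ} (G : Digraph (Fin K)) (δ : ℝ) (h : List (Round M K))
    (c : Fin M) : Store where
  nat
    | 0, (0, 0, 0) => T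
    | 1, (0, 0, 0) => M
    | 2, (0, 0, 0) => K
    | 3, (i, j, 0) =>
      open scoped Classical in
      if ∃ (hi : i < K) (hj : j < K), G.Adj ⟨i, hi⟩ ⟨j, hj⟩ then 1 else 0
    | 4, (0, 0, 0) => h.length
    | 5, (s, 0, 0) =>
      if s = h.length then c else (h.reverse[s]?.map fun x => (x.ctx : ℕ)).getD 0
    | 6, (s, 0, 0) => (h.reverse[s]?.map fun x => (x.act : ℕ)).getD 0
    | _, _ => 0
  real
    | 0, (0, 0, 0) => δ
    | 1, (s, i, j) =>
      if hij : i < M ∧ j < K then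
        (h.reverse[s]?.map fun x => x.obs ⟨i, hij.1⟩ ⟨j, hij.2⟩).getD 0
      else 0
    | _, _ => 0

/-- The output cell of a policy program. -/
def Store.output (σ : Store) : ℕ := σ.nat 7 (0, 0, 0)

/-- A family of policies, one for each horizon, number of contexts, feedback graph and failure
probability. -/
abbrev PolicyFamily := ℕ → ∀ (M K : ℕ) [NeZero K], Digraph (Fin K) → ℝ → Policy M K

/-- One program computes the action of each round from what the learner knows at that time, in a
number of steps that is polynomial in `T + M + K`. -/
def PolicyFamily.PolyTime (π : PolicyFamily) : Prop :=
  ∃ (p : Cmd) (poly : Polynomial ℕ), ∀ (T M K : ℕ) [NeZero K] (G : Digraph (Fin K)),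
    (∀ a, G.Adj a a) → ∀ δ : ℝ, 0 < δ → δ < 1 →
    ∀ (c : Fin T → Fin M) (r : Fin T → Fin M → Fin K → ℝ) (t : Fin T),
      let run := p.exec
        (encodeInput T G δ (history (π T M K G δ) G c r t t.isLt.le) (c t))
      run.1.output = (action (π T M K G δ) G c r t : ℕ) ∧ run.2 ≤ poly.eval (T + M + K)

end

end GraphBandit

open GraphBandit

/-! Domination. For a set A the strategy lowers a threshold d from K to 1. While all out-degrees
within the undominated rest R are at most d, half of R has in-degree at most 2d, and a maximal
independent set of such vertices blocks at most 3d vertices per member; so it has at least |R|/(6d)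
elements (`card_le_greedyIndep`). A vertex picked at threshold d dominates at least d new vertices,
hence costs at most 6b/|R| per dominated vertex, where b is the size of the largest independent set
found. Summing the charges gives a dominating set of at most 6 b H_|A| vertices (`domPhases_spec`).
The answer lists the independent set before the dominating set, so every initial segment, and in
particular an answer cut off by a change of context, contains an independent set of proportional
size (`dominateList_prefix`). The independent sets of successive moves avoid what earlier answers
observed, so they form a family admissible for β_M(G), and the cost is at most `domRatio K` times
β_M(G) (`Thrifty.sum_length_le`).

Elimination. A round reveals rewards for all contexts, so what earlier contexts observed on a layer
also serves the current one. An action active at the end of layer ℓ was observed on each of the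
layers 1, …, ℓ, hence in ℓ distinct rounds, and its empirical reward has error at most √(w/ℓ) with w
= log(2MKT/δ). The best action therefore survives, and actions active on layer ℓ have gap at most
6√(w/ℓ) (`Running.advance`). Since contexts do not return, each adds at most one move per layer; so
every layer carries a game of at most M moves, and at most N = `domRatio K` · β_M(G) rounds are
played on it (`Valid.count_le`). Under this constraint T rounds have total gap O(√(w N T))
(`sum_inv_sqrt_list_le`).

Probability. Whether a round reveals an action is decided by the earlier rewards, and the rewards of
the round itself are independent of these. So the exponential weight of the centred observations has
expectation at most 1 despite the adaptive choices (`lintegral_expWeight_le`), and a Chernoff and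
union bound makes all empirical rewards accurate. Measurability is obtained by freezing the finitely
many possible action sequences.

Running time. One program replays all past rounds. As the strategy ignores the transcript, the
program only has to remember which actions were observed on each layer. All its loops run over the
vertices or over the rounds (`armElimCmd_spec`, `exec_cost_le`). -/

namespace GraphBandit
open scoped Classical

/-! ### The dominating strategy -/

section Strategy
variable {K : ℕ} (G : Digraph (Fin K))

/-- The in-degree of `u` within `R`. -/
noncomputable def inDeg (R : Finset (Fin K)) (u : Fin K) : ℕ := (R.filter fun w => G.Adj w u).card

/-- The out-degree of `v` within `R`. -/
noncomputable def outDeg (R : Finset (Fin K)) (v : Fin K) : ℕ := (R.filter fun w => G.Adj v w).card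

noncomputable def indepStep (S I : Finset (Fin K)) (u : Fin K) : Finset (Fin K) :=
  if u ∈ S ∧ ∀ w ∈ I, ¬ (G.Adj u w ∨ G.Adj w u) then insert u I else I

/-- The lexicographically first maximal independent subset of `S`. -/
noncomputable def greedyIndep (S : Finset (Fin K)) : Finset (Fin K) :=
  (List.finRange K).foldl (indepStep G S) ∅

/-- The vertices of `R` whose in-degree within `R` is at most `2 d`. -/
noncomputable def lowIn (R : Finset (Fin K)) (d : ℕ) : Finset (Fin K) :=
  R.filter fun u => inDeg G R u ≤ d + d

/-- A state of the greedy domination: the vertices not yet dominated, the vertices picked. -/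
noncomputable def pickStep (d : ℕ) (p : Finset (Fin K) × Finset (Fin K)) (v : Fin K) :
    Finset (Fin K) × Finset (Fin K) :=
  if v ∈ p.1 ∧ d ≤ outDeg G p.1 v then (p.1 \ outNbrs G {v}, insert v p.2) else p

/-- A state of the strategy's computation. -/
structure DomState (K : ℕ) where
  /-- the vertices not yet dominated -/
  rest : Finset (Fin K)
  /-- the vertices picked for the dominating set -/
  dom : Finset (Fin K)
  /-- the largest independent set found so far -/
  best : Finset (Fin K)

noncomputable def largerOf (I J : Finset (Fin K)) : Finset (Fin K) :=
  if I.card < J.card then J else I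

/-- One phase: look for an independent set, then pick all vertices of out-degree at least `K - i`. -/
noncomputable def domPhase (s : DomState K) (i : Fin K) : DomState K :=
  let q := (List.finRange K).foldl (pickStep G (K - i)) (s.rest, s.dom)
  ⟨q.1, q.2, largerOf s.best (greedyIndep G (lowIn G s.rest (K - i)))⟩

noncomputable def domPhases (A : Finset (Fin K)) : DomState K :=
  (List.finRange K).foldl (domPhase G) ⟨A, ∅, ∅⟩

/-- The strategy answers with an independent set followed by a greedy dominating set. -/
noncomputable def dominateList (A : Finset (Fin K)) : List (Fin K) :=
  (List.finRange K).filter (fun v => v ∈ (domPhases G A).best) ++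
    (List.finRange K).filter
      (fun v => v ∈ (domPhases G A).dom ∧ v ∉ (domPhases G A).best)

end Strategy

/-- The strategy for sequential game I. It only looks at the current set of the adversary. -/
noncomputable def dominate : GameAlg := fun _ G _ A => dominateList G A

section Strategy
variable {K : ℕ} {G : Digraph (Fin K)}

/-! ### Analysis of the greedy domination and the cost of the game -/

theorem mem_outNbrs {D : Finset (Fin K)} {v : Fin K} :
    v ∈ outNbrs G D ↔ ∃ u ∈ D, G.Adj u v := by simp [outNbrs]

theorem outNbrs_mono {D E : Finset (Fin K)} (h : D ⊆ E) : outNbrs G D ⊆ outNbrs G E := by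
  intro v; simp only [mem_outNbrs]; rintro ⟨u, hu, h'⟩; exact ⟨u, h hu, h'⟩

theorem outNbrs_union (D E : Finset (Fin K)) : outNbrs G (D ∪ E) = outNbrs G D ∪ outNbrs G E := by
  ext v; simp only [mem_outNbrs, Finset.mem_union, or_and_right, exists_or]

/-- The invariant of a fold over all of `Fin K`: what holds after the element `v` was processed. -/
theorem foldl_finRange_invariant {S : Type*} (f : S → Fin K → S) (Q : ℕ → S → Prop) (s : S)
    (h0 : Q 0 s) (hs : ∀ (i : Fin K) s, Q i s → Q (i + 1) (f s i)) :
    Q K ((List.finRange K).foldl f s) := by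
  have key : ∀ n ≤ K, Q n (((List.finRange K).take n).foldl f s) := by
    intro n
    induction n with
    | zero => intro _; simpa using h0
    | succ n ih =>
      intro hn
      have hl : n < (List.finRange K).length := by simpa using hn
      rw [List.take_succ_eq_append_getElem hl, List.foldl_append]
      have := hs ⟨n, hn⟩ _ (ih (by omega))
      simpa using this
  have := key K le_rfl
  rwa [List.take_of_length_le (by simp)] at this

/-- A vertex is rejected only because of a neighbour already taken, and taken vertices stay; this
gives maximality. -/
theorem greedyIndep_spec (S : Finset (Fin K)) :
    greedyIndep G S ⊆ S ∧ IsIndep G (greedyIndep G S) ∧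
      ∀ u ∈ S, u ∈ greedyIndep G S ∨ ∃ w ∈ greedyIndep G S, G.Adj u w ∨ G.Adj w u := by
  have := foldl_finRange_invariant (indepStep G S)
    (fun n I => I ⊆ S ∧ IsIndep G I ∧
      ∀ u : Fin K, u.1 < n → u ∈ S → u ∈ I ∨ ∃ w ∈ I, G.Adj u w ∨ G.Adj w u) ∅
    ⟨by simp, by simp [IsIndep], by simp⟩ (by
      rintro i I ⟨h1, h2, h3⟩
      unfold indepStep
      split_ifs with h
      · refine ⟨Finset.insert_subset h.1 h1, ?_, ?_⟩
        · intro u hu v hv huv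
          rw [Finset.mem_insert] at hu hv
          rcases hu with rfl | hu <;> rcases hv with rfl | hv
          · exact absurd rfl huv
          · exact fun hh => h.2 v hv (Or.inl hh)
          · exact fun hh => h.2 u hu (Or.inr hh)
          · exact h2 u hu v hv huv
        · intro u hu huS
          rcases Nat.lt_succ_iff_lt_or_eq.mp hu with hu | hu
          · rcases h3 u hu huS with h | ⟨w, hw, h⟩
            · exact Or.inl (Finset.mem_insert_of_mem h)
            · exact Or.inr ⟨w, Finset.mem_insert_of_mem hw, h⟩
          · left; rw [Fin.ext hu]; exact Finset.mem_insert_self _ _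
      · refine ⟨h1, h2, ?_⟩
        intro u hu huS
        rcases Nat.lt_succ_iff_lt_or_eq.mp hu with hu | hu
        · exact h3 u hu huS
        · right
          have hu' := Fin.ext hu
          subst hu'
          push Not at h
          obtain ⟨w, hw, h⟩ := h huS
          exact ⟨w, hw, h⟩)
  exact ⟨this.1, this.2.1, fun u => this.2.2 u u.2⟩

theorem lowIn_subset (R : Finset (Fin K)) (d : ℕ) : lowIn G R d ⊆ R := Finset.filter_subset _ _

/-- If all out-degrees within `R` are at most `d`, then the greedy independent set has at least
`|R| / (6 d)` elements. -/
theorem card_le_greedyIndep (hG : ∀ a, G.Adj a a) (R : Finset (Fin K)) (d : ℕ) (hd : 0 < d)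
    (hR : ∀ v ∈ R, outDeg G R v ≤ d) :
    R.card ≤ 6 * d * (greedyIndep G (lowIn G R d)).card := by
  obtain ⟨h1, -, h3⟩ := greedyIndep_spec (G := G) (lowIn G R d)
  set I := greedyIndep G (lowIn G R d)
  -- Markov's inequality: the average in-degree equals the average out-degree, which is at most `d`,
  -- so at most half of the vertices have in-degree above `2 d`.
  have hlow : R.card ≤ 2 * (lowIn G R d).card := by
    have hsum : ∑ u ∈ R, inDeg G R u = ∑ v ∈ R, outDeg G R v := by
      simp only [inDeg, outDeg, Finset.card_filter]
      exact Finset.sum_comm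
    have h4 : ∑ v ∈ R, outDeg G R v ≤ R.card * d := by
      simpa using Finset.sum_le_sum hR
    have h5 : (R \ lowIn G R d).card * (2 * d) ≤ ∑ u ∈ R, inDeg G R u := by
      calc (R \ lowIn G R d).card * (2 * d) = ∑ _u ∈ R \ lowIn G R d, 2 * d := by simp
        _ ≤ ∑ u ∈ R \ lowIn G R d, inDeg G R u := by
            apply Finset.sum_le_sum
            intro u hu
            simp only [lowIn, Finset.mem_sdiff, Finset.mem_filter, not_and, not_le] at hu
            have := hu.2 hu.1
            omega
        _ ≤ _ := Finset.sum_le_sum_of_subset Finset.sdiff_subset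
    have h6 := Finset.card_sdiff_add_card_eq_card (lowIn_subset (G := G) R d)
    have h7 : (R \ lowIn G R d).card * 2 ≤ R.card := by
      refine Nat.le_of_mul_le_mul_right ?_ hd
      nlinarith
    omega
  -- By maximality each low vertex is a neighbour of a member of `I`, members being covered through
  -- their self-loops. A member has at most `d` out-neighbours and `2 d` in-neighbours in `R`.
  have hcov : lowIn G R d ⊆ I.biUnion fun w =>
      (R.filter fun u => G.Adj w u) ∪ (R.filter fun u => G.Adj u w) := by
    intro u hu
    have huR := lowIn_subset R d hu
    simp only [Finset.mem_biUnion, Finset.mem_union, Finset.mem_filter]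
    rcases h3 u hu with h | ⟨w, hw, h⟩
    · exact ⟨u, h, Or.inl ⟨huR, hG u⟩⟩
    · exact ⟨w, hw, h.elim (fun h => Or.inr ⟨huR, h⟩) fun h => Or.inl ⟨huR, h⟩⟩
  have hle : (lowIn G R d).card ≤ I.card * (3 * d) := by
    refine (Finset.card_le_card hcov).trans (Finset.card_biUnion_le_card_mul _ _ _ ?_)
    intro w hw
    have hw' := h1 hw
    have h5 := hR w (lowIn_subset R d hw')
    have h6 : inDeg G R w ≤ d + d := (Finset.mem_filter.mp hw').2
    refine (Finset.card_union_le _ _).trans ?_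
    unfold outDeg at h5
    unfold inDeg at h6
    omega
  nlinarith

theorem outDeg_mono {R R' : Finset (Fin K)} (h : R ⊆ R') (v : Fin K) :
    outDeg G R v ≤ outDeg G R' v :=
  Finset.card_le_card (Finset.filter_subset_filter _ h)

/-- One pass suffices: out-degrees only fall as the rest shrinks, so a skipped vertex stays below
the threshold, and a picked one removes itself by its self-loop. A pick removes at least `d`
vertices, so the potential (picked) · `d` + (rest) never grows. -/
theorem pick_fold_spec (hG : ∀ a, G.Adj a a) (d : ℕ) (R D : Finset (Fin K)) :
    let q := (List.finRange K).foldl (pickStep G d) (R, D)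
    q.1 ⊆ R ∧ D ⊆ q.2 ∧ q.2 ⊆ D ∪ R ∧ R ⊆ q.1 ∪ outNbrs G q.2 ∧
      q.2.card * d + q.1.card ≤ D.card * d + R.card ∧
      ∀ v ∈ q.1, outDeg G q.1 v < d := by
  intro q
  have := foldl_finRange_invariant (pickStep G d)
    (fun n q => q.1 ⊆ R ∧ D ⊆ q.2 ∧ q.2 ⊆ D ∪ R ∧ R ⊆ q.1 ∪ outNbrs G q.2 ∧
      q.2.card * d + q.1.card ≤ D.card * d + R.card ∧
      ∀ v ∈ q.1, v.1 < n → outDeg G q.1 v < d) (R, D)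
    ⟨by simp, by simp, by simp, by simp, by simp, by simp⟩ (by
      rintro i ⟨R', D'⟩ ⟨h1, h2, h3, h4, h5, h6⟩
      dsimp only at h1 h2 h3 h4 h5 h6
      unfold pickStep
      dsimp only
      split_ifs with h
      · have hsub : R' \ outNbrs G {i} ⊆ R' := Finset.sdiff_subset
        refine ⟨hsub.trans h1, h2.trans (Finset.subset_insert _ _), ?_, ?_, ?_, ?_⟩
        · exact Finset.insert_subset (Finset.mem_union_right _ (h1 h.1)) h3
        · intro v hv
          have hv' := h4 hv
          rw [Finset.mem_union] at hv' ⊢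
          by_cases hvi : v ∈ outNbrs G {i}
          · right
            exact outNbrs_mono (by simp) hvi
          · rcases hv' with hv' | hv'
            · exact Or.inl (Finset.mem_sdiff.mpr ⟨hv', hvi⟩)
            · exact Or.inr (outNbrs_mono (Finset.subset_insert _ _) hv')
        · have e : R'.filter (fun w => G.Adj i w) = R' ∩ outNbrs G {i} := by
            ext v; simp [mem_outNbrs]
          have h7 := h.2
          unfold outDeg at h7
          have h8 := Finset.card_sdiff_add_card_inter R' (outNbrs G {i})
          have h9 := Finset.card_insert_le i D'
          rw [e] at h7
          nlinarith
        · intro v hv hvn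
          have hvR : v ∈ R' := hsub hv
          rcases Nat.lt_succ_iff_lt_or_eq.mp hvn with hvn | hvn
          · exact (outDeg_mono hsub v).trans_lt (h6 v hvR hvn)
          · rw [Fin.ext hvn] at hv
            exact absurd (mem_outNbrs.mpr ⟨i, by simp, hG i⟩) (Finset.mem_sdiff.mp hv).2
      · refine ⟨h1, h2, h3, h4, h5, ?_⟩
        intro v hv hvn
        rcases Nat.lt_succ_iff_lt_or_eq.mp hvn with hvn | hvn
        · exact h6 v hv hvn
        · rw [Fin.ext hvn] at hv ⊢
          exact not_le.mp fun hle => h ⟨hv, hle⟩)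
  exact ⟨this.1, this.2.1, this.2.2.1, this.2.2.2.1, this.2.2.2.2.1,
    fun v hv => this.2.2.2.2.2 v hv v.2⟩

/-- Each of the `n - m` reciprocals in the difference is at least `1 / n`. This turns charges of `1
/ |R|` per removed vertex into a telescoping sum over the phases. -/
theorem sub_div_le_harmonic_sub {m n : ℕ} (h : m ≤ n) :
    ((n : ℝ) - m) / n ≤ (harmonic n : ℝ) - harmonic m := by
  induction h using Nat.decreasingInduction with
  | self => simp
  | of_succ m hm ih =>
    have hm' : (m : ℝ) + 1 ≤ n := by exact_mod_cast hm
    have h1 : ((n : ℝ) - m) / n = (n - (m + 1 : ℕ)) / n + 1 / n := by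
      push_cast; rw [← add_div]; congr 1; ring
    have h2 : (1 : ℝ) / n ≤ 1 / (m + 1) := one_div_le_one_div_of_le (by positivity) hm'
    rw [harmonic_succ] at ih
    push_cast at ih h1
    rw [h1]
    rw [one_div ((m : ℝ) + 1)] at h2
    linarith

theorem largerOf_spec (I J : Finset (Fin K)) :
    I.card ≤ (largerOf I J).card ∧ J.card ≤ (largerOf I J).card := by
  unfold largerOf; split_ifs <;> omega

/-- Before phase `n` all out-degrees within the rest are at most `K - n`, so the independent set of
the phase is large enough to pay for its picks. The running bound charges the picks so far to the
drop of the harmonic number from `A` to the rest. -/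
theorem domPhases_spec (hG : ∀ a, G.Adj a a) (A : Finset (Fin K)) :
    let s := domPhases G A
    s.best ⊆ A ∧ IsIndep G s.best ∧ s.dom ⊆ A ∧ A ⊆ outNbrs G s.dom ∧
      (s.dom.card : ℝ) ≤ 6 * s.best.card * harmonic A.card := by
  intro s
  have := foldl_finRange_invariant (domPhase G)
    (fun n s => s.best ⊆ A ∧ IsIndep G s.best ∧ s.dom ⊆ A ∧ s.rest ⊆ A ∧
      A ⊆ s.rest ∪ outNbrs G s.dom ∧ (∀ v ∈ s.rest, outDeg G s.rest v ≤ K - n) ∧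
      (s.dom.card : ℝ) ≤ 6 * s.best.card * (harmonic A.card - harmonic s.rest.card))
    ⟨A, ∅, ∅⟩
    ⟨by simp, by simp [IsIndep], by simp, by simp, by simp, by
        intro v _
        exact (Finset.card_le_univ (A.filter fun w => G.Adj v w)).trans (by simp), by simp⟩ (by
      rintro i ⟨R, D, best⟩ ⟨h1, h2, h3, h4, h5, h6, h7⟩
      dsimp only at h1 h2 h3 h4 h5 h6 h7
      have hd : 0 < K - i := by omega
      obtain ⟨g1, g2, g3, g4, g5, g6⟩ := pick_fold_spec hG (K - i) R D
      have hcard := card_le_greedyIndep hG R (K - i) hd h6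
      obtain ⟨k1, k2, -⟩ := greedyIndep_spec (G := G) (lowIn G R (K - i))
      unfold domPhase
      dsimp only
      set q := (List.finRange K).foldl (pickStep G (K - i)) (R, D)
      set I := greedyIndep G (lowIn G R (K - i))
      obtain ⟨b1, b2⟩ := largerOf_spec best I
      refine ⟨?_, ?_, ?_, g1.trans h4, ?_, ?_, ?_⟩
      · unfold largerOf
        split_ifs
        exacts [k1.trans ((lowIn_subset _ _).trans h4), h1]
      · unfold largerOf
        split_ifs
        exacts [k2, h2]
      · exact g3.trans (Finset.union_subset h3 h4)
      · intro v hv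
        rcases Finset.mem_union.mp (h5 hv) with h | h
        · exact g4 h
        · exact Finset.mem_union_right _ (outNbrs_mono g2 h)
      · intro v hv
        have := g6 v hv
        omega
      · have hRq : q.1.card ≤ R.card := Finset.card_le_card g1
        have hDq : D.card ≤ q.2.card := Finset.card_le_card g2
        have hharm := sub_div_le_harmonic_sub hRq
        set b := (largerOf best I).card
        have hRA : (0 : ℝ) ≤ (harmonic A.card : ℝ) - harmonic R.card := by
          refine le_trans ?_ (sub_div_le_harmonic_sub (Finset.card_le_card h4))
          have : (R.card : ℝ) ≤ A.card := by exact_mod_cast Finset.card_le_card h4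
          exact div_nonneg (by linarith) (by positivity)
        have e1 : (D.card : ℝ) ≤ 6 * b * (harmonic A.card - harmonic R.card) := by
          refine h7.trans ?_
          have : (best.card : ℝ) ≤ b := by exact_mod_cast b1
          gcongr
        -- With `d = K - i`: picks · `d` is at most the number of removed vertices, which is at most
        -- `|R|` times the harmonic drop, and `|R| ≤ 6 d b`; then `d` cancels.
        have e2 : (q.2.card : ℝ) - D.card ≤ 6 * b * (harmonic R.card - harmonic q.1.card) := by
          rcases Nat.eq_zero_or_pos R.card with hR0 | hR0
          · have hq0 : q.1.card = 0 := by omega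
            have : q.2.card ≤ D.card := by
              refine Nat.le_of_mul_le_mul_right ?_ hd
              omega
            have : (q.2.card : ℝ) ≤ D.card := by exact_mod_cast this
            rw [hR0, hq0]; simpa using this
          · have hR0' : (0 : ℝ) < R.card := by exact_mod_cast hR0
            have f1 : ((q.2.card : ℝ) - D.card) * (K - i : ℕ) ≤ R.card - q.1.card := by
              have : (q.2.card * (K - i : ℕ) + q.1.card : ℝ) ≤ D.card * (K - i : ℕ) + R.card := by
                exact_mod_cast g5
              linarith
            have f2 : (R.card : ℝ) ≤ 6 * (K - i : ℕ) * b := by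
              have : R.card ≤ 6 * (K - i) * b := hcard.trans (Nat.mul_le_mul_left _ b2)
              exact_mod_cast this
            have f3 : ((R.card : ℝ) - q.1.card) ≤ R.card * (harmonic R.card - harmonic q.1.card) := by
              rw [div_le_iff₀ hR0'] at hharm
              linarith
            have hd' : (0 : ℝ) < (K - i : ℕ) := by exact_mod_cast hd
            have hh : (0 : ℝ) ≤ harmonic R.card - harmonic q.1.card := by
              refine le_trans ?_ hharm
              have : (q.1.card : ℝ) ≤ R.card := by exact_mod_cast hRq
              exact div_nonneg (by linarith) hR0'.le
            have f4 := mul_le_mul_of_nonneg_right f2 hh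
            have f5 : ((q.2.card : ℝ) - D.card) * (K - i : ℕ) ≤
              (6 * b * (harmonic R.card - harmonic q.1.card)) * (K - i : ℕ) := by
              linarith
            exact le_of_mul_le_mul_right f5 hd'
        linarith)
  obtain ⟨h1, h2, h3, h4, h5, h6, h7⟩ := this
  -- After the last phase the bound on out-degrees is `0`, whereas a self-loop contributes `1`.
  have hempty : s.rest = ∅ := by
    refine Finset.eq_empty_of_forall_notMem fun v hv => ?_
    have := h6 v hv
    simp only [Nat.sub_self, Nat.le_zero, outDeg, Finset.card_eq_zero] at this
    exact Finset.notMem_empty v (this ▸ Finset.mem_filter.mpr ⟨hv, hG v⟩)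
  have h7' : (s.dom.card : ℝ) ≤ 6 * s.best.card * (harmonic A.card - harmonic s.rest.card) := h7
  have h5' : A ⊆ s.rest ∪ outNbrs G s.dom := h5
  rw [hempty] at h5' h7'
  exact ⟨h1, h2, h3, by simpa using h5', by simpa using h7'⟩

theorem dominateList_spec (hG : ∀ a, G.Adj a a) (A : Finset (Fin K)) :
    (dominateList G A).Nodup ∧ (dominateList G A).toFinset ⊆ A ∧
      A ⊆ outNbrs G (dominateList G A).toFinset := by
  obtain ⟨h1, h2, h3, h4, -⟩ := domPhases_spec hG A
  refine ⟨?_, ?_, ?_⟩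
  · unfold dominateList
    refine List.Nodup.append ((List.nodup_finRange K).filter _)
      ((List.nodup_finRange K).filter _) ?_
    intro v hv hv'
    simp only [List.mem_filter, decide_eq_true_eq] at hv hv'
    exact hv'.2.2 hv.2
  · intro v
    simp only [dominateList, List.toFinset_append, Finset.mem_union, List.mem_toFinset,
      List.mem_filter, List.mem_finRange, decide_eq_true_eq, true_and]
    rintro (h | h)
    exacts [h1 h, h3 h.1]
  · refine h4.trans (outNbrs_mono ?_)
    intro v hv
    simp only [dominateList, List.toFinset_append, Finset.mem_union, List.mem_toFinset,
      List.mem_filter, List.mem_finRange, decide_eq_true_eq, true_and]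
    tauto

theorem dominate_legal : dominate.Legal := fun _ _ hG _ A => dominateList_spec hG A

/-- The ratio between the answers of the strategy and the independent sets they contain. -/
noncomputable def domRatio (K : ℕ) : ℝ := 30 * Real.log K ^ 2

/-- The left side is what the analysis gives: `1` for the independent set and `6 (1 + log K)` for
the dominating set. The squared logarithm absorbs the constant because `log K ≥ log 2 > 0.69`. -/
theorem domRatio_bound (hK : 2 ≤ K) : 7 + 6 * Real.log K ≤ domRatio K := by
  have h2 : Real.log 2 ≤ Real.log K := Real.log_le_log (by norm_num) (by exact_mod_cast hK)
  have h3 := Real.log_two_gt_d9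
  unfold domRatio
  nlinarith

theorem one_le_domRatio (hK : 2 ≤ K) : 1 ≤ domRatio K := by
  have := domRatio_bound hK
  have : 0 ≤ Real.log K := Real.log_natCast_nonneg K
  linarith

/-- Every initial segment of an answer contains a proportionally large independent set. -/
theorem dominateList_prefix (hK : 2 ≤ K) (hG : ∀ a, G.Adj a a) (A : Finset (Fin K))
    {p : List (Fin K)} (hp : p <+: dominateList G A) :
    ∃ I ⊆ p.toFinset, IsIndep G I ∧ (p.length : ℝ) ≤ domRatio K * I.card := by
  obtain ⟨h1, h2, h3, h4, h5⟩ := domPhases_spec hG A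
  have hnd := (dominateList_spec hG A).1
  have hpn : p.Nodup := hnd.sublist hp.sublist
  unfold dominateList at hp
  set s := domPhases G A
  set L := (List.finRange K).filter (fun v => v ∈ s.best) with hL
  set L' := (List.finRange K).filter (fun v => v ∈ s.dom ∧ v ∉ s.best)
  have hLs : L.toFinset = s.best := by ext v; simp [hL]
  have hLc : L.length = s.best.card := by
    rw [← hLs, List.toFinset_card_of_nodup ((List.nodup_finRange K).filter _)]
  have hL'c : L'.length ≤ s.dom.card := by
    rw [← List.toFinset_card_of_nodup ((List.nodup_finRange K).filter _)]
    refine Finset.card_le_card fun v => ?_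
    simp
    tauto
  -- A segment that ends within the independent part is itself independent; a longer one contains
  -- the whole independent set.
  rcases le_total p.length L.length with hle | hle
  · have hpL : p <+: L := List.prefix_of_prefix_length_le hp (List.prefix_append _ _) hle
    refine ⟨p.toFinset, subset_rfl, ?_, ?_⟩
    · intro u hu v hv
      have key : ∀ w ∈ p.toFinset, w ∈ s.best := fun w hw => by
        rw [← hLs]; exact List.mem_toFinset.mpr (hpL.subset (List.mem_toFinset.mp hw))
      exact h2 u (key u hu) v (key v hv)
    · rw [List.toFinset_card_of_nodup hpn]
      have := one_le_domRatio hK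
      nlinarith [(Nat.cast_nonneg p.length : (0 : ℝ) ≤ p.length)]
  · have hpL : L <+: p := List.prefix_of_prefix_length_le (List.prefix_append _ _) hp hle
    refine ⟨s.best, ?_, h2, ?_⟩
    · rw [← hLs]
      intro v hv
      exact List.mem_toFinset.mpr (hpL.subset (List.mem_toFinset.mp hv))
    · have hlen : p.length ≤ s.best.card + s.dom.card := by
        have := hp.length_le
        rw [List.length_append] at this
        omega
      have hlen' : (p.length : ℝ) ≤ s.best.card + s.dom.card := by exact_mod_cast hlen
      have hA : (harmonic A.card : ℝ) ≤ 1 + Real.log K := by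
        refine le_trans ?_ (harmonic_le_one_add_log K)
        have hAK : A.card ≤ K := by simpa using Finset.card_le_univ A
        have := sub_div_le_harmonic_sub hAK
        have h0 : (0 : ℝ) ≤ ((K : ℝ) - A.card) / K :=
          div_nonneg (by have : (A.card : ℝ) ≤ K := by exact_mod_cast hAK
                         linarith) (by positivity)
        linarith
      have hb : (0 : ℝ) ≤ s.best.card := by positivity
      have h6 := mul_le_mul_of_nonneg_left hA (mul_nonneg (by norm_num : (0 : ℝ) ≤ 6) hb)
      have h7 := mul_le_mul_of_nonneg_right (domRatio_bound hK) hb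
      nlinarith

/-- Transcripts whose answers contain proportionally large independent sets of vertices that the
earlier answers did not observe. -/
def Thrifty (G : Digraph (Fin K)) (B : ℝ) (h : Transcript K) : Prop :=
  ∀ i (hi : i < h.length), Disjoint (h[i]).2.toFinset (covered G (h.take i)) ∧
    ∃ I ⊆ (h[i]).2.toFinset, IsIndep G I ∧ ((h[i]).2.length : ℝ) ≤ B * I.card

theorem thrifty_nil (B : ℝ) : Thrifty G B [] := by intro i hi; simp at hi

theorem Thrifty.append {B : ℝ} {h : Transcript K} (hh : Thrifty G B h)
    {p : Finset (Fin K) × List (Fin K)} (h1 : Disjoint p.2.toFinset (covered G h))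
    (h2 : ∃ I ⊆ p.2.toFinset, IsIndep G I ∧ (p.2.length : ℝ) ≤ B * I.card) :
    Thrifty G B (h ++ [p]) := by
  intro i hi
  rcases Nat.lt_or_ge i h.length with hi' | hi'
  · rw [List.getElem_append_left hi', List.take_append_of_le_length hi'.le]
    exact hh i hi'
  · obtain rfl : i = h.length := by simp at hi; omega
    simpa using ⟨h1, h2⟩

/-- The cost of a game that charges to independent sets is at most a multiple of `β_M(G)`. -/
theorem Thrifty.sum_length_le {B : ℝ} (hB : 0 ≤ B) {h : Transcript K} (hh : Thrifty G B h) {M : ℕ}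
    (hM : h.length ≤ M) :
    ((h.map fun p => p.2.length).sum : ℝ) ≤ B * beta M G := by
  choose hd I hI using hh
  -- Games of fewer than `M` moves are padded with empty sets.
  set J : Fin M → Finset (Fin K) := fun c => if hc : c.1 < h.length then I c hc else ∅ with hJ
  have hbeta : ∑ c, (J c).card ≤ beta M G := by
    unfold beta
    refine Finset.le_sup (f := fun I : Fin M → Finset (Fin K) => ∑ c, (I c).card) ?_
    rw [Finset.mem_filter]
    refine ⟨Finset.mem_univ _, fun c => ?_, fun i j hij u hu v hv hadj => ?_⟩
    · simp only [hJ]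
      split_ifs with hc
      exacts [(hI c hc).2.1, by simp [IsIndep]]
    · simp only [hJ] at hu hv
      split_ifs at hu hv with hi hj
      all_goals first | exact absurd hu (Finset.notMem_empty _) | exact absurd hv (Finset.notMem_empty _) | skip
      have hv' := (hI j hj).1 hv
      have hu' := (hI i hi).1 hu
      -- An edge from the `i`-th to the `j`-th set would put its end among the vertices covered
      -- before move `j`.
      refine Finset.disjoint_left.mp (hd j hj) hv' ?_
      refine mem_outNbrs.mpr ⟨u, ?_, hadj⟩
      rw [List.mem_toFinset, List.mem_flatMap]
      refine ⟨h[i.1], ?_, List.mem_toFinset.mp hu'⟩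
      rw [List.mem_iff_getElem]
      exact ⟨i.1, by simp; omega, by simp⟩
  have hsum : ((h.map fun p => p.2.length).sum : ℝ) ≤ B * ∑ c, ((J c).card : ℝ) := by
    have e : (h.map fun p => (p.2.length : ℝ)).sum =
        ∑ i : Fin M, if hc : i.1 < h.length then ((h[i.1]).2.length : ℝ) else 0 := by
      rw [← Fin.sum_univ_fun_getElem]
      obtain ⟨n, rfl⟩ := Nat.exists_eq_add_of_le hM
      rw [Fin.sum_univ_add]
      simp
    rw [e, Finset.mul_sum]
    refine Finset.sum_le_sum fun c _ => ?_
    simp only [hJ]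
    split_ifs with hc
    · exact (hI c hc).2.2
    · simp
  refine hsum.trans (mul_le_mul_of_nonneg_left ?_ hB)
  exact_mod_cast hbeta

/-- A legal adversary keeps its sets off the covered vertices and the answers lie in these sets, so
transcripts of the game are thrifty. -/
theorem dominate_costLE (hK : 2 ≤ K) (hG : ∀ a, G.Adj a a) (M : ℕ) :
    dominate.CostLE G M (domRatio K * beta M G) := by
  intro A hA
  have key : ∀ n ≤ M, (gamePlay dominate G A n).length = n ∧
      Thrifty G (domRatio K) (gamePlay dominate G A n) := by
    intro n
    induction n with
    | zero => intro _; exact ⟨rfl, thrifty_nil _⟩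
    | succ n ih =>
      intro hn
      obtain ⟨h1, h2⟩ := ih (by omega)
      refine ⟨by simp [gamePlay, h1], h2.append ?_ ?_⟩
      · exact (hA n hn).mono_left (dominateList_spec hG (A n)).2.1
      · exact dominateList_prefix hK hG (A n) (List.prefix_refl _)
  obtain ⟨h1, h2⟩ := key M le_rfl
  exact h2.sum_length_le (zero_le_one.trans (one_le_domRatio hK)) h1.le

end Strategy

/-! ### Reasoning about programs -/

section Machine

/-- Does the program write to the array `z` of natural numbers? -/
def Cmd.writesNat (z : ℕ) : Cmd → Bool
  | skip => false
  | setNat x _ _ _ _ => Nat.beq x z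
  | setReal _ _ _ _ _ => false
  | seq p q => p.writesNat z || q.writesNat z
  | ite _ p q => p.writesNat z || q.writesNat z
  | loop x _ p => Nat.beq x z || p.writesNat z

/-- Does the program write to the array `z` of real numbers? -/
def Cmd.writesReal (z : ℕ) : Cmd → Bool
  | skip => false
  | setNat _ _ _ _ _ => false
  | setReal x _ _ _ _ => Nat.beq x z
  | seq p q => p.writesReal z || q.writesReal z
  | ite _ p q => p.writesReal z || q.writesReal z
  | loop _ _ p => p.writesReal z

/-- The memory after the program was run. -/
noncomputable def Cmd.run (p : Cmd) (σ : Store) : Store := (p.exec σ).1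

/-! ### Effect of single commands, frame conditions and loop invariants -/

theorem run_skip (σ : Store) : Cmd.skip.run σ = σ := rfl
theorem run_setNat (σ : Store) (x : ℕ) (i j k e : NExp) :
    (Cmd.setNat x i j k e).run σ = σ.setNat x (i.eval σ, j.eval σ, k.eval σ) (e.eval σ) := rfl
theorem run_setReal (σ : Store) (x : ℕ) (i j k : NExp) (e : RExp) :
    (Cmd.setReal x i j k e).run σ = σ.setReal x (i.eval σ, j.eval σ, k.eval σ) (e.eval σ) := rfl
theorem run_seq (σ : Store) (p q : Cmd) : (Cmd.seq p q).run σ = q.run (p.run σ) := rfl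
theorem run_ite (σ : Store) (b : BExp) (p q : Cmd) :
    (Cmd.ite b p q).run σ = if b.holds σ then p.run σ else q.run σ := by
  unfold Cmd.run; simp only [Cmd.exec]; split_ifs <;> rfl

theorem nat_setNat (σ : Store) (x y : ℕ) (p q : ℕ × ℕ × ℕ) (v : ℕ) :
    (σ.setNat x p v).nat y q = if y = x ∧ q = p then v else σ.nat y q := by
  unfold Store.setNat
  by_cases h : y = x
  · subst h; by_cases h' : q = p
    · subst h'; simp
    · simp [h']
  · simp [h]

theorem nat_setNat_of_ne (σ : Store) {x y : ℕ} (p : ℕ × ℕ × ℕ) (v : ℕ) (h : y ≠ x) :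
    (σ.setNat x p v).nat y = σ.nat y := by simp [Store.setNat, h]

theorem real_setNat (σ : Store) (x : ℕ) (p : ℕ × ℕ × ℕ) (v : ℕ) :
    (σ.setNat x p v).real = σ.real := rfl

theorem nat_setReal (σ : Store) (x : ℕ) (p : ℕ × ℕ × ℕ) (v : ℝ) :
    (σ.setReal x p v).nat = σ.nat := rfl

theorem real_setReal (σ : Store) (x y : ℕ) (p q : ℕ × ℕ × ℕ) (v : ℝ) :
    (σ.setReal x p v).real y q = if y = x ∧ q = p then v else σ.real y q := by
  unfold Store.setReal
  by_cases h : y = x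
  · subst h; by_cases h' : q = p
    · subst h'; simp
    · simp [h']
  · simp [h]

theorem real_setReal_of_ne (σ : Store) {x y : ℕ} (p : ℕ × ℕ × ℕ) (v : ℝ) (h : y ≠ x) :
    (σ.setReal x p v).real y = σ.real y := by simp [Store.setReal, h]

theorem exec_loop (σ : Store) (x : ℕ) (e : NExp) (body : Cmd) :
    (Cmd.loop x e body).exec σ = Nat.rec (motive := fun _ => Store × ℕ) (σ, e.cost + 1)
      (fun i s =>
        ((body.exec (s.1.setNat x (0, 0, 0) i)).1,
          s.2 + (body.exec (s.1.setNat x (0, 0, 0) i)).2 + 1))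
      (e.eval σ) := rfl

theorem loop_invariant_of_le {x : ℕ} {e : NExp} {body : Cmd} {σ : Store} (Q : ℕ → Store → Prop)
    (h0 : Q 0 σ)
    (hs : ∀ i < e.eval σ, ∀ σ', Q i σ' → Q (i + 1) (body.run (σ'.setNat x (0, 0, 0) i))) :
    Q (e.eval σ) ((Cmd.loop x e body).run σ) := by
  unfold Cmd.run
  rw [exec_loop]
  generalize e.eval σ = n at hs
  induction n with
  | zero => exact h0
  | succ n ih => exact hs n (by omega) _ (ih fun i hi => hs i (by omega))

theorem natBeq_eq_false_iff {x y : ℕ} : Nat.beq x y = false ↔ x ≠ y := by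
  rw [← Bool.not_eq_true, Nat.beq_eq]

/-- The hypothesis is syntactic and evaluates to a Boolean, so for concrete programs `rfl` proves
that an array is untouched. -/
theorem run_nat_of_not_writes {z : ℕ} (p : Cmd) (σ : Store) (h : p.writesNat z = false) :
    (p.run σ).nat z = σ.nat z := by
  induction p generalizing σ with
  | skip => rfl
  | setNat x i j k e =>
    exact nat_setNat_of_ne _ _ _ (Ne.symm (natBeq_eq_false_iff.mp h))
  | setReal => rfl
  | seq p q hp hq =>
    simp only [Cmd.writesNat, Bool.or_eq_false_iff] at h
    rw [run_seq, hq _ h.2, hp _ h.1]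
  | ite b p q hp hq =>
    simp only [Cmd.writesNat, Bool.or_eq_false_iff] at h
    rw [run_ite]
    split_ifs
    exacts [hp _ h.1, hq _ h.2]
  | loop x e p hp =>
    simp only [Cmd.writesNat, Bool.or_eq_false_iff] at h
    refine loop_invariant_of_le (fun _ σ' => σ'.nat z = σ.nat z) rfl fun i _ σ' hσ' => ?_
    rw [hp _ h.2, nat_setNat_of_ne _ _ _ (Ne.symm (natBeq_eq_false_iff.mp h.1)), hσ']

theorem run_real_of_not_writes {z : ℕ} (p : Cmd) (σ : Store) (h : p.writesReal z = false) :
    (p.run σ).real z = σ.real z := by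
  induction p generalizing σ with
  | skip => rfl
  | setNat => rfl
  | setReal x i j k e =>
    exact real_setReal_of_ne _ _ _ (Ne.symm (natBeq_eq_false_iff.mp h))
  | seq p q hp hq =>
    simp only [Cmd.writesReal, Bool.or_eq_false_iff] at h
    rw [run_seq, hq _ h.2, hp _ h.1]
  | ite b p q hp hq =>
    simp only [Cmd.writesReal, Bool.or_eq_false_iff] at h
    rw [run_ite]
    split_ifs
    exacts [hp _ h.1, hq _ h.2]
  | loop x e p hp =>
    refine loop_invariant_of_le (fun _ σ' => σ'.real z = σ.real z) rfl fun i _ σ' hσ' => ?_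
    rw [hp _ h, real_setNat, hσ']

/-- `σ'` differs from `σ` only in arrays that `p` writes to. -/
def Frame (p : Cmd) (σ σ' : Store) : Prop :=
  (∀ z, p.writesNat z = false → σ'.nat z = σ.nat z) ∧
    ∀ z, p.writesReal z = false → σ'.real z = σ.real z

theorem frame_run (p : Cmd) (σ : Store) : Frame p σ (p.run σ) :=
  ⟨fun _ => run_nat_of_not_writes p σ, fun _ => run_real_of_not_writes p σ⟩

/-- The working rule for loops: each pass starts with the counter freshly set and with every array
outside the loop's writes as it was before the loop. In exchange, the invariant must not depend on
the counter. -/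
theorem loop_invariant {x : ℕ} {e : NExp} {body : Cmd} {σ : Store} (Q : ℕ → Store → Prop)
    (h0 : Q 0 σ)
    (hs : ∀ i < e.eval σ, ∀ σ', Frame (.loop x e body) σ σ' → σ'.nat x (0, 0, 0) = i →
      Q i σ' → Q (i + 1) (body.run σ'))
    (hQ : ∀ i σ', Q i σ' → ∀ v, Q i (σ'.setNat x (0, 0, 0) v)) :
    Q (e.eval σ) ((Cmd.loop x e body).run σ) := by
  have := loop_invariant_of_le (x := x) (e := e) (body := body) (σ := σ)
    (fun i σ' => Q i σ' ∧ Frame (.loop x e body) σ σ')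
    ⟨h0, fun _ _ => rfl, fun _ _ => rfl⟩ (by
      rintro i hi σ' ⟨h1, h2⟩
      have hf : Frame (.loop x e body) σ (σ'.setNat x (0, 0, 0) i) := by
        refine ⟨fun z hz => ?_, fun z hz => ?_⟩
        · rw [nat_setNat_of_ne, h2.1 z hz]
          simp only [Cmd.writesNat, Bool.or_eq_false_iff] at hz
          exact Ne.symm (natBeq_eq_false_iff.mp hz.1)
        · rw [real_setNat, h2.2 z hz]
      refine ⟨hs i hi _ hf (by simp [nat_setNat]) (hQ i σ' h1 i), fun z hz => ?_, fun z hz => ?_⟩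
      · rw [run_nat_of_not_writes, hf.1 z hz]
        simp only [Cmd.writesNat, Bool.or_eq_false_iff] at hz
        exact hz.2
      · rw [run_real_of_not_writes, hf.2 z hz]
        exact hz)
  exact this.1

/-- A loop over `Fin K` that simulates a fold. -/
theorem loop_foldl {K x : ℕ} {e : NExp} {body : Cmd} {σ : Store} {S : Type*}
    (R : S → Store → Prop) (f : S → Fin K → S) (s : S) (he : e.eval σ = K) (h0 : R s σ)
    (hs : ∀ (i : Fin K) s σ', Frame (.loop x e body) σ σ' → σ'.nat x (0, 0, 0) = i →
      R s σ' → R (f s i) (body.run σ'))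
    (hR : ∀ s σ', R s σ' → ∀ v, R s (σ'.setNat x (0, 0, 0) v)) :
    R ((List.finRange K).foldl f s) ((Cmd.loop x e body).run σ) := by
  have := loop_invariant (x := x) (e := e) (body := body) (σ := σ)
    (fun n σ' => R (((List.finRange K).take n).foldl f s) σ') (by simpa using h0) (by
      intro i hi σ' hf hx h
      rw [he] at hi
      have hl : i < (List.finRange K).length := by simpa using hi
      rw [List.take_succ_eq_append_getElem hl, List.foldl_append]
      have := hs ⟨i, hi⟩ _ σ' hf hx h
      simpa using this) (fun i σ' h v => hR _ _ h v)
  rw [he] at this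
  rwa [List.take_of_length_le (by simp)] at this

/-! ### The number of steps -/

/-- The number of vertices. -/
abbrev kExp : NExp := .get 2 (.lit 0) (.lit 0) (.lit 0)
/-- The number of past rounds plus one. -/
abbrev roundsExp : NExp := .add (.get 4 (.lit 0) (.lit 0) (.lit 0)) (.lit 1)

/-- All loops run over the vertices or over the rounds. -/
def Cmd.Bounded : Cmd → Prop
  | skip => True
  | setNat _ _ _ _ _ => True
  | setReal _ _ _ _ _ => True
  | seq p q => p.Bounded ∧ q.Bounded
  | ite _ p q => p.Bounded ∧ q.Bounded
  | loop _ e p => (e = kExp ∨ e = roundsExp) ∧ p.Bounded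

/-- A bound for the number of steps in terms of a bound for the length of loops. -/
noncomputable def Cmd.stepBound : Cmd → Polynomial ℕ
  | skip => 1
  | setNat _ i j k e => ((i.cost + j.cost + k.cost + e.cost + 1 : ℕ) : Polynomial ℕ)
  | setReal _ i j k e => ((i.cost + j.cost + k.cost + e.cost + 1 : ℕ) : Polynomial ℕ)
  | seq p q => p.stepBound + q.stepBound
  | ite b p q => ((b.cost + 1 : ℕ) : Polynomial ℕ) + p.stepBound + q.stepBound
  | loop _ e p => ((e.cost + 1 : ℕ) : Polynomial ℕ) + (Polynomial.X + 1) * (p.stepBound + 1)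

/-- Loop lengths are read from arrays 2 and 4, which are never written. So even nested loops make at
most `N + 1` passes, and the costs multiply to a fixed polynomial. -/
theorem exec_cost_le (N : ℕ) (p : Cmd) (hp : p.Bounded) (h2 : p.writesNat 2 = false)
    (h4 : p.writesNat 4 = false) (σ : Store) (hK : σ.nat 2 (0, 0, 0) ≤ N)
    (hT : σ.nat 4 (0, 0, 0) ≤ N) : (p.exec σ).2 ≤ p.stepBound.eval N := by
  induction p generalizing σ with
  | skip => simp [Cmd.exec, Cmd.stepBound]
  | setNat => simp [Cmd.exec, Cmd.stepBound]
  | setReal => simp [Cmd.exec, Cmd.stepBound]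
  | seq p q ihp ihq =>
    simp only [Cmd.writesNat, Bool.or_eq_false_iff] at h2 h4
    simp only [Cmd.exec, Cmd.stepBound, Polynomial.eval_add]
    refine Nat.add_le_add (ihp hp.1 h2.1 h4.1 σ hK hT) (ihq hp.2 h2.2 h4.2 _ ?_ ?_)
    · have := run_nat_of_not_writes p σ h2.1
      unfold Cmd.run at this; rw [this]; exact hK
    · have := run_nat_of_not_writes p σ h4.1
      unfold Cmd.run at this; rw [this]; exact hT
  | ite b p q ihp ihq =>
    simp only [Cmd.writesNat, Bool.or_eq_false_iff] at h2 h4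
    have e1 := ihp hp.1 h2.1 h4.1 σ hK hT
    have e2 := ihq hp.2 h2.2 h4.2 σ hK hT
    simp only [Cmd.exec, Cmd.stepBound, Polynomial.eval_add, Polynomial.eval_natCast]
    split_ifs <;> simp only <;> push_cast <;> omega
  | loop x e p ih =>
    simp only [Cmd.writesNat, Bool.or_eq_false_iff] at h2 h4
    have he : e.eval σ ≤ N + 1 := by
      rcases hp.1 with rfl | rfl <;> simp only [NExp.eval] <;> omega
    rw [exec_loop]
    simp only [Cmd.stepBound, Polynomial.eval_add, Polynomial.eval_mul, Polynomial.eval_X,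
      Polynomial.eval_one, Polynomial.eval_natCast]
    have key : ∀ n, ∀ s : Store × ℕ, s = Nat.rec (motive := fun _ => Store × ℕ) (σ, e.cost + 1)
        (fun i s => ((p.exec (s.1.setNat x (0, 0, 0) i)).1,
          s.2 + (p.exec (s.1.setNat x (0, 0, 0) i)).2 + 1)) n →
        s.1.nat 2 = σ.nat 2 ∧ s.1.nat 4 = σ.nat 4 ∧
          s.2 ≤ (e.cost + 1) + n * (p.stepBound.eval N + 1) := by
      intro n
      induction n with
      | zero => rintro _ rfl; simp
      | succ n ihn =>
        rintro _ rfl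
        obtain ⟨k2, k4, kc⟩ := ihn _ rfl
        dsimp only
        generalize (Nat.rec (motive := fun _ => Store × ℕ) (σ, e.cost + 1)
          (fun i s => ((p.exec (s.1.setNat x (0, 0, 0) i)).1,
          s.2 + (p.exec (s.1.setNat x (0, 0, 0) i)).2 + 1)) n : Store × ℕ) = s at k2 k4 kc ⊢
        have f2 : (s.1.setNat x (0, 0, 0) n).nat 2 = σ.nat 2 := by
          rw [nat_setNat_of_ne _ _ _ (Ne.symm (natBeq_eq_false_iff.mp h2.1)), k2]
        have f4 : (s.1.setNat x (0, 0, 0) n).nat 4 = σ.nat 4 := by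
          rw [nat_setNat_of_ne _ _ _ (Ne.symm (natBeq_eq_false_iff.mp h4.1)), k4]
        refine ⟨?_, ?_, ?_⟩
        · have := run_nat_of_not_writes p (s.1.setNat x (0, 0, 0) n) h2.2
          unfold Cmd.run at this; rw [this, f2]
        · have := run_nat_of_not_writes p (s.1.setNat x (0, 0, 0) n) h4.2
          unfold Cmd.run at this; rw [this, f4]
        · have := ih hp.2 h2.2 h4.2 (s.1.setNat x (0, 0, 0) n) (by rw [f2]; exact hK)
            (by rw [f4]; exact hT)
          rw [Nat.add_mul, Nat.one_mul]
          omega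
    refine (key _ _ rfl).2.2.trans ?_
    push_cast
    gcongr

/-! ### Building blocks of programs -/

/-- A scalar variable. -/
abbrev var (x : ℕ) : NExp := .get x (.lit 0) (.lit 0) (.lit 0)
abbrev at1 (x : ℕ) (i : NExp) : NExp := .get x i (.lit 0) (.lit 0)
abbrev at2 (x : ℕ) (i j : NExp) : NExp := .get x i j (.lit 0)
abbrev setVar (x : ℕ) (e : NExp) : Cmd := .setNat x (.lit 0) (.lit 0) (.lit 0) e
abbrev pos (e : NExp) : BExp := .nle (.lit 1) e

/-- Count the vertices `x` that pass the test `b` in the variable `y`. -/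
def countLoop (x y : ℕ) (b : BExp) : Cmd :=
  .seq (setVar y (.lit 0)) (.loop x kExp (.ite b (setVar y (.add (var y) (.lit 1))) .skip))

theorem foldl_count {α : Type*} (P : α → Prop) (l : List α) (n : ℕ) :
    l.foldl (fun n v => if P v then n + 1 else n) n = n + (l.filter fun v => P v).length := by
  induction l generalizing n with
  | nil => simp
  | cons a l ih =>
    rw [List.foldl_cons, ih, List.filter_cons]
    by_cases h : P a <;> simp [h]
    omega

theorem countLoop_spec {K x y : ℕ} {b : BExp} {σ : Store} (hK : σ.nat 2 (0, 0, 0) = K)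
    (hxy : x ≠ y) (hy : y ≠ 2) (P : Fin K → Prop)
    (hb : ∀ (i : Fin K) (σ' : Store), (∀ z, z ≠ x → z ≠ y → σ'.nat z = σ.nat z) →
      σ'.real = σ.real → σ'.nat x (0, 0, 0) = i → (b.holds σ' ↔ P i)) :
    ((countLoop x y b).run σ).nat y (0, 0, 0) = (Finset.univ.filter P).card := by
  unfold countLoop
  rw [run_seq]
  have h1 : (setVar y (.lit 0)).run σ = σ.setNat y (0, 0, 0) 0 := rfl
  rw [h1]
  have := loop_foldl (K := K) (x := x) (e := kExp)
    (body := (.ite b (setVar y (.add (var y) (.lit 1))) .skip)) (σ := σ.setNat y (0, 0, 0) 0)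
    (fun n σ' => σ'.nat y (0, 0, 0) = n) (fun n v => if P v then n + 1 else n) 0
    (by simp [NExp.eval, nat_setNat, Ne.symm hy, hK]) (by simp [nat_setNat]) (by
      intro i n σ' hf hx hn
      have hh : b.holds σ' ↔ P i := by
        refine hb i σ' (fun z hzx hzy => ?_) ?_ hx
        · rw [hf.1 z, nat_setNat_of_ne _ _ _ hzy]
          simp [Cmd.writesNat, natBeq_eq_false_iff, Ne.symm hzx, Ne.symm hzy]
        · funext z
          rw [hf.2 z (by simp [Cmd.writesReal])]; rfl
      rw [run_ite]
      simp only [hh]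
      split_ifs
      · rw [run_setNat]; simp [nat_setNat, NExp.eval, hn]
      · exact hn) (by
      intro n σ' h v
      rw [nat_setNat_of_ne _ _ _ hxy.symm]; exact h)
  rw [this, foldl_count, Nat.zero_add]
  rw [← List.toFinset_card_of_nodup ((List.nodup_finRange K).filter _)]
  congr 1
  ext v
  simp

/-- Tabulate the test `b`, prepared by `pre`, in column `r` of the array `y`. -/
def tabLoop (x y : ℕ) (r : NExp) (pre : Cmd) (b : BExp) : Cmd :=
  .loop x kExp (.seq pre
    (.ite b (.setNat y (var x) r (.lit 0) (.lit 1)) (.setNat y (var x) r (.lit 0) (.lit 0))))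

/-- The test may read the array that is being overwritten: when row `i` is reached, its own cell
still has the old value. This permits updates in place. -/
theorem tabLoop_spec {K x y : ℕ} {re : NExp} {pre : Cmd} {b : BExp} {σ : Store}
    (hK : σ.nat 2 (0, 0, 0) = K) (hxy : x ≠ y) (hpx : pre.writesNat x = false)
    (hpy : pre.writesNat y = false) (r : ℕ) (P : Fin K → Prop)
    (hb : ∀ (i : Fin K) (σ' : Store),
      (∀ z, z ≠ x → z ≠ y → pre.writesNat z = false → σ'.nat z = σ.nat z) →
      (∀ z, pre.writesReal z = false → σ'.real z = σ.real z) → σ'.nat x (0, 0, 0) = i →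
      σ'.nat y (i, r, 0) = σ.nat y (i, r, 0) →
      re.eval (pre.run σ') = r ∧ (b.holds (pre.run σ') ↔ P i)) :
    (∀ v : Fin K, 1 ≤ ((tabLoop x y re pre b).run σ).nat y (v, r, 0) ↔ P v) ∧
      ∀ p, (∀ v : Fin K, p ≠ (v.1, r, 0)) →
        ((tabLoop x y re pre b).run σ).nat y p = σ.nat y p := by
  have := loop_invariant (x := x) (e := kExp) (σ := σ)
    (body := .seq pre (.ite b (.setNat y (var x) re (.lit 0) (.lit 1))
      (.setNat y (var x) re (.lit 0) (.lit 0))))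
    (fun n σ' => (∀ v : Fin K, v.1 < n → (1 ≤ σ'.nat y (v, r, 0) ↔ P v)) ∧
      ∀ p, (∀ v : Fin K, v.1 < n → p ≠ (v.1, r, 0)) → σ'.nat y p = σ.nat y p)
    ⟨by simp, by simp⟩ (by
      rintro i hi σ' hf hx ⟨h1, h2⟩
      have hi' : i < K := by simpa [NExp.eval, hK] using hi
      obtain ⟨hr, hP⟩ := hb ⟨i, hi'⟩ σ' (fun z hzx hzy hz => by
          refine hf.1 z ?_
          simp [Cmd.writesNat, natBeq_eq_false_iff, hz, Ne.symm hzx, Ne.symm hzy])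
        (fun z hz => hf.2 z (by simp [Cmd.writesReal, hz])) hx (h2 _ (by
          intro v hv h
          simp only [Prod.mk.injEq, and_true] at h
          omega))
      have hx' : (pre.run σ').nat x (0, 0, 0) = i := by
        rw [run_nat_of_not_writes _ _ hpx, hx]
      have hy' : (pre.run σ').nat y = σ'.nat y := run_nat_of_not_writes _ _ hpy
      have hrun : ∃ w, (Cmd.seq pre (.ite b (.setNat y (var x) re (.lit 0) (.lit 1))
          (.setNat y (var x) re (.lit 0) (.lit 0)))).run σ' =
            (pre.run σ').setNat y (i, r, 0) w ∧ (1 ≤ w ↔ P ⟨i, hi'⟩) := by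
        rw [run_seq, run_ite]
        by_cases hb : b.holds (pre.run σ')
        · refine ⟨1, ?_, by simp [hP.mp hb]⟩
          rw [if_pos hb, run_setNat]
          simp only [NExp.eval, hx', hr]
        · refine ⟨0, ?_, by simpa using fun h => hb (hP.mpr h)⟩
          rw [if_neg hb, run_setNat]
          simp only [NExp.eval, hx', hr]
      obtain ⟨w, hw, hwP⟩ := hrun
      rw [hw]
      refine ⟨fun v hv => ?_, fun p hp => ?_⟩
      · rw [nat_setNat, hy']
        rcases Nat.lt_succ_iff_lt_or_eq.mp hv with hv | hv
        · rw [if_neg (by simp; omega)]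
          exact h1 v hv
        · subst hv
          simpa using hwP
      · rw [nat_setNat, hy', if_neg (by simpa using hp ⟨i, hi'⟩ (by simp))]
        exact h2 p fun v hv => hp v (by omega)) (by
      rintro n σ' ⟨h1, h2⟩ v
      rw [nat_setNat_of_ne _ _ _ hxy.symm]
      exact ⟨h1, h2⟩)
  have hK' : kExp.eval σ = K := by simpa [NExp.eval] using hK
  rw [hK'] at this
  exact ⟨fun v => this.1 v v.2, fun p hp => this.2 p fun v _ => hp v⟩

end Machine

/-! ### The program of the strategy -/

section GameProgram
variable {K : ℕ} {G : Digraph (Fin K)}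

/-- The array `a` holds the indicator function of `S` in its column `r`. -/
def ColSet (a : ℕ × ℕ × ℕ → ℕ) (r : ℕ) (S : Finset (Fin K)) : Prop :=
  ∀ v : Fin K, 1 ≤ a (v, r, 0) ↔ v ∈ S

/-- The graph is stored in the input arrays. -/
def HasGraph (σ : Store) (G : Digraph (Fin K)) : Prop :=
  σ.nat 2 (0, 0, 0) = K ∧ ∀ u v : Fin K, 1 ≤ σ.nat 3 (u, v, 0) ↔ G.Adj u v

theorem HasGraph.frame {σ σ' : Store} (h : HasGraph σ G) (h2 : σ'.nat 2 = σ.nat 2)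
    (h3 : σ'.nat 3 = σ.nat 3) : HasGraph σ' G := by
  unfold HasGraph; rw [h2, h3]; exact h

theorem colSet_insert {a b : ℕ × ℕ × ℕ → ℕ} {S : Finset (Fin K)} (h : ColSet a 0 S) (v : Fin K)
    (h1 : b (v, 0, 0) = 1) (h2 : ∀ p, p ≠ (v.1, 0, 0) → b p = a p) : ColSet b 0 (insert v S) := by
  intro u
  by_cases huv : u = v
  · subst huv; simp [h1]
  · rw [h2 _ (by simpa [Fin.ext_iff] using huv), h u]
    simp [huv]

/-- Layout of the strategy's memory: 20 the undominated rest, 21 the picked vertices, 22 and 25 the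
best independent set and its size, 23 and 24 the current one and its size, 26 a counter, 27 the
vertices of low in-degree, 28 the threshold. Names from 30 on are loop counters. -/
def outDegCmd : Cmd :=
  countLoop 32 26 (.and (pos (at1 20 (var 32))) (pos (at2 3 (var 31) (var 32))))

def removeCmd : Cmd :=
  tabLoop 33 20 (.lit 0) .skip
    (.and (pos (at1 20 (var 33))) (.not (pos (at2 3 (var 31) (var 33)))))

def pickCmd : Cmd :=
  .loop 31 kExp (.seq outDegCmd (.ite (.and (pos (at1 20 (var 31))) (.nle (var 28) (var 26)))
    (.seq (.setNat 21 (var 31) (.lit 0) (.lit 0) (.lit 1)) removeCmd) .skip))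

theorem outDegCmd_spec {σ : Store} (hG : HasGraph σ G) {R : Finset (Fin K)}
    (hR : ColSet (σ.nat 20) 0 R) {v : Fin K} (hv : σ.nat 31 (0, 0, 0) = v) :
    (outDegCmd.run σ).nat 26 (0, 0, 0) = outDeg G R v := by
  unfold outDegCmd outDeg
  rw [countLoop_spec hG.1 (by decide) (by decide) (fun w => w ∈ R ∧ G.Adj v w)]
  · congr 1; ext w; simp
  · intro i σ' h _ hi
    simp only [BExp.holds, NExp.eval, hi, h 20 (by decide) (by decide), h 3 (by decide) (by decide),
      h 31 (by decide) (by decide), hv, hR i, hG.2 v i]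

theorem removeCmd_spec {σ : Store} (hG : HasGraph σ G) {R : Finset (Fin K)}
    (hR : ColSet (σ.nat 20) 0 R) {v : Fin K} (hv : σ.nat 31 (0, 0, 0) = v) :
    ColSet ((removeCmd.run σ).nat 20) 0 (R \ outNbrs G {v}) := by
  have := (tabLoop_spec (x := 33) (y := 20) (re := .lit 0) (pre := .skip)
    (b := .and (pos (at1 20 (var 33))) (.not (pos (at2 3 (var 31) (var 33))))) hG.1 (by decide)
    rfl rfl 0 (fun w => w ∈ R ∧ ¬ G.Adj v w) (by
      intro i σ' h _ hi hy
      simp only [run_skip, BExp.holds, NExp.eval, hi, h 3 (by decide) (by decide) rfl,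
        h 31 (by decide) (by decide) rfl, hv, hy, hR i, hG.2 v i, and_self])).1
  intro w
  rw [removeCmd, this w]
  simp [mem_outNbrs]

theorem pickCmd_spec {σ : Store} (hG : HasGraph σ G) {R D : Finset (Fin K)} {d : ℕ}
    (hR : ColSet (σ.nat 20) 0 R) (hD : ColSet (σ.nat 21) 0 D) (hd : σ.nat 28 (0, 0, 0) = d) :
    let q := (List.finRange K).foldl (pickStep G d) (R, D)
    ColSet ((pickCmd.run σ).nat 20) 0 q.1 ∧ ColSet ((pickCmd.run σ).nat 21) 0 q.2 := by
  intro q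
  unfold pickCmd
  refine loop_foldl (e := kExp) (fun q σ' => ColSet (σ'.nat 20) 0 q.1 ∧ ColSet (σ'.nat 21) 0 q.2)
    (pickStep G d) (R, D) (by simpa [NExp.eval] using hG.1) ⟨hR, hD⟩ ?_ ?_
  · rintro i ⟨R', D'⟩ σ' hf hi ⟨h1, h2⟩
    dsimp only at h1 h2
    have hG' : HasGraph σ' G := hG.frame (hf.1 2 rfl) (hf.1 3 rfl)
    have hd' : σ'.nat 28 (0, 0, 0) = d := by rw [hf.1 28 rfl, hd]
    have hout := outDegCmd_spec hG' h1 hi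
    have fr := frame_run outDegCmd σ'
    rw [run_seq, run_ite]
    set σ₁ := outDegCmd.run σ'
    have hi1 : σ₁.nat 31 (0, 0, 0) = i := by rw [fr.1 31 rfl, hi]
    have h11 : ColSet (σ₁.nat 20) 0 R' := by rw [fr.1 20 rfl]; exact h1
    have h21 : ColSet (σ₁.nat 21) 0 D' := by rw [fr.1 21 rfl]; exact h2
    have htest : (BExp.and (pos (at1 20 (var 31))) (.nle (var 28) (var 26))).holds σ₁ ↔
        (i ∈ R' ∧ d ≤ outDeg G R' i) := by
      simp only [BExp.holds, NExp.eval, hi1, fr.1 28 rfl, hd', hout, h11 i]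
    unfold pickStep
    simp only [htest]
    split_ifs
    · rw [run_seq, run_setNat]
      simp only [NExp.eval, hi1]
      set σ₂ := σ₁.setNat 21 (↑i, 0, 0) 1 with hσ₂
      have hrem := removeCmd_spec (σ := σ₂) (hG'.frame (by rw [hσ₂]; simp [Store.setNat, fr.1 2 rfl])
        (by simp [hσ₂, Store.setNat, fr.1 3 rfl])) (R := R') (by simpa [hσ₂, Store.setNat] using h11)
        (v := i) (by simpa [hσ₂, Store.setNat] using hi1)
      refine ⟨hrem, ?_⟩
      rw [(frame_run removeCmd σ₂).1 21 rfl]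
      refine colSet_insert h21 i ?_ ?_
      · simp [hσ₂, nat_setNat]
      · intro p hp
        simp [hσ₂, nat_setNat, hp]
    · exact ⟨h11, h21⟩
  · rintro q σ' h v
    simpa [Store.setNat] using h

def lowInCmd : Cmd :=
  tabLoop 34 27 (.lit 0)
    (countLoop 35 26 (.and (pos (at1 20 (var 35))) (pos (at2 3 (var 35) (var 34)))))
    (.and (pos (at1 20 (var 34))) (.nle (var 26) (.add (var 28) (var 28))))

theorem lowInCmd_spec {σ : Store} (hG : HasGraph σ G) {R : Finset (Fin K)} {d : ℕ}
    (hR : ColSet (σ.nat 20) 0 R) (hd : σ.nat 28 (0, 0, 0) = d) :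
    ColSet ((lowInCmd.run σ).nat 27) 0 (lowIn G R d) := by
  have := (tabLoop_spec (x := 34) (y := 27) (re := .lit 0)
    (pre := countLoop 35 26 (.and (pos (at1 20 (var 35))) (pos (at2 3 (var 35) (var 34)))))
    (b := .and (pos (at1 20 (var 34))) (.nle (var 26) (.add (var 28) (var 28)))) hG.1 (by decide)
    rfl rfl 0 (fun w => w ∈ R ∧ inDeg G R w ≤ d + d) (by
      intro i σ' h _ hi hy
      have hc := countLoop_spec (x := 35) (y := 26) (σ := σ') (K := K)
        (b := .and (pos (at1 20 (var 35))) (pos (at2 3 (var 35) (var 34))))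
        (by rw [h 2 (by decide) (by decide) rfl]; exact hG.1) (by decide) (by decide)
        (fun w => w ∈ R ∧ G.Adj w i) (by
          intro j σ'' h' _ hj
          simp only [BExp.holds, NExp.eval, hj, h' 20 (by decide) (by decide),
            h' 3 (by decide) (by decide), h' 34 (by decide) (by decide), hi,
            h 20 (by decide) (by decide) rfl, h 3 (by decide) (by decide) rfl, hR j, hG.2 j i])
      have fr := frame_run
        (countLoop 35 26 (.and (pos (at1 20 (var 35))) (pos (at2 3 (var 35) (var 34))))) σ'
      have hc' := hc.trans (show _ = inDeg G R i by unfold inDeg; congr 1; ext w; simp)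
      refine ⟨rfl, ?_⟩
      simp only [BExp.holds, NExp.eval, hc', fr.1 34 rfl, fr.1 20 rfl, fr.1 28 rfl, hi,
        h 20 (by decide) (by decide) rfl, h 28 (by decide) (by decide) rfl, hd, hR i])).1
  intro w
  rw [lowInCmd, this w]
  simp [lowIn]

def indepCmd : Cmd :=
  .seq (tabLoop 36 23 (.lit 0) .skip (pos (.lit 0))) <| .seq (setVar 24 (.lit 0)) <|
    .loop 37 kExp <| .seq (countLoop 38 26 (.and (pos (at1 23 (var 38)))
        (pos (.add (at2 3 (var 37) (var 38)) (at2 3 (var 38) (var 37)))))) <|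
      .ite (.and (pos (at1 27 (var 37))) (.nle (var 26) (.lit 0)))
        (.seq (.setNat 23 (var 37) (.lit 0) (.lit 0) (.lit 1))
          (setVar 24 (.add (var 24) (.lit 1)))) .skip

theorem clear_spec {σ : Store} (hG : HasGraph σ G) {x y : ℕ} (hxy : x ≠ y) :
    ColSet (((tabLoop x y (.lit 0) .skip (pos (.lit 0))).run σ).nat y) 0 (∅ : Finset (Fin K)) := by
  intro v
  rw [(tabLoop_spec hG.1 hxy rfl rfl 0 (fun _ => False) (by
    intro i σ' _ _ _ _
    simp [NExp.eval, BExp.holds])).1 v]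
  simp

theorem copy_spec {σ : Store} (hG : HasGraph σ G) {x y z : ℕ} (hxy : x ≠ y) (hzx : z ≠ x)
    (hzy : z ≠ y) {S : Finset (Fin K)} (hS : ColSet (σ.nat z) 0 S) :
    ColSet (((tabLoop x y (.lit 0) .skip (pos (at1 z (var x)))).run σ).nat y) 0 S := by
  intro v
  rw [(tabLoop_spec hG.1 hxy rfl rfl 0 (fun v => v ∈ S) (by
    intro i σ' h _ hi _
    simp only [run_skip, BExp.holds, NExp.eval, hi, h z hzx hzy rfl, hS i, and_self])).1 v]

theorem indepCmd_spec (hself : ∀ a, G.Adj a a) {σ : Store} (hG : HasGraph σ G) {S : Finset (Fin K)}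
    (hS : ColSet (σ.nat 27) 0 S) :
    ColSet ((indepCmd.run σ).nat 23) 0 (greedyIndep G S) ∧
      (indepCmd.run σ).nat 24 (0, 0, 0) = (greedyIndep G S).card := by
  unfold indepCmd
  rw [run_seq, run_seq]
  have hcl := clear_spec (x := 36) (y := 23) hG (by decide)
  have fr₀ := frame_run (tabLoop 36 23 (.lit 0) .skip (pos (.lit 0))) σ
  set σ₀ := (tabLoop 36 23 (.lit 0) .skip (pos (.lit 0))).run σ
  have e : (setVar 24 (.lit 0)).run σ₀ = σ₀.setNat 24 (0, 0, 0) 0 := rfl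
  rw [e]
  set σ₁ := σ₀.setNat 24 (0, 0, 0) 0 with hσ₁
  have hG1 : HasGraph σ₁ G := hG.frame (by simp [hσ₁, Store.setNat, fr₀.1 2 rfl])
    (by simp [hσ₁, Store.setNat, fr₀.1 3 rfl])
  have hS1 : ColSet (σ₁.nat 27) 0 S := by simpa [hσ₁, Store.setNat, fr₀.1 27 rfl] using hS
  refine loop_foldl (fun I σ' => ColSet (σ'.nat 23) 0 I ∧ σ'.nat 24 (0, 0, 0) = I.card)
    (indepStep G S) ∅ (by simpa [NExp.eval] using hG1.1) ?_ ?_ ?_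
  · exact ⟨by simpa [hσ₁, Store.setNat] using hcl, by simp [hσ₁, nat_setNat]⟩
  · rintro i I σ' hf hi ⟨h1, h2⟩
    have hG' : HasGraph σ' G := hG1.frame (hf.1 2 rfl) (hf.1 3 rfl)
    have hS' : ColSet (σ'.nat 27) 0 S := by rw [hf.1 27 rfl]; exact hS1
    rw [run_seq, run_ite]
    have hc := countLoop_spec (x := 38) (y := 26) (σ := σ') (K := K)
      (b := .and (pos (at1 23 (var 38)))
        (pos (.add (at2 3 (var 37) (var 38)) (at2 3 (var 38) (var 37))))) hG'.1 (by decide)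
      (by decide) (fun w => w ∈ I ∧ (G.Adj i w ∨ G.Adj w i)) (by
        intro j σ'' h _ hj
        simp only [BExp.holds, NExp.eval, hj, h 23 (by decide) (by decide),
            h 3 (by decide) (by decide), h 37 (by decide) (by decide), hi, h1 j]
        rw [← hG'.2 i j, ← hG'.2 j i]
        refine and_congr_right fun _ => ?_
        -- A disjunction of two adjacencies is tested as positivity of the sum of the two matrix
        -- entries.
        omega)
    have fr := frame_run (countLoop 38 26 (.and (pos (at1 23 (var 38)))
        (pos (.add (at2 3 (var 37) (var 38)) (at2 3 (var 38) (var 37)))))) σ'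
    set σ₂ := (countLoop 38 26 (.and (pos (at1 23 (var 38)))
        (pos (.add (at2 3 (var 37) (var 38)) (at2 3 (var 38) (var 37)))))).run σ'
    have h12 : ColSet (σ₂.nat 23) 0 I := by rw [fr.1 23 rfl]; exact h1
    have hi2 : σ₂.nat 37 (0, 0, 0) = i := by rw [fr.1 37 rfl, hi]
    have h22 : σ₂.nat 24 (0, 0, 0) = I.card := by rw [fr.1 24 rfl, h2]
    have htest : (BExp.and (pos (at1 27 (var 37))) (.nle (var 26) (.lit 0))).holds σ₂ ↔
        (i ∈ S ∧ ∀ w ∈ I, ¬ (G.Adj i w ∨ G.Adj w i)) := by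
      simp only [BExp.holds, NExp.eval, hi2, fr.1 27 rfl, hc, hS' i, Nat.le_zero,
        Finset.card_eq_zero, Finset.filter_eq_empty_iff, Finset.mem_univ, true_implies, not_and]
    unfold indepStep
    simp only [htest]
    split_ifs with ht
    · simp only [run_seq, run_setNat, NExp.eval, hi2]
      -- The self-loop makes an accepted vertex new, so the running size in array 24 is exact.
      have hiI : i ∉ I := fun h => ht.2 i h (Or.inl (hself i))
      rw [Finset.card_insert_of_notMem hiI]
      refine ⟨?_, ?_⟩
      · rw [nat_setNat_of_ne _ _ _ (by decide)]
        refine colSet_insert h12 i (by simp [nat_setNat]) fun p hp => by simp [nat_setNat, hp]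
      · simp [nat_setNat, h22]
    · exact ⟨h12, h22⟩
  · rintro q σ' h v
    simpa [Store.setNat] using h

def bestCmd : Cmd :=
  .ite (.nle (.add (var 25) (.lit 1)) (var 24))
    (.seq (tabLoop 39 22 (.lit 0) .skip (pos (at1 23 (var 39)))) (setVar 25 (var 24))) .skip

theorem bestCmd_spec {σ : Store} (hG : HasGraph σ G) {I J : Finset (Fin K)}
    (hI : ColSet (σ.nat 22) 0 I) (hIc : σ.nat 25 (0, 0, 0) = I.card)
    (hJ : ColSet (σ.nat 23) 0 J) (hJc : σ.nat 24 (0, 0, 0) = J.card) :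
    ColSet ((bestCmd.run σ).nat 22) 0 (largerOf I J) ∧
      (bestCmd.run σ).nat 25 (0, 0, 0) = (largerOf I J).card := by
  unfold bestCmd largerOf
  rw [run_ite]
  simp only [BExp.holds, NExp.eval, hIc, hJc, Nat.lt_iff_add_one_le]
  split_ifs
  · have hcp := copy_spec (x := 39) (y := 22) hG (by decide) (by decide) (by decide) hJ
    have fr := frame_run (tabLoop 39 22 (.lit 0) .skip (pos (at1 23 (var 39)))) σ
    rw [run_seq, run_setNat]
    refine ⟨?_, ?_⟩
    · rw [nat_setNat_of_ne _ _ _ (by decide)]; exact hcp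
    · simp [nat_setNat, NExp.eval, fr.1 24 rfl, hJc]
  · exact ⟨hI, hIc⟩

def phaseCmd : Cmd :=
  .seq (setVar 28 (.sub kExp (var 30))) <| .seq lowInCmd <| .seq indepCmd <| .seq bestCmd pickCmd

/-- The state of the strategy's computation is stored in the memory. -/
def HasDomState (σ : Store) (s : DomState K) : Prop :=
  ColSet (σ.nat 20) 0 s.rest ∧ ColSet (σ.nat 21) 0 s.dom ∧ ColSet (σ.nat 22) 0 s.best ∧
    σ.nat 25 (0, 0, 0) = s.best.card

/-- The independent set is computed before `pickCmd` overwrites the rest, as `domPhase` requires. -/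
theorem phaseCmd_spec (hself : ∀ a, G.Adj a a) {σ : Store} (hG : HasGraph σ G) {s : DomState K}
    (hs : HasDomState σ s) {i : Fin K} (hi : σ.nat 30 (0, 0, 0) = i) :
    HasDomState (phaseCmd.run σ) (domPhase G s i) := by
  obtain ⟨h1, h2, h3, h4⟩ := hs
  unfold phaseCmd
  simp only [run_seq]
  have e1 : (setVar 28 (.sub kExp (var 30))).run σ = σ.setNat 28 (0, 0, 0) (K - i) := by
    rw [run_setNat]; simp [NExp.eval, hi, hG.1]
  rw [e1]
  set σ₁ := σ.setNat 28 (0, 0, 0) (K - i) with hσ₁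
  have g1 : ∀ z, z ≠ 28 → σ₁.nat z = σ.nat z := fun z hz => by simp [hσ₁, Store.setNat, hz]
  have hG1 : HasGraph σ₁ G := hG.frame (g1 2 (by decide)) (g1 3 (by decide))
  have k1 : ColSet (σ₁.nat 20) 0 s.rest := by rw [g1 20 (by decide)]; exact h1
  have d1 : σ₁.nat 28 (0, 0, 0) = K - i := by simp [hσ₁, nat_setNat]
  have l2 := lowInCmd_spec hG1 k1 d1
  have f2 := frame_run lowInCmd σ₁
  set σ₂ := lowInCmd.run σ₁
  have hG2 : HasGraph σ₂ G := hG1.frame (f2.1 2 rfl) (f2.1 3 rfl)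
  have l3 := indepCmd_spec hself hG2 l2
  have f3 := frame_run indepCmd σ₂
  set σ₃ := indepCmd.run σ₂
  have hG3 : HasGraph σ₃ G := hG2.frame (f3.1 2 rfl) (f3.1 3 rfl)
  have l4 := bestCmd_spec hG3 (I := s.best)
    (by rw [f3.1 22 rfl, f2.1 22 rfl, g1 22 (by decide)]; exact h3)
    (by rw [f3.1 25 rfl, f2.1 25 rfl, g1 25 (by decide)]; exact h4) l3.1 l3.2
  have f4 := frame_run bestCmd σ₃
  set σ₄ := bestCmd.run σ₃
  have hG4 : HasGraph σ₄ G := hG3.frame (f4.1 2 rfl) (f4.1 3 rfl)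
  have l5 := pickCmd_spec hG4 (R := s.rest) (D := s.dom) (d := K - i)
    (by rw [f4.1 20 rfl, f3.1 20 rfl, f2.1 20 rfl]; exact k1)
    (by rw [f4.1 21 rfl, f3.1 21 rfl, f2.1 21 rfl, g1 21 (by decide)]; exact h2)
    (by rw [f4.1 28 rfl, f3.1 28 rfl, f2.1 28 rfl]; exact d1)
  have f5 := frame_run pickCmd σ₄
  refine ⟨l5.1, l5.2, ?_, ?_⟩
  · rw [f5.1 22 rfl]; exact l4.1
  · rw [f5.1 25 rfl]; exact l4.2

def phasesCmd : Cmd :=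
  .seq (tabLoop 40 21 (.lit 0) .skip (pos (.lit 0))) <|
    .seq (tabLoop 40 22 (.lit 0) .skip (pos (.lit 0))) <|
      .seq (setVar 25 (.lit 0)) (.loop 30 kExp phaseCmd)

theorem phasesCmd_spec (hself : ∀ a, G.Adj a a) {σ : Store} (hG : HasGraph σ G)
    {A : Finset (Fin K)} (hA : ColSet (σ.nat 20) 0 A) :
    HasDomState (phasesCmd.run σ) (domPhases G A) := by
  unfold phasesCmd
  simp only [run_seq]
  have l1 := clear_spec (x := 40) (y := 21) hG (by decide)
  have f1 := frame_run (tabLoop 40 21 (.lit 0) .skip (pos (.lit 0))) σ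
  set σ₁ := (tabLoop 40 21 (.lit 0) .skip (pos (.lit 0))).run σ
  have hG1 : HasGraph σ₁ G := hG.frame (f1.1 2 rfl) (f1.1 3 rfl)
  have l2 := clear_spec (x := 40) (y := 22) hG1 (by decide)
  have f2 := frame_run (tabLoop 40 22 (.lit 0) .skip (pos (.lit 0))) σ₁
  set σ₂ := (tabLoop 40 22 (.lit 0) .skip (pos (.lit 0))).run σ₁
  have hG2 : HasGraph σ₂ G := hG1.frame (f2.1 2 rfl) (f2.1 3 rfl)
  have e3 : (setVar 25 (.lit 0)).run σ₂ = σ₂.setNat 25 (0, 0, 0) 0 := rfl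
  rw [e3]
  set σ₃ := σ₂.setNat 25 (0, 0, 0) 0 with hσ₃
  have g3 : ∀ z, z ≠ 25 → σ₃.nat z = σ₂.nat z := fun z hz => by simp [hσ₃, Store.setNat, hz]
  have hG3 : HasGraph σ₃ G := hG2.frame (g3 2 (by decide)) (g3 3 (by decide))
  refine loop_foldl (fun s σ' => HasDomState σ' s) (domPhase G) ⟨A, ∅, ∅⟩
    (by simpa [NExp.eval] using hG3.1) ⟨?_, ?_, ?_, ?_⟩ ?_ ?_
  · rw [g3 20 (by decide), f2.1 20 rfl, f1.1 20 rfl]; exact hA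
  · rw [g3 21 (by decide), f2.1 21 rfl]; exact l1
  · rw [g3 22 (by decide)]; exact l2
  · simp [hσ₃, nat_setNat]
  · intro i s σ' hf hi hs
    exact phaseCmd_spec hself (hG3.frame (hf.1 2 rfl) (hf.1 3 rfl)) hs hi
  · intro s σ' h v
    simpa [HasDomState, Store.setNat] using h

/-- A list of vertices is stored in the array 14, its length in the variable 15. -/
def HasList (σ : Store) (L : List (Fin K)) : Prop :=
  σ.nat 15 (0, 0, 0) = L.length ∧ ∀ i (h : i < L.length), σ.nat 14 (i, 0, 0) = L[i]

def appendLoop (x : ℕ) (b : BExp) : Cmd :=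
  .loop x kExp <| .ite b (.seq (.setNat 14 (var 15) (.lit 0) (.lit 0) (var x))
    (setVar 15 (.add (var 15) (.lit 1)))) .skip

theorem foldl_append_filter {α : Type*} (P : α → Prop) (l L : List α) :
    l.foldl (fun L v => if P v then L ++ [v] else L) L = L ++ l.filter fun v => P v := by
  induction l generalizing L with
  | nil => simp
  | cons a l ih =>
    rw [List.foldl_cons, ih, List.filter_cons]
    by_cases h : P a <;> simp [h]

theorem appendLoop_spec {σ : Store} (hG : HasGraph σ G) {x : ℕ} (h14 : x ≠ 14) (h15 : x ≠ 15)
    {b : BExp} {L : List (Fin K)} (hL : HasList σ L) (P : Fin K → Prop)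
    (hb : ∀ (i : Fin K) (σ' : Store), (∀ z, z ≠ x → z ≠ 14 → z ≠ 15 → σ'.nat z = σ.nat z) →
      σ'.nat x (0, 0, 0) = i → (b.holds σ' ↔ P i)) :
    HasList ((appendLoop x b).run σ) (L ++ (List.finRange K).filter fun v => P v) := by
  rw [← foldl_append_filter]
  refine loop_foldl (fun L σ' => HasList σ' L) _ L (by simpa [NExp.eval] using hG.1) hL ?_ ?_
  · intro i L' σ' hf hi hs
    have hh := hb i σ' (fun z hz h1 h2 => hf.1 z (by
      simp [Cmd.writesNat, natBeq_eq_false_iff, Ne.symm hz, Ne.symm h1, Ne.symm h2])) hi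
    rw [run_ite]
    simp only [hh]
    split_ifs
    · simp only [run_seq, run_setNat, NExp.eval, hs.1, hi]
      refine ⟨by simp [nat_setNat, hs.1], fun j hj => ?_⟩
      rw [nat_setNat_of_ne _ _ _ (by decide), nat_setNat]
      rcases Nat.lt_or_ge j L'.length with h | h
      · rw [if_neg (by simp; omega), List.getElem_append_left h]
        exact hs.2 j h
      · obtain rfl : j = L'.length := by simp at hj; omega
        simp
    · exact hs
  · intro L' σ' h v
    unfold HasList
    rwa [nat_setNat_of_ne _ _ _ h14.symm, nat_setNat_of_ne _ _ _ h15.symm]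

def gameCmd : Cmd :=
  .seq phasesCmd <| .seq (setVar 15 (.lit 0)) <| .seq (appendLoop 41 (pos (at1 22 (var 41)))) <|
    appendLoop 42 (.and (pos (at1 21 (var 42))) (.not (pos (at1 22 (var 42)))))

theorem gameCmd_spec (hself : ∀ a, G.Adj a a) {σ : Store} (hG : HasGraph σ G)
    {A : Finset (Fin K)} (hA : ColSet (σ.nat 20) 0 A) :
    HasList (gameCmd.run σ) (dominateList G A) := by
  unfold gameCmd
  simp only [run_seq]
  obtain ⟨-, l2, l3, -⟩ := phasesCmd_spec hself hG hA
  have f1 := frame_run phasesCmd σ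
  set σ₁ := phasesCmd.run σ
  have hG1 : HasGraph σ₁ G := hG.frame (f1.1 2 rfl) (f1.1 3 rfl)
  have e2 : (setVar 15 (.lit 0)).run σ₁ = σ₁.setNat 15 (0, 0, 0) 0 := rfl
  rw [e2]
  set σ₂ := σ₁.setNat 15 (0, 0, 0) 0 with hσ₂
  have g2 : ∀ z, z ≠ 15 → σ₂.nat z = σ₁.nat z := fun z hz => by simp [hσ₂, Store.setNat, hz]
  have hG2 : HasGraph σ₂ G := hG1.frame (g2 2 (by decide)) (g2 3 (by decide))
  have k2 : ColSet (σ₂.nat 21) 0 (domPhases G A).dom := by rw [g2 21 (by decide)]; exact l2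
  have k3 : ColSet (σ₂.nat 22) 0 (domPhases G A).best := by rw [g2 22 (by decide)]; exact l3
  have l4 := appendLoop_spec (x := 41) hG2 (by decide) (by decide) (b := pos (at1 22 (var 41)))
    (L := []) ⟨by simp [hσ₂, nat_setNat], by simp⟩ (fun v => v ∈ (domPhases G A).best) (by
      intro i σ' h hi
      simp only [BExp.holds, NExp.eval, hi, h 22 (by decide) (by decide) (by decide), k3 i])
  have f3 := frame_run (appendLoop 41 (pos (at1 22 (var 41)))) σ₂
  set σ₃ := (appendLoop 41 (pos (at1 22 (var 41)))).run σ₂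
  have hG3 : HasGraph σ₃ G := hG2.frame (f3.1 2 rfl) (f3.1 3 rfl)
  have l5 := appendLoop_spec (x := 42) hG3 (by decide) (by decide)
    (b := .and (pos (at1 21 (var 42))) (.not (pos (at1 22 (var 42))))) l4
    (fun v => v ∈ (domPhases G A).dom ∧ v ∉ (domPhases G A).best) (by
      intro i σ' h hi
      simp only [BExp.holds, NExp.eval, hi, h 22 (by decide) (by decide) (by decide),
        h 21 (by decide) (by decide) (by decide), f3.1 21 rfl, f3.1 22 rfl, k3 i, k2 i])
  rw [List.nil_append] at l5
  convert l5 using 1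
  unfold dominateList
  congr!

end GameProgram

/-! ### The program of layered arm elimination -/

section ElimProgram
variable {M K : ℕ} {G : Digraph (Fin K)}

theorem covered_append (h : Transcript K) (p : Finset (Fin K) × List (Fin K)) :
    covered G (h ++ [p]) = covered G h ∪ outNbrs G p.2.toFinset := by
  simp [covered, outNbrs_union]

/-- The vertices observed on layer `ℓ`, including those observed in the move in progress. -/
noncomputable def observed (G : Digraph (Fin K)) (st : ElimState M K) (ℓ : ℕ) : Finset (Fin K) :=
  covered G ((st.close G).record ℓ)

theorem observed_eq (st : ElimState M K) (ℓ : ℕ) :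
    observed G st ℓ = covered G (st.record ℓ) ∪
      if ℓ = st.layer then outNbrs G st.chosen.toFinset else ∅ := by
  unfold observed ElimState.close
  by_cases h : ℓ = st.layer
  · subst h; simp [covered_append]
  · simp [h]

theorem outNbrs_empty : outNbrs G ∅ = ∅ := by ext v; simp [mem_outNbrs]

/-- A newly opened move has no chosen actions. Hence closing one move and opening the next leaves
the observed sets alone, and the program need not touch them. -/
theorem observed_enter (𝒜 : GameAlg) (c : Fin M) (ℓ : ℕ) (A : Finset (Fin K))
    (st : ElimState M K) (ℓ' : ℕ) :
    observed G ((st.close G).enter 𝒜 G c ℓ A) ℓ' = observed G st ℓ' := by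
  rw [observed_eq]
  simp [ElimState.enter, outNbrs_empty, observed]

theorem observed_choose (st : ElimState M K) (ℓ : ℕ) :
    observed G st.choose ℓ = observed G st ℓ ∪
      if ℓ = st.layer then outNbrs G (st.todo.take 1).toFinset else ∅ := by
  simp only [observed_eq, ElimState.choose]
  split_ifs <;> simp [outNbrs_union, Finset.union_assoc]

/-- The past rounds, oldest first, are stored in the input arrays. -/
structure HasData (σ : Store) (T : ℕ) (G : Digraph (Fin K)) (δ : ℝ) (l : List (Round M K)) :
    Prop where
  graph : HasGraph σ G
  horizon : σ.nat 0 (0, 0, 0) = T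
  contexts : σ.nat 1 (0, 0, 0) = M
  rounds : σ.nat 4 (0, 0, 0) = l.length
  ctx : ∀ u (hu : u < l.length), σ.nat 5 (u, 0, 0) = l[u].ctx
  act : ∀ u (hu : u < l.length), σ.nat 6 (u, 0, 0) = l[u].act
  conf : σ.real 0 (0, 0, 0) = δ
  obs : ∀ u (hu : u < l.length) (c : Fin M) (a : Fin K), σ.real 1 (u, c, a) = l[u].obs c a

/-- The program leaves the input alone. -/
def KeepsInput (p : Cmd) : Prop :=
  (∀ z < 7, p.writesNat z = false) ∧ ∀ z < 2, p.writesReal z = false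

theorem HasData.of_agree {σ σ' : Store} {T : ℕ} {δ : ℝ} {l : List (Round M K)}
    (hD : HasData σ T G δ l) (hn : ∀ z < 7, σ'.nat z = σ.nat z)
    (hr : ∀ z < 2, σ'.real z = σ.real z) : HasData σ' T G δ l := by
  obtain ⟨h1, h2, h3, h4, h5, h6, h7, h8⟩ := hD
  refine ⟨h1.frame (hn 2 (by decide)) (hn 3 (by decide)), ?_, ?_, ?_, ?_, ?_, ?_, ?_⟩
  · rw [hn 0 (by decide)]; exact h2
  · rw [hn 1 (by decide)]; exact h3
  · rw [hn 4 (by decide)]; exact h4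
  · rw [hn 5 (by decide)]; exact h5
  · rw [hn 6 (by decide)]; exact h6
  · rw [hr 0 (by decide)]; exact h7
  · rw [hr 1 (by decide)]; exact h8

theorem HasData.frame {σ σ' : Store} {T : ℕ} {δ : ℝ} {l : List (Round M K)} {p : Cmd}
    (hD : HasData σ T G δ l) (hf : Frame p σ σ') (hp : KeepsInput p) : HasData σ' T G δ l :=
  hD.of_agree (fun z hz => hf.1 z (hp.1 z hz)) fun z hz => hf.2 z (hp.2 z hz)

abbrev realVar (x : ℕ) : RExp := .get x (.lit 0) (.lit 0) (.lit 0)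

/-- Sum and number of the observed rewards of one action. -/
def sumCmd : Cmd :=
  .loop 52 roundsExp <|
    .ite (.and (.nle (.add (var 52) (.lit 1)) (var 60)) (pos (at2 3 (at1 6 (var 52)) (var 50))))
      (.seq (setVar 51 (.add (var 51) (.lit 1)))
        (.setReal 2 (.lit 0) (.lit 0) (.lit 0)
          (.add (realVar 2) (.get 1 (var 52) (at1 5 (var 60)) (var 50))))) .skip

/-- To keep the loop bounded it runs over all rounds; the guard ignores those not yet replayed,
hence `min i s` in the invariant. -/
theorem sumCmd_spec {σ : Store} {T : ℕ} {δ : ℝ} {l : List (Round M K)} (hD : HasData σ T G δ l)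
    {s : ℕ} (hs : s ≤ l.length) (h60 : σ.nat 60 (0, 0, 0) = s) {c : Fin M}
    (hc : σ.nat 5 (s, 0, 0) = c) {a : Fin K} (ha : σ.nat 50 (0, 0, 0) = a)
    (h51 : σ.nat 51 (0, 0, 0) = 0) (h2 : σ.real 2 (0, 0, 0) = 0) :
    (sumCmd.run σ).nat 51 (0, 0, 0) = ((l.take s).filter fun x => G.Adj x.act a).length ∧
      (sumCmd.run σ).real 2 (0, 0, 0) =
        (((l.take s).filter fun x => G.Adj x.act a).map fun x => x.obs c a).sum := by
  have := loop_invariant (x := 52) (e := roundsExp) (σ := σ)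
    (body := .ite (.and (.nle (.add (var 52) (.lit 1)) (var 60))
      (pos (at2 3 (at1 6 (var 52)) (var 50))))
      (.seq (setVar 51 (.add (var 51) (.lit 1)))
        (.setReal 2 (.lit 0) (.lit 0) (.lit 0)
          (.add (realVar 2) (.get 1 (var 52) (at1 5 (var 60)) (var 50))))) .skip)
    (fun i σ' => σ'.nat 51 (0, 0, 0) =
        ((l.take (min i s)).filter fun x => G.Adj x.act a).length ∧
      σ'.real 2 (0, 0, 0) =
        (((l.take (min i s)).filter fun x => G.Adj x.act a).map fun x => x.obs c a).sum)
    (by simp [h51, h2]) (by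
      rintro i hi σ' hf hx ⟨k1, k2⟩
      have hD' : HasData σ' T G δ l := hD.of_agree
        (fun z hz => hf.1 z (by
          simp [Cmd.writesNat, natBeq_eq_false_iff]; omega))
        (fun z hz => hf.2 z (by simp [Cmd.writesReal, natBeq_eq_false_iff]; omega))
      have e60 : σ'.nat 60 (0, 0, 0) = s := by rw [hf.1 60 rfl, h60]
      have e50 : σ'.nat 50 (0, 0, 0) = a := by rw [hf.1 50 rfl, ha]
      have e5 : σ'.nat 5 (s, 0, 0) = c := by rw [hf.1 5 rfl, hc]
      rw [run_ite]
      rcases Nat.lt_or_ge i s with his | his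
      · have hil : i < l.length := by omega
        have htest : (BExp.and (.nle (.add (var 52) (.lit 1)) (var 60))
            (pos (at2 3 (at1 6 (var 52)) (var 50)))).holds σ' ↔ G.Adj l[i].act a := by
          simp only [BExp.holds, NExp.eval, hx, e60, e50, hD'.act i hil, hD'.graph.2]
          simp [his]
        have hmin : min (i + 1) s = i + 1 := by omega
        have hmin' : min i s = i := by omega
        rw [hmin, List.take_succ_eq_append_getElem hil, List.filter_append, List.map_append,
          List.sum_append, List.length_append]
        rw [hmin'] at k1 k2
        simp only [htest]
        split_ifs with hadj
        · simp only [run_seq, run_setNat, run_setReal, NExp.eval, RExp.eval]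
          refine ⟨?_, ?_⟩
          · simp [nat_setReal, nat_setNat, k1, hadj]
          · simp only [real_setReal, real_setNat, nat_setNat_of_ne _ _ _ (show (52 : ℕ) ≠ 51 by decide),
              nat_setNat_of_ne _ _ _ (show (60 : ℕ) ≠ 51 by decide),
              nat_setNat_of_ne _ _ _ (show (50 : ℕ) ≠ 51 by decide),
              nat_setNat_of_ne _ _ _ (show (5 : ℕ) ≠ 51 by decide), e60, hx, e5, e50,
              hD'.obs i hil, k2]
            simp [hadj]
        · rw [run_skip]
          simp [k1, k2, hadj]
      · have htest : ¬ (BExp.and (.nle (.add (var 52) (.lit 1)) (var 60))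
            (pos (at2 3 (at1 6 (var 52)) (var 50)))).holds σ' := by
          simp only [BExp.holds, NExp.eval, hx, e60, not_and]
          intro h; omega
        rw [if_neg htest, run_skip]
        have hmin : min (i + 1) s = min i s := by omega
        rw [hmin]
        exact ⟨k1, k2⟩) (by
      rintro i σ' h v
      simpa [Store.setNat] using h)
  have e : min (roundsExp.eval σ) s = s := by
    simp only [NExp.eval, hD.rounds]; omega
  rw [e] at this
  exact this

/-- The empirical rewards of all actions. -/
def empMeanCmd : Cmd :=
  .loop 50 kExp <| .seq (setVar 51 (.lit 0)) <|
    .seq (.setReal 2 (.lit 0) (.lit 0) (.lit 0) (.ofNat (.lit 0))) <| .seq sumCmd <|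
      .setReal 3 (var 50) (.lit 0) (.lit 0) (.div (realVar 2) (.ofNat (var 51)))

theorem empMeanCmd_spec {σ : Store} {T : ℕ} {δ : ℝ} {l : List (Round M K)}
    (hD : HasData σ T G δ l) {s : ℕ} (hs : s ≤ l.length) (h60 : σ.nat 60 (0, 0, 0) = s) {c : Fin M}
    (hc : σ.nat 5 (s, 0, 0) = c) (a : Fin K) :
    (empMeanCmd.run σ).real 3 (a, 0, 0) = empMean G (l.take s).reverse c a := by
  have := loop_invariant (x := 50) (e := kExp) (σ := σ)
    (body := .seq (setVar 51 (.lit 0)) <|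
    .seq (.setReal 2 (.lit 0) (.lit 0) (.lit 0) (.ofNat (.lit 0))) <| .seq sumCmd <|
      .setReal 3 (var 50) (.lit 0) (.lit 0) (.div (realVar 2) (.ofNat (var 51))))
    (fun i σ' => ∀ a : Fin K, a.1 < i →
      σ'.real 3 (a, 0, 0) = empMean G (l.take s).reverse c a)
    (by simp) (by
      rintro i hi σ' hf hx ih a hai
      have hi' : i < K := by simpa [NExp.eval, hD.graph.1] using hi
      simp only [run_seq]
      have e1 : (setVar 51 (.lit 0)).run σ' = σ'.setNat 51 (0, 0, 0) 0 := rfl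
      rw [e1]
      set σ₁ := σ'.setNat 51 (0, 0, 0) 0 with hσ₁
      have e2 : (Cmd.setReal 2 (.lit 0) (.lit 0) (.lit 0) (.ofNat (.lit 0))).run σ₁ =
        σ₁.setReal 2 (0, 0, 0) 0 := by rw [run_setReal]; simp [NExp.eval, RExp.eval]
      rw [e2]
      set σ₂ := σ₁.setReal 2 (0, 0, 0) 0 with hσ₂
      have gn : ∀ z, z ≠ 51 → σ₂.nat z = σ'.nat z := fun z hz => by
        simp [hσ₂, hσ₁, Store.setNat, Store.setReal, hz]
      have gr : ∀ z, z ≠ 2 → σ₂.real z = σ'.real z := fun z hz => by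
        simp [hσ₂, hσ₁, Store.setNat, Store.setReal, hz]
      have hD2 : HasData σ₂ T G δ l := hD.of_agree
        (fun z hz => by
          rw [gn z (by omega)]
          exact hf.1 z (by
            simp [Cmd.writesNat, sumCmd, natBeq_eq_false_iff]; omega))
        (fun z hz => by
          rw [gr z (by omega)]
          exact hf.2 z (by simp [Cmd.writesReal, sumCmd, natBeq_eq_false_iff]; omega))
      obtain ⟨k1, k2⟩ := sumCmd_spec hD2 hs (c := c) (a := ⟨i, hi'⟩)
        (by rw [gn 60 (by decide), hf.1 60 rfl, h60])
        (by rw [gn 5 (by decide), hf.1 5 rfl, hc]) (by rw [gn 50 (by decide), hx])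
        (by simp [hσ₂, hσ₁, nat_setReal, nat_setNat]) (by simp [hσ₂, real_setReal])
      have fr := frame_run sumCmd σ₂
      set σ₃ := sumCmd.run σ₂
      rw [run_setReal]
      simp only [NExp.eval, RExp.eval, fr.1 50 rfl, gn 50 (by decide), hx, k1, k2, real_setReal]
      rcases Nat.lt_succ_iff_lt_or_eq.mp hai with h | h
      · rw [if_neg (by simp; omega), fr.2 3 rfl, gr 3 (by decide)]
        exact ih a h
      · obtain rfl : a = ⟨i, hi'⟩ := Fin.ext h
        rw [if_pos (by simp)]
        -- The program adds the oldest round first, whereas histories are listed newest first.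
        simp only [empMean, List.filter_reverse, List.map_reverse, List.sum_reverse,
          List.length_reverse]) (by
      rintro i σ' h v
      simpa [Store.setNat] using h)
  have e : kExp.eval σ = K := by simpa [NExp.eval] using hD.graph.1
  rw [e] at this
  exact this a a.2

def widthCmd : Cmd :=
  .setReal 4 (.lit 0) (.lit 0) (.lit 0) <| .mul (.ofNat (.lit 2)) <| .sqrt <| .div
    (.log (.div (.mul (.mul (.mul (.ofNat (.lit 2)) (.ofNat (var 1))) (.ofNat (var 2)))
      (.ofNat (var 0))) (realVar 0))) (.ofNat (var 11))

def beatenTest : BExp :=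
  .and (pos (at1 12 (var 54)))
    (.not (.rle (.sub (.get 3 (var 54) (.lit 0) (.lit 0)) (realVar 4))
      (.get 3 (var 53) (.lit 0) (.lit 0))))

def keepCmd : Cmd :=
  tabLoop 53 17 (.lit 0) (countLoop 54 26 beatenTest)
    (.and (pos (at1 12 (var 53))) (.nle (var 26) (.lit 0)))

def elimCmd : Cmd :=
  .seq empMeanCmd <| .seq widthCmd <| .seq keepCmd <|
    tabLoop 55 12 (.lit 0) .skip (pos (at1 17 (var 55)))

/-- No maximum is computed: an action is kept when the count of active actions that beat it by more
than `w` is zero. -/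
theorem keepCmd_spec {σ : Store} (hG : HasGraph σ G) {A : Finset (Fin K)}
    (hA : ColSet (σ.nat 12) 0 A) (m : Fin K → ℝ) (hm : ∀ a : Fin K, σ.real 3 (a, 0, 0) = m a)
    {w : ℝ} (hw : σ.real 4 (0, 0, 0) = w) :
    ColSet ((keepCmd.run σ).nat 17) 0 (A.filter fun a => ∀ a' ∈ A, m a' - w ≤ m a) := by
  have := (tabLoop_spec (x := 53) (y := 17) (re := .lit 0)
    (pre := countLoop 54 26 beatenTest)
    (b := .and (pos (at1 12 (var 53))) (.nle (var 26) (.lit 0))) hG.1 (by decide)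
    rfl rfl 0 (fun a => a ∈ A ∧ ∀ a' ∈ A, m a' - w ≤ m a) (by
      intro i σ' h hr hi hy
      have hc := countLoop_spec (x := 54) (y := 26) (σ := σ') (K := K) (b := beatenTest)
        (by rw [h 2 (by decide) (by decide) rfl]; exact hG.1) (by decide) (by decide)
        (fun a' => a' ∈ A ∧ ¬ (m a' - w ≤ m i)) (by
          intro j σ'' h' hr' hj
          simp only [beatenTest, BExp.holds, NExp.eval, RExp.eval, hj,
            h' 12 (by decide) (by decide), h' 53 (by decide) (by decide), hi, hr',
            h 12 (by decide) (by decide) rfl, hr 3 rfl, hr 4 rfl, hm, hw, hA j])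
      have fr := frame_run (countLoop 54 26 beatenTest) σ'
      refine ⟨rfl, ?_⟩
      simp only [BExp.holds, NExp.eval, hc, fr.1 53 rfl, fr.1 12 rfl, hi,
        h 12 (by decide) (by decide) rfl, hA i, Nat.le_zero, Finset.card_eq_zero,
        Finset.filter_eq_empty_iff, Finset.mem_univ, true_implies, not_and, not_not])).1
  intro v
  rw [keepCmd, this v]
  simp

theorem elimCmd_spec {σ : Store} {T : ℕ} {δ : ℝ} {l : List (Round M K)}
    (hD : HasData σ T G δ l) {s : ℕ} (hs : s ≤ l.length) (h60 : σ.nat 60 (0, 0, 0) = s) {c : Fin M}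
    (hc : σ.nat 5 (s, 0, 0) = c) {ℓ : ℕ} (hℓ : σ.nat 11 (0, 0, 0) = ℓ) {A : Finset (Fin K)}
    (hA : ColSet (σ.nat 12) 0 A) :
    ColSet ((elimCmd.run σ).nat 12) 0 (eliminate T G δ (l.take s).reverse c ℓ A) := by
  unfold elimCmd
  simp only [run_seq]
  have k1 := empMeanCmd_spec hD hs h60 hc
  have f1 := frame_run empMeanCmd σ
  set σ₁ := empMeanCmd.run σ
  have hG1 : HasGraph σ₁ G := hD.graph.frame (f1.1 2 rfl) (f1.1 3 rfl)
  have k2 : (widthCmd.run σ₁).real 4 (0, 0, 0) = 2 * √(Real.log (2 * M * K * T / δ) / ℓ) := by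
    rw [widthCmd, run_setReal]
    simp [real_setReal, NExp.eval, RExp.eval, f1.1 0 rfl, f1.1 1 rfl, f1.1 2 rfl, f1.1 11 rfl,
      f1.2 0 rfl, hD.horizon, hD.contexts, hD.graph.1, hD.conf, hℓ]
  have f2 := frame_run widthCmd σ₁
  set σ₂ := widthCmd.run σ₁
  have hG2 : HasGraph σ₂ G := hG1.frame (f2.1 2 rfl) (f2.1 3 rfl)
  have k3 := keepCmd_spec hG2 (A := A) (by rw [f2.1 12 rfl, f1.1 12 rfl]; exact hA)
    (fun a => empMean G (l.take s).reverse c a) (fun a => by rw [f2.2 3 rfl]; exact k1 a) k2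
  have f3 := frame_run keepCmd σ₂
  set σ₃ := keepCmd.run σ₂
  have hG3 : HasGraph σ₃ G := hG2.frame (f3.1 2 rfl) (f3.1 3 rfl)
  have k4 := copy_spec (x := 55) (y := 12) hG3 (by decide) (by decide) (by decide) k3
  unfold eliminate
  convert k4 using 1

/-- The state of the elimination algorithm is stored in the memory. -/
structure HasState (σ : Store) (G : Digraph (Fin K)) (st : ElimState M K) : Prop where
  -- Contexts are shifted by one, so that an untouched cell means that there is no current context.
  cur : σ.nat 10 (0, 0, 0) = st.cur.elim 0 fun c => (c : ℕ) + 1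
  layer : σ.nat 11 (0, 0, 0) = st.layer
  active : ColSet (σ.nat 12) 0 st.active
  -- The records are not stored: `dominate` ignores the transcript, so only the observed set of each
  -- layer matters.
  observed : ∀ ℓ, ColSet (σ.nat 13) ℓ (observed G st ℓ)
  -- The full answer stays in memory; choosing an action only moves the pointer in cell 16.
  todo : ∃ L, HasList σ L ∧ σ.nat 16 (0, 0, 0) ≤ L.length ∧ st.todo = L.drop (σ.nat 16 (0, 0, 0))

theorem HasState.of_agree {σ σ' : Store} {st : ElimState M K} (h : HasState σ G st)
    (hn : ∀ z, 10 ≤ z → z ≤ 16 → σ'.nat z = σ.nat z) : HasState σ' G st := by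
  obtain ⟨h1, h2, h3, h4, L, h5⟩ := h
  refine ⟨?_, ?_, ?_, ?_, L, ?_⟩
  · rw [hn 10 (by decide) (by decide)]; exact h1
  · rw [hn 11 (by decide) (by decide)]; exact h2
  · rw [hn 12 (by decide) (by decide)]; exact h3
  · rw [hn 13 (by decide) (by decide)]; exact h4
  · unfold HasList
    rw [hn 14 (by decide) (by decide), hn 15 (by decide) (by decide),
      hn 16 (by decide) (by decide)]
    exact h5

def enterCmd : Cmd :=
  .seq (tabLoop 62 20 (.lit 0) .skip
    (.and (pos (at1 12 (var 62))) (.not (pos (at2 13 (var 62) (var 11)))))) <|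
    .seq gameCmd (setVar 16 (.lit 0))

theorem enterCmd_spec (hself : ∀ a, G.Adj a a) {σ : Store} (hG : HasGraph σ G)
    (st : ElimState M K) {c : Fin M} {ℓ : ℕ} {A : Finset (Fin K)}
    (hc : σ.nat 10 (0, 0, 0) = c + 1) (hℓ : σ.nat 11 (0, 0, 0) = ℓ) (hA : ColSet (σ.nat 12) 0 A)
    (hO : ∀ ℓ, ColSet (σ.nat 13) ℓ (observed G st ℓ)) :
    HasState (enterCmd.run σ) G ((st.close G).enter dominate G c ℓ A) := by
  unfold enterCmd
  simp only [run_seq]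
  have k1 : ColSet (((tabLoop 62 20 (.lit 0) .skip
      (.and (pos (at1 12 (var 62))) (.not (pos (at2 13 (var 62) (var 11)))))).run σ).nat 20) 0
      (A \ observed G st ℓ) := by
    intro v
    rw [(tabLoop_spec (K := K) hG.1 (by decide) rfl rfl 0 (fun v => v ∈ A ∧ v ∉ observed G st ℓ) (by
      intro i σ' h _ hi _
      simp only [run_skip, BExp.holds, NExp.eval, hi, h 12 (by decide) (by decide) rfl,
        h 13 (by decide) (by decide) rfl, h 11 (by decide) (by decide) rfl, hℓ, hA i, hO ℓ i,
        and_self])).1 v]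
    simp
  have f1 := frame_run (tabLoop 62 20 (.lit 0) .skip
      (.and (pos (at1 12 (var 62))) (.not (pos (at2 13 (var 62) (var 11)))))) σ
  set σ₁ := (tabLoop 62 20 (.lit 0) .skip
      (.and (pos (at1 12 (var 62))) (.not (pos (at2 13 (var 62) (var 11)))))).run σ
  have hG1 : HasGraph σ₁ G := hG.frame (f1.1 2 rfl) (f1.1 3 rfl)
  have k2 := gameCmd_spec hself hG1 k1
  have f2 := frame_run gameCmd σ₁
  set σ₂ := gameCmd.run σ₁
  have e3 : (setVar 16 (.lit 0)).run σ₂ = σ₂.setNat 16 (0, 0, 0) 0 := rfl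
  rw [e3]
  refine ⟨?_, ?_, ?_, ?_, dominateList G (A \ observed G st ℓ), ?_, ?_, ?_⟩
  · rw [nat_setNat_of_ne _ _ _ (by decide), f2.1 10 rfl, f1.1 10 rfl, hc]; rfl
  · rw [nat_setNat_of_ne _ _ _ (by decide), f2.1 11 rfl, f1.1 11 rfl, hℓ]; rfl
  · rw [nat_setNat_of_ne _ _ _ (by decide), f2.1 12 rfl, f1.1 12 rfl]; exact hA
  · intro ℓ'
    rw [nat_setNat_of_ne _ _ _ (by decide), f2.1 13 rfl, f1.1 13 rfl, observed_enter]
    exact hO ℓ'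
  · unfold HasList
    rwa [nat_setNat_of_ne _ _ _ (by decide), nat_setNat_of_ne _ _ _ (by decide)]
  · simp [nat_setNat]
  · simp only [nat_setNat, and_self, if_true, List.drop_zero]
    -- The observed set is by definition what the closed record covers, and `dominate` does not look
    -- at that record.
    rfl

def advanceCmd : Cmd :=
  .ite (.nle (var 15) (var 16))
    (.seq elimCmd (.seq (setVar 11 (.add (var 11) (.lit 1))) enterCmd)) .skip

theorem advanceCmd_spec (hself : ∀ a, G.Adj a a) {σ : Store} {T : ℕ} {δ : ℝ}
    {l : List (Round M K)} (hD : HasData σ T G δ l) {s : ℕ} (hs : s ≤ l.length)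
    (h60 : σ.nat 60 (0, 0, 0) = s) {c : Fin M} (hc : σ.nat 5 (s, 0, 0) = c) {st : ElimState M K}
    (hst : HasState σ G st) (hcur : st.cur = some c) :
    HasState (advanceCmd.run σ) G (st.advance dominate T G δ (l.take s).reverse c) := by
  unfold advanceCmd ElimState.advance
  obtain ⟨L, hL, hle, htodo⟩ := hst.todo
  have htest : (BExp.nle (var 15) (var 16)).holds σ ↔ st.todo = [] := by
    simp only [BExp.holds, NExp.eval, hL.1, htodo, List.drop_eq_nil_iff]
  rw [run_ite]
  simp only [htest]
  split_ifs
  · simp only [run_seq]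
    have k1 := elimCmd_spec hD hs h60 hc hst.layer hst.active
    have f1 := frame_run elimCmd σ
    set σ₁ := elimCmd.run σ
    have e2 : (setVar 11 (.add (var 11) (.lit 1))).run σ₁ =
        σ₁.setNat 11 (0, 0, 0) (st.layer + 1) := by
      rw [run_setNat]; simp [NExp.eval, f1.1 11 rfl, hst.layer]
    rw [e2]
    refine enterCmd_spec hself (hD.graph.frame ?_ ?_) st ?_ ?_ ?_ ?_
    · rw [nat_setNat_of_ne _ _ _ (by decide), f1.1 2 rfl]
    · rw [nat_setNat_of_ne _ _ _ (by decide), f1.1 3 rfl]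
    · rw [nat_setNat_of_ne _ _ _ (by decide), f1.1 10 rfl, hst.cur, hcur]; rfl
    · simp [nat_setNat]
    · rw [nat_setNat_of_ne _ _ _ (by decide)]; exact k1
    · rw [nat_setNat_of_ne _ _ _ (by decide), f1.1 13 rfl]; exact hst.observed
  · exact hst

def restartCmd : Cmd :=
  .ite (.and (.nle (var 10) (.add (at1 5 (var 60)) (.lit 1)))
      (.nle (.add (at1 5 (var 60)) (.lit 1)) (var 10))) .skip
    (.seq (setVar 10 (.add (at1 5 (var 60)) (.lit 1))) (.seq (setVar 11 (.lit 1))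
      (.seq (tabLoop 56 12 (.lit 0) .skip (pos (.lit 1))) enterCmd)))

theorem restartCmd_spec (hself : ∀ a, G.Adj a a) {σ : Store} (hG : HasGraph σ G) {s : ℕ}
    (h60 : σ.nat 60 (0, 0, 0) = s) {c : Fin M} (hc : σ.nat 5 (s, 0, 0) = c) {st : ElimState M K}
    (hst : HasState σ G st) :
    HasState (restartCmd.run σ) G
      (if st.cur = some c then st else (st.close G).enter dominate G c 1 Finset.univ) := by
  unfold restartCmd
  have htest : (BExp.and (.nle (var 10) (.add (at1 5 (var 60)) (.lit 1)))
      (.nle (.add (at1 5 (var 60)) (.lit 1)) (var 10))).holds σ ↔ st.cur = some c := by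
    simp only [BExp.holds, NExp.eval, h60, hc, hst.cur]
    cases st.cur with
    | none => simp
    | some c' =>
      simp only [Option.elim_some, Option.some.injEq, Fin.ext_iff]
      omega
  rw [run_ite]
  simp only [htest]
  split_ifs
  · exact hst
  · simp only [run_seq]
    have e1 : (setVar 10 (.add (at1 5 (var 60)) (.lit 1))).run σ =
        σ.setNat 10 (0, 0, 0) (c + 1) := by
      rw [run_setNat]; simp [NExp.eval, h60, hc]
    rw [e1]
    have e2 : (setVar 11 (.lit 1)).run (σ.setNat 10 (0, 0, 0) (c + 1)) =
        (σ.setNat 10 (0, 0, 0) (c + 1)).setNat 11 (0, 0, 0) 1 := rfl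
    rw [e2]
    set σ₁ := (σ.setNat 10 (0, 0, 0) (c + 1)).setNat 11 (0, 0, 0) 1 with hσ₁
    have g1 : ∀ z, z ≠ 10 → z ≠ 11 → σ₁.nat z = σ.nat z := fun z h h' => by
      simp [hσ₁, Store.setNat, h, h']
    have hG1 : HasGraph σ₁ G := hG.frame (g1 2 (by decide) (by decide)) (g1 3 (by decide) (by decide))
    have k2 : ColSet (((tabLoop 56 12 (.lit 0) .skip (pos (.lit 1))).run σ₁).nat 12) 0
        (Finset.univ : Finset (Fin K)) := by
      intro v
      rw [(tabLoop_spec (K := K) hG1.1 (by decide) rfl rfl 0 (fun _ => True) (by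
        intro i σ' _ _ _ _
        simp [NExp.eval, BExp.holds])).1 v]
      simp
    have f2 := frame_run (tabLoop 56 12 (.lit 0) .skip (pos (.lit 1))) σ₁
    set σ₂ := (tabLoop 56 12 (.lit 0) .skip (pos (.lit 1))).run σ₁
    refine enterCmd_spec hself (hG1.frame (f2.1 2 rfl) (f2.1 3 rfl)) st ?_ ?_ k2 ?_
    · rw [f2.1 10 rfl]; simp [hσ₁, nat_setNat]
    · rw [f2.1 11 rfl]; simp [hσ₁, nat_setNat]
    · rw [f2.1 13 rfl, g1 13 (by decide) (by decide)]; exact hst.observed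

def prepareCmd : Cmd :=
  .seq restartCmd (.loop 61 roundsExp (.ite (.nle (var 61) (var 60)) advanceCmd .skip))

theorem cur_advance_iterate (𝒜 : GameAlg) (T : ℕ) (δ : ℝ) (h : List (Round M K)) (c : Fin M)
    {st : ElimState M K} (hcur : st.cur = some c) (n : ℕ) :
    ((ElimState.advance 𝒜 T G δ h c)^[n] st).cur = some c := by
  induction n with
  | zero => exact hcur
  | succ n ih =>
    rw [Function.iterate_succ_apply']
    unfold ElimState.advance at ih ⊢
    split_ifs
    · rfl
    · exact ih

theorem prepareCmd_spec (hself : ∀ a, G.Adj a a) {σ : Store} {T : ℕ} {δ : ℝ}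
    {l : List (Round M K)} (hD : HasData σ T G δ l) {s : ℕ} (hs : s ≤ l.length)
    (h60 : σ.nat 60 (0, 0, 0) = s) {c : Fin M} (hc : σ.nat 5 (s, 0, 0) = c) {st : ElimState M K}
    (hst : HasState σ G st) :
    HasState (prepareCmd.run σ) G (st.prepare dominate T G δ (l.take s).reverse c) := by
  unfold prepareCmd ElimState.prepare
  rw [run_seq]
  have k1 := restartCmd_spec hself hD.graph h60 hc hst
  have f1 := frame_run restartCmd σ
  have hD1 : HasData (restartCmd.run σ) T G δ l := hD.frame f1 (by constructor <;> decide)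
  set σ₁ := restartCmd.run σ
  have hcur : (if st.cur = some c then st
      else (st.close G).enter dominate G c 1 Finset.univ).cur = some c := by
    split_ifs with h
    exacts [h, rfl]
  set st₁ := if st.cur = some c then st else (st.close G).enter dominate G c 1 Finset.univ
  -- The loop length is the total number of rounds plus one; the guard makes the passes after the
  -- first `s + 1` idle.
  have := loop_invariant (x := 61) (e := roundsExp) (σ := σ₁)
    (body := .ite (.nle (var 61) (var 60)) advanceCmd .skip)
    (fun i σ' => HasState σ' G
      ((ElimState.advance dominate T G δ (l.take s).reverse c)^[min i (s + 1)] st₁))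
    (by simpa using k1) (by
      intro i hi σ' hf hx ih
      have e60 : σ'.nat 60 (0, 0, 0) = s := by rw [hf.1 60 rfl, f1.1 60 rfl, h60]
      have e5 : σ'.nat 5 (s, 0, 0) = c := by rw [hf.1 5 rfl, f1.1 5 rfl, hc]
      have hD' : HasData σ' T G δ l := hD1.frame hf (by constructor <;> decide)
      rw [run_ite]
      simp only [BExp.holds, NExp.eval, hx, e60]
      split_ifs with his
      · have hmin : min (i + 1) (s + 1) = min i (s + 1) + 1 := by omega
        rw [hmin, Function.iterate_succ_apply']
        exact advanceCmd_spec hself hD' hs e60 e5 ih (cur_advance_iterate _ _ _ _ _ hcur _)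
      · have hmin : min (i + 1) (s + 1) = min i (s + 1) := by omega
        rw [hmin]
        exact ih) (by
      intro i σ' h v
      exact h.of_agree fun z h1 h2 => nat_setNat_of_ne _ _ _ (by omega))
  have e : min (roundsExp.eval σ₁) (s + 1) = (l.take s).reverse.length + 1 := by
    simp [NExp.eval, hD1.rounds]; omega
  rw [e] at this
  exact this

def outputCmd : Cmd :=
  .ite (.nle (.add (var 16) (.lit 1)) (var 15)) (setVar 7 (at1 14 (var 16))) (setVar 7 (.lit 0))

theorem outputCmd_spec [NeZero K] {σ : Store} {st : ElimState M K} (hst : HasState σ G st) :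
    (outputCmd.run σ).nat 7 (0, 0, 0) = (st.todo.headD 0 : Fin K) := by
  obtain ⟨L, hL, hle, htodo⟩ := hst.todo
  unfold outputCmd
  rw [run_ite]
  simp only [BExp.holds, NExp.eval, hL.1]
  split_ifs with h
  · rw [run_setNat]
    simp only [NExp.eval, nat_setNat, and_self, if_true]
    rw [hL.2 _ h, htodo, List.drop_eq_getElem_cons h]
    rfl
  · rw [run_setNat]
    simp only [NExp.eval, nat_setNat, and_self, if_true]
    rw [htodo, List.drop_eq_nil_of_le (by omega)]
    simp

def chooseCmd : Cmd :=
  .ite (.nle (.add (var 16) (.lit 1)) (var 15))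
    (.seq (setVar 63 (at1 14 (var 16))) <| .seq (tabLoop 64 13 (var 11) .skip
        (pos (.add (at2 13 (var 64) (var 11)) (at2 3 (var 63) (var 64))))) <|
      setVar 16 (.add (var 16) (.lit 1))) .skip

theorem chooseCmd_spec {σ : Store} (hG : HasGraph σ G) {st : ElimState M K}
    (hst : HasState σ G st) : HasState (chooseCmd.run σ) G st.choose := by
  obtain ⟨L, hL, hle, htodo⟩ := hst.todo
  unfold chooseCmd
  rw [run_ite]
  simp only [BExp.holds, NExp.eval, hL.1]
  split_ifs with h
  · simp only [run_seq]
    set v := L[σ.nat 16 (0, 0, 0)] with hv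
    have e1 : (setVar 63 (at1 14 (var 16))).run σ = σ.setNat 63 (0, 0, 0) v := by
      rw [run_setNat]; simp only [NExp.eval, hL.2 _ h]; rfl
    rw [e1]
    set σ₁ := σ.setNat 63 (0, 0, 0) v with hσ₁
    have g1 : ∀ z, z ≠ 63 → σ₁.nat z = σ.nat z := fun z h => by simp [hσ₁, Store.setNat, h]
    have hG1 : HasGraph σ₁ G := hG.frame (g1 2 (by decide)) (g1 3 (by decide))
    obtain ⟨k2, k2'⟩ := tabLoop_spec (x := 64) (y := 13) (re := var 11) (pre := .skip)
      (b := pos (.add (at2 13 (var 64) (var 11)) (at2 3 (var 63) (var 64)))) hG1.1 (by decide)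
      rfl rfl st.layer (fun u => u ∈ observed G st st.layer ∨ G.Adj v u) (by
        intro i σ' h' _ hi hy
        simp only [run_skip, BExp.holds, NExp.eval, hi, h' 11 (by decide) (by decide) rfl,
          h' 3 (by decide) (by decide) rfl, h' 63 (by decide) (by decide) rfl,
          g1 11 (by decide), hst.layer, hy]
        rw [← hst.observed st.layer i, ← hG1.2 v i, g1 13 (by decide)]
        have : σ₁.nat 63 (0, 0, 0) = v := by simp [hσ₁, nat_setNat]
        rw [this]
        refine ⟨trivial, ?_⟩
        omega)
    have f2 := frame_run (tabLoop 64 13 (var 11) .skip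
        (pos (.add (at2 13 (var 64) (var 11)) (at2 3 (var 63) (var 64))))) σ₁
    set σ₂ := (tabLoop 64 13 (var 11) .skip
        (pos (.add (at2 13 (var 64) (var 11)) (at2 3 (var 63) (var 64))))).run σ₁
    have e16 : σ₂.nat 16 (0, 0, 0) = σ.nat 16 (0, 0, 0) := by
      rw [f2.1 16 rfl, g1 16 (by decide)]
    have e3 : (setVar 16 (.add (var 16) (.lit 1))).run σ₂ =
        σ₂.setNat 16 (0, 0, 0) (σ.nat 16 (0, 0, 0) + 1) := by
      rw [run_setNat]; simp [NExp.eval, e16]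
    rw [e3]
    have htake : st.todo.take 1 = [v] := by
      rw [htodo, List.drop_eq_getElem_cons h]; rfl
    refine ⟨?_, ?_, ?_, ?_, L, ?_, ?_, ?_⟩
    · rw [nat_setNat_of_ne _ _ _ (by decide), f2.1 10 rfl, g1 10 (by decide)]; exact hst.cur
    · rw [nat_setNat_of_ne _ _ _ (by decide), f2.1 11 rfl, g1 11 (by decide)]; exact hst.layer
    · rw [nat_setNat_of_ne _ _ _ (by decide), f2.1 12 rfl, g1 12 (by decide)]; exact hst.active
    · intro ℓ u
      rw [nat_setNat_of_ne _ _ _ (by decide), observed_choose, htake]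
      by_cases hℓ : ℓ = st.layer
      · subst hℓ
        rw [k2 u]
        simp [mem_outNbrs]
      · rw [k2' _ (by simp [hℓ]), g1 13 (by decide), if_neg hℓ, Finset.union_empty]
        exact hst.observed ℓ u
    · unfold HasList
      rw [nat_setNat_of_ne _ _ _ (by decide), nat_setNat_of_ne _ _ _ (by decide), f2.1 14 rfl,
        f2.1 15 rfl, g1 14 (by decide), g1 15 (by decide)]
      exact hL
    · simpa [nat_setNat] using h
    · simp only [nat_setNat, and_self, if_true]
      simp [ElimState.choose, htodo]
  · have : st.choose = st := by
      have h0 : st.todo = [] := by rw [htodo, List.drop_eq_nil_of_le (by omega)]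
      cases st
      simp only at h0
      simp [ElimState.choose, h0]
    rw [this]
    exact hst

/-- Replay the past rounds and compute the next action. -/
def armElimCmd : Cmd :=
  .loop 60 roundsExp (.seq prepareCmd (.seq outputCmd chooseCmd))

theorem armElimCmd_spec [NeZero K] (hself : ∀ a, G.Adj a a) (T : ℕ) (δ : ℝ)
    (h : List (Round M K)) (c : Fin M) :
    (armElimCmd.run (encodeInput T G δ h c)).output = (armElim dominate T M K G δ h c : ℕ) := by
  set σ := encodeInput T G δ h c with hσ
  have hD : HasData σ T G δ h.reverse := by
    refine ⟨⟨rfl, fun u v => ?_⟩, rfl, rfl, ?_, fun u hu => ?_, fun u hu => ?_, rfl,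
      fun u hu c a => ?_⟩
    · by_cases huv : G.Adj u v <;> simp [hσ, encodeInput, huv]
    · simp [hσ, encodeInput]
    · have hu' : u < h.length := by simpa using hu
      have : h.reverse[u]? = some h.reverse[u] := List.getElem?_eq_getElem hu
      simp only [hσ, encodeInput, this]
      rw [if_neg (by omega)]
      rfl
    · have : h.reverse[u]? = some h.reverse[u] := List.getElem?_eq_getElem hu
      simp only [hσ, encodeInput, this]
      rfl
    · have : h.reverse[u]? = some h.reverse[u] := List.getElem?_eq_getElem hu
      simp [hσ, encodeInput, this]
  have hc : σ.nat 5 (h.length, 0, 0) = c := by simp [hσ, encodeInput]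
  -- After `i` passes the memory holds the state after the `i` oldest rounds. The extra last pass,
  -- under the current context, is claimed to be right only about the output cell, which every pass
  -- overwrites.
  have := loop_invariant (x := 60) (e := roundsExp) (σ := σ)
    (body := .seq prepareCmd (.seq outputCmd chooseCmd))
    (fun i σ' => (i ≤ h.length →
        HasState σ' G (elimState dominate T G δ (h.reverse.take i).reverse)) ∧
      (i = h.length + 1 → σ'.nat 7 (0, 0, 0) = (armElim dominate T M K G δ h c : ℕ)))
    ⟨fun _ => by
      -- The all-zero working memory encodes the initial state.
      refine ⟨rfl, rfl, fun v => ?_, fun ℓ v => ?_, [], ⟨rfl, by simp⟩, by simp [hσ, encodeInput], ?_⟩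
      · simp [hσ, encodeInput, elimState, ElimState.init]
      · simp [hσ, encodeInput, elimState, ElimState.init, observed_eq, covered, outNbrs_empty]
      · simp [elimState, ElimState.init], by omega⟩ (by
      rintro i hi σ' hf hx ⟨ih, -⟩
      have hi' : i ≤ h.length := by
        have : roundsExp.eval σ = h.length + 1 := by simp [NExp.eval, hD.rounds]
        omega
      have hi'' : i ≤ h.reverse.length := by simpa using hi'
      have hD' : HasData σ' T G δ h.reverse := hD.frame hf (by constructor <;> decide)
      simp only [run_seq]
      have key : ∀ c' : Fin M, σ'.nat 5 (i, 0, 0) = c' →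
          HasState (prepareCmd.run σ') G ((elimState dominate T G δ
            (h.reverse.take i).reverse).prepare dominate T G δ (h.reverse.take i).reverse c') :=
        fun c' hc' => prepareCmd_spec hself hD' hi'' hx hc' (ih hi')
      have f1 := frame_run prepareCmd σ'
      have hD1 := hD'.frame f1 (by constructor <;> decide)
      set σ₁ := prepareCmd.run σ'
      have f2 := frame_run outputCmd σ₁
      have hD2 := hD1.frame f2 (by constructor <;> decide)
      have f3 := frame_run chooseCmd (outputCmd.run σ₁)
      refine ⟨fun hi1 => ?_, fun hi1 => ?_⟩
      · have hil : i < h.reverse.length := by simp; omega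
        have k1 := key h.reverse[i].ctx (hD'.ctx i hil)
        have k2 : HasState (outputCmd.run σ₁) G _ := k1.of_agree fun z h1 h2 => f2.1 z (by
          simp [outputCmd, Cmd.writesNat, natBeq_eq_false_iff]; omega)
        have k3 := chooseCmd_spec hD2.graph k2
        rw [List.take_succ_eq_append_getElem hil, List.reverse_append]
        exact k3
      · obtain rfl : i = h.length := by omega
        have k1 := key c (by rw [hf.1 5 rfl]; exact hc)
        rw [f3.1 7 rfl, outputCmd_spec k1]
        rw [List.take_of_length_le (by simp), List.reverse_reverse]
        rfl) (by
      intro i σ' h v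
      refine ⟨fun hi => (h.1 hi).of_agree fun z h1 h2 => nat_setNat_of_ne _ _ _ (by omega),
        fun hi => ?_⟩
      rw [nat_setNat_of_ne _ _ _ (by decide)]
      exact h.2 hi)
  refine this.2 ?_
  simp [NExp.eval, hD.rounds]

theorem armElimCmd_bounded : armElimCmd.Bounded := by
  simp [armElimCmd, prepareCmd, restartCmd, enterCmd, gameCmd, phasesCmd, phaseCmd, lowInCmd,
    indepCmd, bestCmd, pickCmd, outDegCmd, removeCmd, appendLoop, advanceCmd, elimCmd, empMeanCmd,
    sumCmd, widthCmd, keepCmd, outputCmd, chooseCmd, tabLoop, countLoop, Cmd.Bounded]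

theorem length_history {T : ℕ} (π : Policy M K) (G : Digraph (Fin K)) (c : Fin T → Fin M)
    (r : Fin T → Fin M → Fin K → ℝ) (t : ℕ) (ht : t ≤ T) : (history π G c r t ht).length = t := by
  induction t with
  | zero => rfl
  | succ t ih => simp [history, ih]

theorem armElim_polyTime :
    PolicyFamily.PolyTime (fun T M K _ G δ => armElim dominate T M K G δ) := by
  refine ⟨armElimCmd, armElimCmd.stepBound, fun T M K _ G hself δ _ _ c r t => ⟨?_, ?_⟩⟩
  · exact armElimCmd_spec hself T δ _ (c t)
  · refine exec_cost_le _ _ armElimCmd_bounded rfl rfl _ ?_ ?_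
    · exact Nat.le_add_left _ _
    · have : (encodeInput T G δ (history (armElim dominate T M K G δ) G c r t t.isLt.le)
          (c t)).nat 4 (0, 0, 0) = t := by
        simp [encodeInput, length_history]
      rw [this]
      have := t.2
      omega

end ElimProgram

/-! ### The course of layered arm elimination -/

section Course
variable {M K : ℕ} {G : Digraph (Fin K)}

theorem Thrifty.of_append {B : ℝ} {h h' : Transcript K} (hh : Thrifty G B (h ++ h')) :
    Thrifty G B h := by
  intro i hi
  have := hh i (by rw [List.length_append]; omega)
  rwa [List.getElem_append_left hi, List.take_append_of_le_length hi.le] at this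

/-- The number of past rounds in which the reward of `a` was observed. -/
noncomputable def obsCount (G : Digraph (Fin K)) (h : List (Round M K)) (a : Fin K) : ℕ :=
  (h.filter fun x => G.Adj x.act a).length

/-- The layers on which the past rounds were played, newest first. -/
noncomputable def layersOf (𝒜 : GameAlg) (T : ℕ) (G : Digraph (Fin K)) (δ : ℝ) :
    List (Round M K) → List ℕ
  | [] => []
  | x :: h => ((elimState 𝒜 T G δ h).prepare 𝒜 T G δ h x.ctx).layer :: layersOf 𝒜 T G δ h

/-- What holds for every state with respect to the past rounds `h`, played on the layers `ls`. -/
structure Sound (G : Digraph (Fin K)) (B : ℝ) (h : List (Round M K)) (ls : List ℕ)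
    (st : ElimState M K) : Prop where
  -- Closed records are used, so that the move in progress counts with the actions chosen so far.
  -- Layer `0` is excluded because closing the initial state leaves a dummy move there.
  thrifty : ∀ ℓ, 1 ≤ ℓ → Thrifty G B ((st.close G).record ℓ)
  -- A round belongs to one layer only, so observations of `a` on different layers come from
  -- different rounds.
  card_le_obsCount : ∀ a, ∀ F : Finset ℕ, (∀ ℓ ∈ F, a ∈ observed G st ℓ) → F.card ≤ obsCount G h a
  card_le_length : ∀ F : Finset ℕ, (∀ ℓ ∈ F, (observed G st ℓ).Nonempty) → F.card ≤ h.length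
  count : ∀ ℓ, 1 ≤ ℓ → ls.count ℓ = (((st.close G).record ℓ).map fun p => p.2.length).sum

/-- The number of contexts seen, with the current one. -/
noncomputable def ctxCount (h : List (Round M K)) (c : Fin M) : ℕ :=
  (insert c (h.map Round.ctx).toFinset).card

/-- The suboptimality gap. -/
noncomputable def gap (μ : Fin M → Fin K → ℝ) (c : Fin M) (a : Fin K) : ℝ := (⨆ a, μ c a) - μ c a

/-- What holds for the states in which the context `c` is current. `w` is the logarithmic term. -/
structure Running (G : Digraph (Fin K)) (μ : Fin M → Fin K → ℝ) (w : ℝ) (h : List (Round M K))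
    (c : Fin M) (st : ElimState M K) : Prop where
  cur : st.cur = some c
  one_le_layer : 1 ≤ st.layer
  -- Each context adds at most one move to a layer; the extra `1` reserves the slot of the current
  -- context on layers that it has not left.
  length_record : ∀ ℓ, 1 ≤ ℓ →
    (st.record ℓ).length + (if st.layer ≤ ℓ then 1 else 0) ≤ ctxCount h c
  -- The observation may have been made under an earlier context.
  lower : ∀ a ∈ st.active, ∀ ℓ, 1 ≤ ℓ → ℓ < st.layer → a ∈ observed G st ℓ
  move : st.move = st.active \ covered G (st.record st.layer)
  answer : st.chosen ++ st.todo = dominateList G st.move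
  best_mem : ∃ a ∈ st.active, ∀ b, μ c b ≤ μ c a
  gap_le : ∀ a ∈ st.active, gap μ c a ≤ 6 * √(w / st.layer)

/-! ### Preservation of the invariants -/

theorem close_record (st : ElimState M K) (ℓ : ℕ) :
    (st.close G).record ℓ = st.record ℓ ++
      if ℓ = st.layer then [(st.move ∩ outNbrs G st.chosen.toFinset, st.chosen)] else [] := by
  unfold ElimState.close
  by_cases h : ℓ = st.layer
  · subst h; simp
  · simp [h]

theorem close_enter_record (𝒜 : GameAlg) (c : Fin M) (ℓ : ℕ) (A : Finset (Fin K))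
    (st : ElimState M K) (ℓ' : ℕ) :
    ∃ A', (((st.close G).enter 𝒜 G c ℓ A).close G).record ℓ' = (st.close G).record ℓ' ++
      if ℓ' = ℓ then [(A', [])] else [] := by
  rw [close_record]
  exact ⟨_, rfl⟩

/-- The closed record gains only a move with an empty answer, which costs nothing and observes
nothing. -/
theorem Sound.enter {B : ℝ} {h : List (Round M K)} {ls : List ℕ} {st : ElimState M K}
    (hs : Sound G B h ls st) (c : Fin M) (ℓ : ℕ) (A : Finset (Fin K)) :
    Sound G B h ls ((st.close G).enter dominate G c ℓ A) := by
  refine ⟨fun ℓ' hℓ' => ?_, fun a F hF => ?_, fun F hF => ?_, fun ℓ' hℓ' => ?_⟩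
  · obtain ⟨A', e⟩ := close_enter_record (G := G) dominate c ℓ A st ℓ'
    rw [e]
    split_ifs
    · exact (hs.thrifty ℓ' hℓ').append (by simp) ⟨∅, by simp, by simp [IsIndep], by simp⟩
    · simpa using hs.thrifty ℓ' hℓ'
  · simp only [observed_enter] at hF
    exact hs.card_le_obsCount a F hF
  · simp only [observed_enter] at hF
    exact hs.card_le_length F hF
  · obtain ⟨A', e⟩ := close_enter_record (G := G) dominate c ℓ A st ℓ'
    rw [e, hs.count ℓ' hℓ']
    split_ifs <;> simp

/-- An active action was either covered when the layer was entered or belongs to the move, which the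
completed answer dominates. -/
theorem observed_of_todo_eq_nil (hself : ∀ a, G.Adj a a) {μ : Fin M → Fin K → ℝ} {w : ℝ}
    {h : List (Round M K)} {c : Fin M} {st : ElimState M K} (hr : Running G μ w h c st)
    (h0 : st.todo = []) {a : Fin K} (ha : a ∈ st.active) : a ∈ observed G st st.layer := by
  rw [observed_eq, if_pos rfl, Finset.mem_union]
  by_cases hc : a ∈ covered G (st.record st.layer)
  · exact Or.inl hc
  · right
    have h1 := hr.answer
    rw [h0, List.append_nil] at h1
    rw [h1]
    refine (dominateList_spec hself _).2.2 ?_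
    rw [hr.move]
    exact Finset.mem_sdiff.mpr ⟨ha, hc⟩

/-- The empirical rewards are close to the means. -/
def Accurate (G : Digraph (Fin K)) (μ : Fin M → Fin K → ℝ) (w : ℝ) (h : List (Round M K)) : Prop :=
  ∀ c a, 0 < obsCount G h a → |empMean G h c a - μ c a| ≤ √(w / obsCount G h a)

theorem gap_eq {μ : Fin M → Fin K → ℝ} {c : Fin M} {a : Fin K} (ha : ∀ b, μ c b ≤ μ c a)
    (b : Fin K) : gap μ c b = μ c a - μ c b := by
  unfold gap
  congr 1
  have : Nonempty (Fin K) := ⟨a⟩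
  exact le_antisymm (ciSup_le ha) (le_ciSup (Set.finite_range _).bddAbove a)

/-- Passes from the width of the layer just left to that of the next one; it amounts to `16 (ℓ + 1)
≤ 36 ℓ`. -/
theorem four_sqrt_le {w : ℝ} (hw : 0 ≤ w) {ℓ : ℕ} (hℓ : 1 ≤ ℓ) :
    4 * √(w / ℓ) ≤ 6 * √(w / (ℓ + 1 : ℕ)) := by
  have hℓ' : (1 : ℝ) ≤ ℓ := by exact_mod_cast hℓ
  have e1 : 4 * √(w / ℓ) = √(16 * (w / ℓ)) := by
    rw [Real.sqrt_mul (by norm_num), show (16 : ℝ) = 4 ^ 2 by norm_num,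
      Real.sqrt_sq (by norm_num)]
  have e2 : 6 * √(w / (ℓ + 1 : ℕ)) = √(36 * (w / (ℓ + 1 : ℕ))) := by
    rw [Real.sqrt_mul (by norm_num), show (36 : ℝ) = 6 ^ 2 by norm_num,
      Real.sqrt_sq (by norm_num)]
  rw [e1, e2]
  refine Real.sqrt_le_sqrt ?_
  push_cast
  rw [← mul_div_assoc, ← mul_div_assoc, div_le_div_iff₀ (by linarith) (by linarith)]
  nlinarith

theorem Running.advance (hself : ∀ a, G.Adj a a) {μ : Fin M → Fin K → ℝ} {T : ℕ} {δ B : ℝ}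
    {h : List (Round M K)} {ls : List ℕ} {c : Fin M} {st : ElimState M K}
    (hw : 0 ≤ Real.log (2 * M * K * T / δ)) (hs : Sound G B h ls st)
    (hr : Running G μ (Real.log (2 * M * K * T / δ)) h c st)
    (hacc : Accurate G μ (Real.log (2 * M * K * T / δ)) h) :
    Sound G B h ls (st.advance dominate T G δ h c) ∧
      Running G μ (Real.log (2 * M * K * T / δ)) h c (st.advance dominate T G δ h c) := by
  set w := Real.log (2 * M * K * T / δ) with hwdef
  unfold ElimState.advance
  split_ifs with h0
  · refine ⟨hs.enter _ _ _, ?_⟩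
    have hobs : ∀ a ∈ st.active, ∀ ℓ, 1 ≤ ℓ → ℓ < st.layer + 1 → a ∈ observed G st ℓ := by
      intro a ha ℓ h1 h2
      rcases Nat.lt_succ_iff_lt_or_eq.mp h2 with h2 | rfl
      · exact hr.lower a ha ℓ h1 h2
      · exact observed_of_todo_eq_nil hself hr h0 ha
    -- Having been seen on each of the layers up to the current one, an active action has at least
    -- `st.layer` observations.
    have hemp : ∀ a ∈ st.active, |empMean G h c a - μ c a| ≤ √(w / st.layer) := by
      intro a ha
      have hcard := hs.card_le_obsCount a (Finset.Icc 1 st.layer) fun ℓ hℓ => by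
        rw [Finset.mem_Icc] at hℓ
        exact hobs a ha ℓ hℓ.1 (by omega)
      rw [Nat.card_Icc, Nat.add_sub_cancel] at hcard
      have h1 := hr.one_le_layer
      refine (hacc c a (by omega)).trans (Real.sqrt_le_sqrt ?_)
      have h2 : (st.layer : ℝ) ≤ obsCount G h a := by exact_mod_cast hcard
      have h3 : (0 : ℝ) < st.layer := by exact_mod_cast h1
      exact div_le_div_of_nonneg_left hw h3 h2
    have hsub : eliminate T G δ h c st.layer st.active ⊆ st.active := Finset.filter_subset _ _
    obtain ⟨b, hb, hbest⟩ := hr.best_mem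
    refine ⟨rfl, Nat.le_add_left _ _, fun ℓ hℓ => ?_, fun a ha ℓ h1 h2 => ?_, rfl, rfl,
      ⟨b, ?_, hbest⟩, fun a ha => ?_⟩
    · have := hr.length_record ℓ hℓ
      change ((st.close G).record ℓ).length + (if st.layer + 1 ≤ ℓ then 1 else 0) ≤ _
      rw [close_record, List.length_append]
      refine le_trans ?_ this
      split_ifs <;> (simp; try omega)
    · rw [observed_enter]
      exact hobs a (hsub ha) ℓ h1 h2
    -- Two errors of one width each cannot eliminate a best action.
    · refine Finset.mem_filter.mpr ⟨hb, fun a' ha' => ?_⟩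
      have h1 := abs_le.mp (hemp a' ha')
      have h2 := abs_le.mp (hemp b hb)
      have h3 := hbest a'
      change _ - 2 * √(w / st.layer) ≤ _
      linarith
    -- A survivor loses at most the elimination margin of two widths plus two errors: four widths.
    · have h1 := abs_le.mp (hemp a (hsub ha))
      have h2 := abs_le.mp (hemp b hb)
      have h3 : empMean G h c b - 2 * √(w / st.layer) ≤ empMean G h c a :=
        (Finset.mem_filter.mp ha).2 b hb
      rw [gap_eq hbest]
      refine le_trans ?_ (four_sqrt_le hw hr.one_le_layer)
      linarith
  · exact ⟨hs, hr⟩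

theorem Running.iterate (hself : ∀ a, G.Adj a a) {μ : Fin M → Fin K → ℝ} {T : ℕ} {δ B : ℝ}
    {h : List (Round M K)} {ls : List ℕ} {c : Fin M} {st : ElimState M K}
    (hw : 0 ≤ Real.log (2 * M * K * T / δ)) (hs : Sound G B h ls st)
    (hr : Running G μ (Real.log (2 * M * K * T / δ)) h c st)
    (hacc : Accurate G μ (Real.log (2 * M * K * T / δ)) h) (n : ℕ) :
    Sound G B h ls ((ElimState.advance dominate T G δ h c)^[n] st) ∧
      Running G μ (Real.log (2 * M * K * T / δ)) h c
        ((ElimState.advance dominate T G δ h c)^[n] st) := by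
  induction n with
  | zero => exact ⟨hs, hr⟩
  | succ n ih =>
    rw [Function.iterate_succ_apply']
    exact ih.2.advance hself hw ih.1 hacc

theorem layer_iterate_of_todo_eq_nil (𝒜 : GameAlg) (T : ℕ) (δ : ℝ) (h : List (Round M K))
    (c : Fin M) (st : ElimState M K) (n : ℕ)
    (h0 : ((ElimState.advance 𝒜 T G δ h c)^[n] st).todo = []) :
    ((ElimState.advance 𝒜 T G δ h c)^[n] st).layer = st.layer + n := by
  induction n with
  | zero => rfl
  | succ n ih =>
    rw [Function.iterate_succ_apply'] at h0 ⊢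
    by_cases h1 : ((ElimState.advance 𝒜 T G δ h c)^[n] st).todo = []
    · have := ih h1
      rw [ElimState.advance, if_pos h1]
      change _ + 1 = _
      omega
    · rw [ElimState.advance, if_neg h1] at h0
      exact absurd h0 h1

/-- Pigeonhole: if every advance found nothing to choose, then a best action would have been
observed on `h.length + 1` layers, although the past has only `h.length` rounds. -/
theorem todo_iterate_ne_nil (hself : ∀ a, G.Adj a a) {μ : Fin M → Fin K → ℝ} {T : ℕ} {δ B : ℝ}
    {h : List (Round M K)} {ls : List ℕ} {c : Fin M} {st : ElimState M K}
    (hw : 0 ≤ Real.log (2 * M * K * T / δ)) (hs : Sound G B h ls st)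
    (hr : Running G μ (Real.log (2 * M * K * T / δ)) h c st)
    (hacc : Accurate G μ (Real.log (2 * M * K * T / δ)) h) :
    ((ElimState.advance dominate T G δ h c)^[h.length + 1] st).todo ≠ [] := by
  intro h0
  have hl := layer_iterate_of_todo_eq_nil dominate T δ h c st _ h0
  obtain ⟨hs', hr'⟩ := hr.iterate hself hw hs hacc (h.length + 1)
  obtain ⟨a, ha, -⟩ := hr'.best_mem
  have := hs'.card_le_length (Finset.Icc 1 (h.length + 1)) fun ℓ hℓ => by
    rw [Finset.mem_Icc] at hℓ
    have := hr.one_le_layer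
    exact ⟨a, hr'.lower a ha ℓ hℓ.1 (by omega)⟩
  rw [Nat.card_Icc] at this
  omega

theorem Running.choose (hK : 2 ≤ K) (hself : ∀ a, G.Adj a a) {μ : Fin M → Fin K → ℝ} {w : ℝ}
    {h : List (Round M K)} {ls : List ℕ} {st : ElimState M K} {x : Round M K}
    (hs : Sound G (domRatio K) h ls st) (hr : Running G μ w h x.ctx st) {td : List (Fin K)}
    (htodo : st.todo = x.act :: td) :
    Sound G (domRatio K) (x :: h) (st.layer :: ls) st.choose ∧
      Running G μ w (x :: h) x.ctx st.choose := by
  have htake : st.todo.take 1 = [x.act] := by rw [htodo]; rfl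
  have hobs : ∀ ℓ, observed G st.choose ℓ = observed G st ℓ ∪
      if ℓ = st.layer then outNbrs G {x.act} else ∅ := by
    intro ℓ
    rw [observed_choose, htake]
    simp
  have hcount : ∀ a, obsCount G (x :: h) a =
      obsCount G h a + if G.Adj x.act a then 1 else 0 := by
    intro a
    unfold obsCount
    rw [List.filter_cons]
    by_cases hxa : G.Adj x.act a <;> simp [hxa]
  refine ⟨⟨fun ℓ hℓ => ?_, fun a F hF => ?_, fun F hF => ?_, fun ℓ hℓ => ?_⟩, ?_⟩
  · rw [close_record]
    have hth := hs.thrifty ℓ hℓ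
    rw [close_record] at hth
    by_cases hl : ℓ = st.layer
    · have hl' : ℓ = st.choose.layer := hl
      rw [if_pos hl']
      -- The answer so far is an initial segment of the strategy's answer, and such segments already
      -- pay for themselves.
      have hpre : st.choose.chosen <+: dominateList G st.move := by
        rw [← hr.answer]
        refine ⟨td, ?_⟩
        simp [ElimState.choose, htodo]
      refine Thrifty.append (Thrifty.of_append hth) ?_ (dominateList_prefix hK hself _ hpre)
      refine Finset.disjoint_left.mpr fun v hv => ?_
      have hv' : v ∈ st.move := (dominateList_spec hself st.move).2.1
        (List.mem_toFinset.mpr (hpre.subset (List.mem_toFinset.mp hv)))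
      rw [hr.move, ← hl] at hv'
      exact (Finset.mem_sdiff.mp hv').2
    · have hl' : ¬ ℓ = st.choose.layer := hl
      rw [if_neg hl', List.append_nil]
      exact hth.of_append
  · rw [hcount]
    -- The new round changes the observed set of the current layer only; if it adds `a` there, it
    -- also adds an observation of `a`.
    have key : (∀ ℓ ∈ F.erase st.layer, a ∈ observed G st ℓ) := by
      intro ℓ hℓ
      have := hF ℓ (Finset.mem_of_mem_erase hℓ)
      rw [hobs, if_neg (Finset.ne_of_mem_erase hℓ)] at this
      simpa using this
    split_ifs with hadj
    · have := hs.card_le_obsCount a _ key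
      have := Finset.pred_card_le_card_erase (s := F) (a := st.layer)
      omega
    · refine hs.card_le_obsCount a F fun ℓ hℓ => ?_
      have := hF ℓ hℓ
      rw [hobs, Finset.mem_union] at this
      rcases this with h | h
      · exact h
      · split_ifs at h
        · simp [mem_outNbrs, hadj] at h
        · simp at h
  · have := hs.card_le_length (F.erase st.layer) (by
      intro ℓ hℓ
      have := hF ℓ (Finset.mem_of_mem_erase hℓ)
      rw [hobs, if_neg (Finset.ne_of_mem_erase hℓ)] at this
      simpa using this)
    have := Finset.pred_card_le_card_erase (s := F) (a := st.layer)
    rw [List.length_cons]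
    omega
  · have hc := hs.count ℓ hℓ
    rw [close_record] at hc ⊢
    rw [List.count_cons, hc]
    by_cases hl : ℓ = st.layer
    · have hl' : ℓ = st.choose.layer := hl
      rw [if_pos hl', if_pos hl]
      simp [ElimState.choose, htodo, hl, Nat.add_assoc]
    · have hl' : ¬ ℓ = st.choose.layer := hl
      rw [if_neg hl', if_neg hl]
      simp [ElimState.choose, Ne.symm hl]
  · have hctx : ctxCount (x :: h) x.ctx = ctxCount h x.ctx := by
      unfold ctxCount
      simp
    refine ⟨hr.cur, hr.one_le_layer, ?_, ?_, hr.move, ?_, hr.best_mem, hr.gap_le⟩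
    · rw [hctx]; exact hr.length_record
    · intro a ha ℓ h1 h2
      rw [hobs]
      exact Finset.mem_union_left _ (hr.lower a ha ℓ h1 h2)
    · refine Eq.trans ?_ hr.answer
      simp [ElimState.choose, htodo]

/-- The past rounds of a run of the policy with self-avoiding contexts and accurate estimates. -/
inductive Valid (G : Digraph (Fin K)) [NeZero K] (μ : Fin M → Fin K → ℝ) (T : ℕ) (δ : ℝ) :
    List (Round M K) → Prop
  | nil : Valid G μ T δ []
  | cons (x : Round M K) (h : List (Round M K)) (hh : Valid G μ T δ h)
      (hacc : Accurate G μ (Real.log (2 * M * K * T / δ)) h)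
      (hact : x.act = armElim dominate T M K G δ h x.ctx)
      (hctx : (∃ y h', h = y :: h' ∧ y.ctx = x.ctx) ∨ ∀ y ∈ h, y.ctx ≠ x.ctx) :
      Valid G μ T δ (x :: h)

theorem exists_best [NeZero K] (μ : Fin M → Fin K → ℝ) (c : Fin M) :
    ∃ a, ∀ b, μ c b ≤ μ c a := by
  obtain ⟨a, ha⟩ := Finite.exists_max (μ c)
  exact ⟨a, ha⟩

/-- The probability-free core: along a run with accurate estimates the invariants hold, and each
round loses at most the gap allowed on its layer. -/
theorem Valid.course [NeZero K] (hK : 2 ≤ K) (hself : ∀ a, G.Adj a a) {μ : Fin M → Fin K → ℝ}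
    (hμ : ∀ c a, μ c a ∈ Set.Icc (0 : ℝ) 1) {T : ℕ} {δ : ℝ}
    (hw : 1 / 36 ≤ Real.log (2 * M * K * T / δ)) {h : List (Round M K)} (hh : Valid G μ T δ h) :
    Sound G (domRatio K) h (layersOf dominate T G δ h) (elimState dominate T G δ h) ∧
      (∀ y h', h = y :: h' → Running G μ (Real.log (2 * M * K * T / δ)) h y.ctx
        (elimState dominate T G δ h)) ∧
      (∀ ℓ ∈ layersOf dominate T G δ h, 1 ≤ ℓ) ∧
      (h.map fun x => gap μ x.ctx x.act).sum ≤
        ((layersOf dominate T G δ h).map fun ℓ : ℕ =>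
          6 * √(Real.log (2 * M * K * T / δ) / ℓ)).sum := by
  set w := Real.log (2 * M * K * T / δ) with hwdef
  have hw0 : 0 ≤ w := by linarith
  induction hh with
  | nil =>
    refine ⟨⟨fun ℓ hℓ => ?_, fun a F hF => ?_, fun F hF => ?_, fun ℓ hℓ => ?_⟩, by simp,
      by simp [layersOf], by simp [layersOf]⟩
    · rw [close_record, if_neg (by simp [elimState, ElimState.init]; omega)]
      exact thrifty_nil _
    · rcases F.eq_empty_or_nonempty with rfl | ⟨ℓ, hℓ⟩
      · simp
      · have := hF ℓ hℓ
        simp [observed_eq, elimState, ElimState.init, covered, outNbrs_empty] at this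
    · rcases F.eq_empty_or_nonempty with rfl | ⟨ℓ, hℓ⟩
      · simp
      · have := hF ℓ hℓ
        simp [observed_eq, elimState, ElimState.init, covered, outNbrs_empty] at this
    · rw [close_record, if_neg (by simp [elimState, ElimState.init]; omega)]
      simp [layersOf, elimState, ElimState.init]
  | cons x h hh hacc hact hctx ih =>
    obtain ⟨hs, hr, hlay, hsum⟩ := ih
    set st := elimState dominate T G δ h with hst
    set st₀ := (if st.cur = some x.ctx then st
      else (st.close G).enter dominate G x.ctx 1 Finset.univ) with hst₀
    have h0 : Sound G (domRatio K) h (layersOf dominate T G δ h) st₀ ∧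
        Running G μ w h x.ctx st₀ := by
      rw [hst₀]
      split_ifs with hcur
      · refine ⟨hs, ?_⟩
        cases h with
        | nil => simp [hst, elimState, ElimState.init] at hcur
        | cons y h' =>
          have := hr y h' rfl
          have e := this.cur
          rw [hcur, Option.some.injEq] at e
          rw [e]; exact this
      · refine ⟨hs.enter _ _ _, ?_⟩
        -- Self-avoidance: a context different from the last one has never occurred, so the context
        -- count grows and frees one slot on every layer.
        have hnew : ∀ y ∈ h, y.ctx ≠ x.ctx := by
          rcases hctx with ⟨y, h', rfl, hy⟩ | hctx
          · exact absurd ((hr y h' rfl).cur.trans (by rw [hy])) hcur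
          · exact hctx
        have hlen : ∀ ℓ, 1 ≤ ℓ →
            ((st.close G).record ℓ).length ≤ (h.map Round.ctx).toFinset.card := by
          intro ℓ hℓ
          cases h with
          | nil =>
            rw [close_record, if_neg (by simp [hst, elimState, ElimState.init]; omega)]
            simp [hst, elimState, ElimState.init]
          | cons y h' =>
            have := (hr y h' rfl).length_record ℓ hℓ
            have e : ctxCount (y :: h') y.ctx = ((y :: h').map Round.ctx).toFinset.card := by
              unfold ctxCount
              simp
            rw [e] at this
            refine le_trans ?_ this
            rw [close_record, List.length_append]
            split_ifs <;> (simp; try omega)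
        obtain ⟨b, hb⟩ := exists_best μ x.ctx
        refine ⟨rfl, le_rfl, fun ℓ hℓ => ?_, fun a _ ℓ h1 h2 => ?_, rfl, rfl,
          ⟨b, Finset.mem_univ _, hb⟩, fun a _ => ?_⟩
        · change ((st.close G).record ℓ).length + (if 1 ≤ ℓ then 1 else 0) ≤ _
          rw [if_pos hℓ]
          unfold ctxCount
          rw [Finset.card_insert_of_notMem]
          · exact Nat.succ_le_succ (hlen ℓ hℓ)
          · rw [List.mem_toFinset, List.mem_map]
            rintro ⟨y, hy, hyx⟩
            exact hnew y hy hyx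
        · change ℓ < 1 at h2
          omega
        · rw [gap_eq hb]
          have h1 := (hμ x.ctx b).2
          have h2 := (hμ x.ctx a).1
          change _ ≤ 6 * √(w / (1 : ℕ))
          -- On layer `1` the gap bound is trivial, as gaps are at most `1`; this is where `1 / 36 ≤
          -- w` enters.
          have h3 : 1 / 6 ≤ √(w / (1 : ℕ)) := by
            refine Real.le_sqrt_of_sq_le ?_
            rw [Nat.cast_one, div_one]
            norm_num
            linarith
          linarith
    obtain ⟨hs₁, hr₁⟩ := h0.2.iterate hself hw0 h0.1 hacc (h.length + 1)
    have hne := todo_iterate_ne_nil hself hw0 h0.1 h0.2 hacc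
    have hprep : st.prepare dominate T G δ h x.ctx =
      (ElimState.advance dominate T G δ h x.ctx)^[h.length + 1] st₀ := rfl
    rw [← hprep] at hs₁ hr₁ hne
    obtain ⟨v, td, htodo⟩ := List.exists_cons_of_ne_nil hne
    have hv : x.act = v := by
      rw [hact]
      unfold armElim
      rw [← hst, htodo]; rfl
    rw [← hv] at htodo
    obtain ⟨k1, k2⟩ := hr₁.choose hK hself hs₁ htodo
    refine ⟨k1, ?_, ?_, ?_⟩
    · intro y h' e
      obtain ⟨rfl, rfl⟩ := List.cons.inj e
      exact k2
    · intro ℓ hℓ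
      rcases List.mem_cons.mp hℓ with rfl | hℓ
      · exact hr₁.one_le_layer
      · exact hlay ℓ hℓ
    · simp only [layersOf, List.map_cons, List.sum_cons]
      refine add_le_add (hr₁.gap_le x.act ?_) hsum
      -- Answers stay within the move, hence within the active set, where the gap bound applies.
      have h1 : x.act ∈ (st.prepare dominate T G δ h x.ctx).move := by
        refine (dominateList_spec hself _).2.1 ?_
        rw [← hr₁.answer, htodo]
        simp
      rw [hr₁.move] at h1
      exact (Finset.mem_sdiff.mp h1).1

/-- The rounds on a layer are the cost of the game played there, which has at most one move per
context. -/
theorem Valid.count_le [NeZero K] (hK : 2 ≤ K) (hself : ∀ a, G.Adj a a) {μ : Fin M → Fin K → ℝ}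
    (hμ : ∀ c a, μ c a ∈ Set.Icc (0 : ℝ) 1) {T : ℕ} {δ : ℝ}
    (hw : 1 / 36 ≤ Real.log (2 * M * K * T / δ)) {h : List (Round M K)} (hh : Valid G μ T δ h)
    {ℓ : ℕ} (hℓ : 1 ≤ ℓ) :
    ((layersOf dominate T G δ h).count ℓ : ℝ) ≤ domRatio K * beta M G := by
  obtain ⟨hs, hr, -⟩ := hh.course hK hself hμ hw
  have hB : 0 ≤ domRatio K := zero_le_one.trans (one_le_domRatio hK)
  rw [hs.count ℓ hℓ]
  have := (hs.thrifty ℓ hℓ).sum_length_le hB (M := M) (by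
    cases h with
    | nil =>
      rw [close_record, if_neg (by simp [elimState, ElimState.init]; omega)]
      simp [elimState, ElimState.init]
    | cons y h' =>
      have h1 := (hr y h' rfl).length_record ℓ hℓ
      have h2 : ctxCount (y :: h') y.ctx ≤ M := by
        unfold ctxCount
        exact (Finset.card_le_univ _).trans (by simp)
      rw [close_record, List.length_append]
      refine le_trans ?_ (h1.trans h2)
      split_ifs <;> (simp; try omega))
  refine le_trans (le_of_eq ?_) this
  push_cast
  simp [List.map_map, Function.comp_def]

/-- Telescoping, since `1 / √(m + 1) ≤ 2 (√(m + 1) - √m)`. -/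
theorem sum_inv_sqrt_le (m : ℕ) : ∑ k ∈ Finset.Icc 1 m, 1 / √(k : ℝ) ≤ 2 * √m := by
  induction m with
  | zero => simp
  | succ m ih =>
    rw [Finset.sum_Icc_succ_top (by omega)]
    have h1 : (0 : ℝ) < √((m + 1 : ℕ) : ℝ) := Real.sqrt_pos.mpr (by positivity)
    have h2 := Real.sq_sqrt (show (0 : ℝ) ≤ ((m + 1 : ℕ) : ℝ) by positivity)
    have h3 := Real.sq_sqrt (show (0 : ℝ) ≤ (m : ℝ) by positivity)
    have h4 : 1 / √((m + 1 : ℕ) : ℝ) ≤ 2 * (√((m + 1 : ℕ) : ℝ) - √m) := by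
      rw [div_le_iff₀ h1]
      push_cast at h2 ⊢
      push_cast at h1
      nlinarith [sq_nonneg (√((m : ℝ) + 1) - √(m : ℝ))]
    linarith

/-- Rounds spread over layers, with at most `N` on each. -/
theorem sum_inv_sqrt_list_le {N : ℝ} (hN : 0 < N) (ls : List ℕ) (h1 : ∀ ℓ ∈ ls, 1 ≤ ℓ)
    (hc : ∀ ℓ, 1 ≤ ℓ → (ls.count ℓ : ℝ) ≤ N) :
    (ls.map fun ℓ : ℕ => 1 / √(ℓ : ℝ)).sum ≤ 3 * √(N * ls.length) := by
  rcases Nat.eq_zero_or_pos ls.length with h0 | h0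
  · rw [List.length_eq_zero_iff] at h0
    simp [h0]
  -- The number of layers that full occupancy would need. Rounds on higher layers cost at most `1 /
  -- √x` each, in total `√(N n)` for `n` rounds; the layers up to `x` cost at most `2 N √x = 2 √(N
  -- n)`.
  set x : ℝ := ls.length / N with hx
  have hn : (0 : ℝ) < ls.length := by exact_mod_cast h0
  have hx0 : 0 < x := div_pos hn hN
  have hsx : N * √x = √(N * ls.length) := by
    rw [hx]
    have : N * ls.length = N ^ 2 * (ls.length / N) := by field_simp
    rw [this, Real.sqrt_mul (by positivity), Real.sqrt_sq hN.le]
  have hle : (ls.map fun ℓ : ℕ => 1 / √(ℓ : ℝ)).sum ≤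
      (ls.map fun ℓ : ℕ => 1 / √x + if ℓ ≤ ⌊x⌋₊ then 1 / √(ℓ : ℝ) else 0).sum := by
    refine List.sum_le_sum fun ℓ hℓ => ?_
    have hs : 0 ≤ 1 / √x := by positivity
    split_ifs with h
    · linarith
    · have : x ≤ ℓ := by
        have := Nat.lt_of_floor_lt (not_le.mp h)
        exact this.le
      rw [add_zero]
      exact one_div_le_one_div_of_le (Real.sqrt_pos.mpr hx0) (Real.sqrt_le_sqrt this)
  refine hle.trans ?_
  rw [List.sum_map_add]
  have e1 : (ls.map fun _ : ℕ => 1 / √x).sum = √(N * ls.length) := by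
    rw [List.map_const', List.sum_replicate, nsmul_eq_mul, ← hsx]
    have h2 := Real.sq_sqrt hx0.le
    have h3 : (ls.length : ℝ) = N * x := by rw [hx]; field_simp
    have h4 : 0 < √x := Real.sqrt_pos.mpr hx0
    rw [h3, mul_one_div, div_eq_iff h4.ne']
    nlinarith
  have e2 : (ls.map fun ℓ : ℕ => if ℓ ≤ ⌊x⌋₊ then 1 / √(ℓ : ℝ) else 0).sum ≤
      2 * √(N * ls.length) := by
    rw [Finset.sum_list_map_count]
    simp only [nsmul_eq_mul, mul_ite, mul_zero]
    rw [← Finset.sum_filter]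
    calc _ ≤ ∑ k ∈ ls.toFinset.filter (fun k => k ≤ ⌊x⌋₊), N * (1 / √(k : ℝ)) := by
            refine Finset.sum_le_sum fun k hk => ?_
            rw [Finset.mem_filter, List.mem_toFinset] at hk
            exact mul_le_mul_of_nonneg_right (hc k (h1 k hk.1)) (by positivity)
      _ ≤ ∑ k ∈ Finset.Icc 1 ⌊x⌋₊, N * (1 / √(k : ℝ)) := by
            refine Finset.sum_le_sum_of_subset_of_nonneg (fun k hk => ?_)
              fun k _ _ => by positivity
            rw [Finset.mem_filter, List.mem_toFinset] at hk
            exact Finset.mem_Icc.mpr ⟨h1 k hk.1, hk.2⟩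
      _ ≤ N * (2 * √x) := by
            rw [← Finset.mul_sum]
            refine mul_le_mul_of_nonneg_left ((sum_inv_sqrt_le _).trans ?_) hN.le
            have := Real.sqrt_le_sqrt (Nat.floor_le hx0.le)
            linarith
      _ = _ := by rw [← hsx]; ring
  linarith

theorem length_layersOf (𝒜 : GameAlg) (T : ℕ) (δ : ℝ) (h : List (Round M K)) :
    (layersOf 𝒜 T G δ h).length = h.length := by
  induction h with
  | nil => rfl
  | cons x h ih => simp [layersOf, ih]

/-- A single vertex in a single slot is admissible; so the per-layer bound is positive. -/
theorem one_le_beta [NeZero K] (c : Fin M) : 1 ≤ beta M G := by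
  unfold beta
  refine le_trans ?_ (Finset.le_sup (f := fun I : Fin M → Finset (Fin K) => ∑ c, (I c).card)
    (b := fun c' => if c' = c then {0} else ∅) ?_)
  · refine le_trans ?_ (Finset.single_le_sum (fun _ _ => Nat.zero_le _) (Finset.mem_univ c))
    simp
  · rw [Finset.mem_filter]
    refine ⟨Finset.mem_univ _, fun c' u hu v hv huv => ?_, fun i j hij u hu v hv => ?_⟩
    · dsimp only at hu hv
      split_ifs at hu hv with hc
      · simp only [Finset.mem_singleton] at hu hv
        exact absurd (hu.trans hv.symm) huv
      · simp at hu
    · dsimp only at hu hv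
      split_ifs at hu hv with hi hj
      · exact absurd (hi.trans hj.symm) hij.ne
      all_goals simp at hu hv

/-- The constant is `6` from the gap on a layer times `3` from spreading the rounds over the layers.
-/
theorem Valid.regret_le [NeZero K] (hK : 2 ≤ K) (hself : ∀ a, G.Adj a a) {μ : Fin M → Fin K → ℝ}
    (hμ : ∀ c a, μ c a ∈ Set.Icc (0 : ℝ) 1) {T : ℕ} {δ : ℝ}
    (hw : 1 / 36 ≤ Real.log (2 * M * K * T / δ)) {h : List (Round M K)} (hh : Valid G μ T δ h)
    (hβ : 1 ≤ beta M G) :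
    (h.map fun x => gap μ x.ctx x.act).sum ≤
      18 * √(Real.log (2 * M * K * T / δ) * (domRatio K * beta M G * h.length)) := by
  obtain ⟨-, -, h1, h2⟩ := hh.course hK hself hμ hw
  have hN : 0 < domRatio K * beta M G := by
    have := one_le_domRatio hK
    have : (1 : ℝ) ≤ beta M G := by exact_mod_cast hβ
    positivity
  have h3 := sum_inv_sqrt_list_le hN _ h1 fun ℓ hℓ => hh.count_le hK hself hμ hw hℓ
  rw [length_layersOf] at h3
  refine h2.trans ?_
  have hw0 : 0 ≤ Real.log (2 * M * K * T / δ) := by linarith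
  have e : (fun ℓ : ℕ => 6 * √(Real.log (2 * M * K * T / δ) / ℓ)) =
      fun ℓ : ℕ => 6 * √(Real.log (2 * M * K * T / δ)) * (1 / √(ℓ : ℝ)) := by
    funext ℓ
    rw [Real.sqrt_div hw0]
    ring
  rw [e, List.sum_map_mul_left, Real.sqrt_mul hw0]
  have := mul_le_mul_of_nonneg_left h3
    (show 0 ≤ 6 * √(Real.log (2 * M * K * T / δ)) by positivity)
  linarith

end Course
open MeasureTheory

/-! ### Measurability of the policy -/

section Measurability

/-- A map into a discrete space with countably many values, each on a measurable set. -/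
def CountableMeas {X S : Type*} [MeasurableSpace X] (f : X → S) : Prop :=
  (Set.range f).Countable ∧ ∀ s, MeasurableSet (f ⁻¹' {s})

variable {X S S' : Type*} [MeasurableSpace X]

theorem CountableMeas.const (s : S) : CountableMeas (fun _ : X => s) :=
  ⟨(Set.countable_singleton s).mono (by rintro _ ⟨x, rfl⟩; rfl), fun _ => by
    by_cases h : s = ‹S› <;> simp [Set.preimage, h]⟩

/-- Partition by the countably many values of `f`. Algorithm states can thus be composed without a
σ-algebra on them. -/
theorem CountableMeas.bind {f : X → S} (hf : CountableMeas f) {g : S → X → S'}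
    (hg : ∀ s, CountableMeas (g s)) : CountableMeas fun x => g (f x) x := by
  refine ⟨(hf.1.biUnion fun s _ => (hg s).1).mono ?_, fun y => ?_⟩
  · rintro _ ⟨x, rfl⟩
    exact Set.mem_biUnion ⟨x, rfl⟩ ⟨x, rfl⟩
  · have : (fun x => g (f x) x) ⁻¹' {y} = ⋃ s ∈ Set.range f, f ⁻¹' {s} ∩ g s ⁻¹' {y} := by
      ext x
      simp only [Set.mem_iUnion, Set.mem_inter_iff, Set.mem_preimage, Set.mem_singleton_iff]
      exact ⟨fun h => ⟨f x, ⟨x, rfl⟩, rfl, h⟩, fun ⟨_, _, e, h⟩ => e ▸ h⟩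
    rw [this]
    exact MeasurableSet.biUnion hf.1 fun s _ => (hf.2 s).inter ((hg s).2 y)

theorem CountableMeas.comp {f : X → S} (hf : CountableMeas f) (g : S → S') :
    CountableMeas fun x => g (f x) :=
  hf.bind fun s => CountableMeas.const (g s)

theorem CountableMeas.measurable_bind {Y : Type*} [MeasurableSpace Y] {f : X → S}
    (hf : CountableMeas f) {g : S → X → Y} (hg : ∀ s, Measurable (g s)) :
    Measurable fun x => g (f x) x := by
  intro B hB
  have : (fun x => g (f x) x) ⁻¹' B = ⋃ s ∈ Set.range f, f ⁻¹' {s} ∩ g s ⁻¹' B := by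
    ext x
    simp only [Set.mem_iUnion, Set.mem_inter_iff, Set.mem_preimage, Set.mem_singleton_iff]
    exact ⟨fun h => ⟨f x, ⟨x, rfl⟩, rfl, h⟩, fun ⟨_, _, e, h⟩ => e ▸ h⟩
  rw [this]
  exact MeasurableSet.biUnion hf.1 fun s _ => (hf.2 s).inter (hg s hB)

variable {M K : ℕ} {G : Digraph (Fin K)}

/-- Random lists of rounds with fixed contexts and actions. -/
inductive MeasRounds : (X → List (Round M K)) → Prop
  | nil : MeasRounds fun _ => []
  | cons (c : Fin M) (a : Fin K) (o : X → Fin M → Fin K → ℝ) (ho : Measurable o)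
      (H : X → List (Round M K)) (hH : MeasRounds H) : MeasRounds fun x => ⟨c, a, o x⟩ :: H x

/-- Only the actions decide what is revealed, and these are frozen; so the denominators of the
empirical means are deterministic. -/
theorem MeasRounds.obsCount_eq {H : X → List (Round M K)} (hH : MeasRounds H) (a : Fin K) :
    ∃ n, ∀ x, obsCount G (H x) a = n := by
  induction hH with
  | nil => exact ⟨0, fun _ => rfl⟩
  | cons c b o ho H hH ih =>
    obtain ⟨n, hn⟩ := ih
    refine ⟨n + if G.Adj b a then 1 else 0, fun x => ?_⟩
    rw [← hn x]
    unfold obsCount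
    rw [List.filter_cons]
    by_cases hab : G.Adj b a <;> simp [hab]

theorem MeasRounds.length_eq {H : X → List (Round M K)} (hH : MeasRounds H) :
    ∃ n, ∀ x, (H x).length = n := by
  induction hH with
  | nil => exact ⟨0, fun _ => rfl⟩
  | cons c b o ho H hH ih =>
    obtain ⟨n, hn⟩ := ih
    exact ⟨n + 1, fun x => by simp [hn x]⟩

/-- The sum of the observed rewards, centred at `m`. -/
noncomputable def obsSum (G : Digraph (Fin K)) (m : ℝ) (h : List (Round M K)) (c : Fin M)
    (a : Fin K) : ℝ :=
  ((h.filter fun x => G.Adj x.act a).map fun x => x.obs c a - m).sum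

theorem obsSum_cons (m : ℝ) (x : Round M K) (h : List (Round M K)) (c : Fin M) (a : Fin K) :
    obsSum G m (x :: h) c a = if G.Adj x.act a then (x.obs c a - m) + obsSum G m h c a
      else obsSum G m h c a := by
  unfold obsSum
  rw [List.filter_cons]
  by_cases h : G.Adj x.act a <;> simp [h]

theorem obsCount_cons (x : Round M K) (h : List (Round M K)) (a : Fin K) :
    obsCount G (x :: h) a = if G.Adj x.act a then obsCount G h a + 1 else obsCount G h a := by
  unfold obsCount
  rw [List.filter_cons]
  by_cases h : G.Adj x.act a <;> simp [h]

theorem empMean_eq (h : List (Round M K)) (c : Fin M) (a : Fin K) :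
    empMean G h c a = obsSum G 0 h c a / obsCount G h a := by
  simp [empMean, obsSum, obsCount]

theorem obsSum_eq (m : ℝ) (h : List (Round M K)) (c : Fin M) (a : Fin K) :
    obsSum G m h c a = obsSum G 0 h c a - obsCount G h a * m := by
  induction h with
  | nil => simp [obsSum, obsCount]
  | cons x h ih =>
    rw [obsSum_cons, obsSum_cons, obsCount_cons]
    split_ifs
    · rw [ih]; push_cast; ring
    · exact ih

theorem MeasRounds.measurable_obsSum {H : X → List (Round M K)} (hH : MeasRounds H) (m : ℝ)
    (c : Fin M) (a : Fin K) : Measurable fun x => obsSum G m (H x) c a := by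
  induction hH with
  | nil => exact measurable_const
  | cons c' b o ho H hH ih =>
    simp only [obsSum_cons]
    by_cases hab : G.Adj b a
    · simp only [hab, if_true]
      have : Measurable fun x => o x c a :=
        (measurable_pi_apply a).comp ((measurable_pi_apply c).comp ho)
      exact (this.sub_const m).add ih
    · simpa only [hab, if_false] using ih

theorem MeasRounds.measurable_empMean {H : X → List (Round M K)} (hH : MeasRounds H)
    (c : Fin M) (a : Fin K) : Measurable fun x => empMean G (H x) c a := by
  simp only [empMean_eq]
  obtain ⟨n, hn⟩ := hH.obsCount_eq (G := G) a
  simp only [hn]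
  exact (hH.measurable_obsSum 0 c a).div_const _

/-- The surviving set is decided by finitely many comparisons of measurable empirical means. -/
theorem MeasRounds.eliminate {H : X → List (Round M K)} (hH : MeasRounds H) (T : ℕ) (δ : ℝ)
    (c : Fin M) (ℓ : ℕ) (A : Finset (Fin K)) :
    CountableMeas fun x => GraphBandit.eliminate T G δ (H x) c ℓ A := by
  refine ⟨Set.to_countable _, fun s => ?_⟩
  have : (fun x => GraphBandit.eliminate T G δ (H x) c ℓ A) ⁻¹' {s} =
      {x | ∀ a, (a ∈ A ∧ ∀ a' ∈ A, empMean G (H x) c a' -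
        2 * √(Real.log (2 * M * K * T / δ) / ℓ) ≤ empMean G (H x) c a) ↔ a ∈ s} := by
    ext x
    simp only [Set.mem_preimage, Set.mem_singleton_iff, Set.mem_ofPred_eq, Finset.ext_iff,
      GraphBandit.eliminate, Finset.mem_filter]
  rw [this, Set.ofPred_forall]
  refine MeasurableSet.iInter fun a => ?_
  refine MeasurableSet.iff ?_ (MeasurableSet.const _)
  refine (MeasurableSet.const (a ∈ A)).inter ?_
  change MeasurableSet {x | ∀ a' ∈ A, empMean G (H x) c a' -
    2 * √(Real.log (2 * M * K * T / δ) / ℓ) ≤ empMean G (H x) c a}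
  simp only [Set.ofPred_forall]
  refine MeasurableSet.iInter fun a' => MeasurableSet.iInter fun _ => ?_
  exact measurableSet_le ((hH.measurable_empMean c a').sub_const _) (hH.measurable_empMean c a)

theorem MeasRounds.advance {H : X → List (Round M K)} (hH : MeasRounds H) (𝒜 : GameAlg) (T : ℕ)
    (δ : ℝ) (c : Fin M) (st : ElimState M K) :
    CountableMeas fun x => st.advance 𝒜 T G δ (H x) c := by
  unfold ElimState.advance
  by_cases h : st.todo = []
  · simp only [h, if_true]
    exact (hH.eliminate T δ c st.layer st.active).comp
      fun A => (st.close G).enter 𝒜 G c (st.layer + 1) A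
  · simp only [h, if_false]
    exact CountableMeas.const _

theorem MeasRounds.prepare {H : X → List (Round M K)} (hH : MeasRounds H) (𝒜 : GameAlg) (T : ℕ)
    (δ : ℝ) (c : Fin M) (st : ElimState M K) :
    CountableMeas fun x => st.prepare 𝒜 T G δ (H x) c := by
  unfold ElimState.prepare
  obtain ⟨n, hn⟩ := hH.length_eq
  simp only [hn]
  generalize (if st.cur = some c then st else (st.close G).enter 𝒜 G c 1 Finset.univ) = st₀
  induction n + 1 with
  | zero => exact CountableMeas.const _
  | succ k ih =>
    simp only [Function.iterate_succ_apply']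
    exact ih.bind fun st => hH.advance 𝒜 T δ c st

theorem MeasRounds.elimState {H : X → List (Round M K)} (hH : MeasRounds H) (𝒜 : GameAlg) (T : ℕ)
    (δ : ℝ) : CountableMeas fun x => GraphBandit.elimState 𝒜 T G δ (H x) := by
  induction hH with
  | nil => exact CountableMeas.const _
  | cons c a o ho H hH ih =>
    exact (ih.bind fun st => hH.prepare 𝒜 T δ c st).comp ElimState.choose

theorem MeasRounds.armElim [NeZero K] {H : X → List (Round M K)} (hH : MeasRounds H) (𝒜 : GameAlg)
    (T : ℕ) (δ : ℝ) (c : Fin M) :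
    CountableMeas fun x => GraphBandit.armElim 𝒜 T M K G δ (H x) c :=
  ((hH.elimState 𝒜 T δ).bind fun st => hH.prepare 𝒜 T δ c st).comp fun st => st.todo.headD 0

/-- The policy's actions are measurable as long as the contexts and actions are fixed. -/
def MeasPolicy (π : Policy M K) : Prop :=
  ∀ (X : Type) [MeasurableSpace X] (H : X → List (Round M K)), MeasRounds H →
    ∀ c, CountableMeas fun x => π (H x) c

variable {T : ℕ}

/-- The past rounds with the given actions. -/
noncomputable def roundsOf (G : Digraph (Fin K)) (c : Fin T → Fin M)
    (r : Fin T → Fin M → Fin K → ℝ) : List (Fin K) → List (Round M K)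
  | [] => []
  | a :: as => if ht : as.length < T then
      ⟨c ⟨as.length, ht⟩, a, reveal G a (r ⟨as.length, ht⟩)⟩ :: roundsOf G c r as
    else roundsOf G c r as

theorem measurable_reveal (a : Fin K) :
    Measurable (reveal G a : (Fin M → Fin K → ℝ) → Fin M → Fin K → ℝ) := by
  refine measurable_pi_lambda _ fun c => measurable_pi_lambda _ fun b => ?_
  unfold reveal
  split_ifs
  · exact (measurable_pi_apply b).comp (measurable_pi_apply c)
  · exact measurable_const

theorem measRounds_roundsOf (c : Fin T → Fin M) (as : List (Fin K)) :
    MeasRounds fun r : Fin T → Fin M → Fin K → ℝ => roundsOf G c r as := by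
  induction as with
  | nil => exact MeasRounds.nil
  | cons a as ih =>
    unfold roundsOf
    split_ifs with ht
    · exact MeasRounds.cons _ _ _ ((measurable_reveal a).comp (measurable_pi_apply _)) _ ih
    · exact ih

/-- Rebuilding a history from its action list lets one freeze that list, which has countably many
values, and treat the history as `MeasRounds`. -/
theorem roundsOf_history (π : Policy M K) (c : Fin T → Fin M) (r : Fin T → Fin M → Fin K → ℝ)
    (t : ℕ) (ht : t ≤ T) :
    roundsOf G c r ((history π G c r t ht).map Round.act) = history π G c r t ht := by
  induction t with
  | zero => rfl
  | succ t ih =>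
    have ih' := ih (Nat.le_of_succ_le ht)
    simp only [history, List.map_cons, roundsOf, List.length_map, length_history, ih',
      dif_pos (Nat.lt_of_succ_le ht)]

theorem countableMeas_acts {π : Policy M K} (hπ : MeasPolicy π) (c : Fin T → Fin M) (t : ℕ)
    (ht : t ≤ T) : CountableMeas fun r => (history π G c r t ht).map Round.act := by
  induction t with
  | zero => exact CountableMeas.const _
  | succ t ih =>
    have ih' := ih (Nat.le_of_succ_le ht)
    have := CountableMeas.bind ih' (g := fun as r => π (roundsOf G c r as) (c ⟨t, ht⟩) :: as)
      fun as => (hπ _ _ (measRounds_roundsOf c as) _).comp fun a => a :: as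
    simp only [roundsOf_history] at this
    exact this

theorem countableMeas_action {π : Policy M K} (hπ : MeasPolicy π) (c : Fin T → Fin M) (t : Fin T) :
    CountableMeas fun r => action π G c r t := by
  have := CountableMeas.bind (countableMeas_acts (G := G) hπ c t t.isLt.le)
    (g := fun as r => π (roundsOf G c r as) (c t))
    fun as => hπ _ _ (measRounds_roundsOf c as) _
  simp only [roundsOf_history] at this
  exact this

theorem measurable_history {Y : Type*} [MeasurableSpace Y] {π : Policy M K} (hπ : MeasPolicy π)
    (c : Fin T → Fin M) (t : ℕ) (ht : t ≤ T) (Φ : List (Round M K) → Y)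
    (hΦ : ∀ H : (Fin T → Fin M → Fin K → ℝ) → List (Round M K), MeasRounds H →
      Measurable fun r => Φ (H r)) :
    Measurable fun r => Φ (history π G c r t ht) := by
  have := (countableMeas_acts (G := G) hπ c t ht).measurable_bind
    (g := fun as r => Φ (roundsOf G c r as)) fun as => hΦ _ (measRounds_roundsOf c as)
  simpa only [roundsOf_history] using this

theorem measurable_regret {π : Policy M K} (hπ : MeasPolicy π) (c : Fin T → Fin M)
    (μ : Fin M → Fin K → ℝ) : Measurable fun r => regret π G c μ r := by
  unfold regret
  refine Finset.measurable_sum _ fun t _ => ?_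
  exact (countableMeas_action (G := G) hπ c t).measurable_bind
    (g := fun a _ => (⨆ a, μ (c t) a) - μ (c t) a) fun _ => measurable_const

theorem measPolicy_armElim [NeZero K] (𝒜 : GameAlg) (T : ℕ) (δ : ℝ) :
    MeasPolicy (armElim 𝒜 T M K G δ) := fun _ _ _ hH c => hH.armElim 𝒜 T δ c

/-- What was observed before round `t` depends only on the earlier rewards. -/
theorem history_congr (π : Policy M K) (c : Fin T → Fin M) {r r' : Fin T → Fin M → Fin K → ℝ}
    (t : ℕ) (ht : t ≤ T) (h : ∀ s : Fin T, s.1 < t → r s = r' s) :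
    history π G c r t ht = history π G c r' t ht := by
  induction t with
  | zero => rfl
  | succ t ih =>
    have := ih (Nat.le_of_succ_le ht) fun s hs => h s (by omega)
    simp only [history, this, h ⟨t, ht⟩ (by simp)]

end Measurability
open ProbabilityTheory

/-! ### Concentration of the empirical rewards -/

section Concentration
variable {T M K : ℕ} {G : Digraph (Fin K)} {Ω : Type*} [MeasurableSpace Ω] {P : Measure Ω}
  {r : Fin T → Ω → Fin M → Fin K → ℝ} {μ : Fin M → Fin K → ℝ}

/-- The exponential supermartingale of the observed rewards of an action. -/
noncomputable def expWeight (G : Digraph (Fin K)) (s m : ℝ) (c : Fin M) (a : Fin K)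
    (h : List (Round M K)) : ENNReal :=
  ENNReal.ofReal (Real.exp (s * obsSum G m h c a - s ^ 2 / 8 * obsCount G h a))

theorem measurable_reward (hr : StochasticRewards P r μ) (t : Fin T) (c : Fin M) (a : Fin K) :
    Measurable fun ω => r t ω c a :=
  (measurable_pi_apply a).comp ((measurable_pi_apply c).comp (hr.measurable t))

/-- Hoeffding's lemma: a variable in `[0, 1]` is sub-Gaussian with variance proxy `1 / 4`. -/
theorem lintegral_exp_reward_le [IsProbabilityMeasure P] (hr : StochasticRewards P r μ) (s : ℝ)
    (t : Fin T) (c : Fin M) (a : Fin K) :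
    ∫⁻ ω, ENNReal.ofReal (Real.exp (s * (r t ω c a - μ c a) - s ^ 2 / 8)) ∂P ≤ 1 := by
  have h := hasSubgaussianMGF_of_mem_Icc (measurable_reward hr t c a).aemeasurable
    (hr.mem_Icc t c a)
  rw [hr.mean t c a] at h
  have h1 := h.mgf_le s
  have h2 := h.integrable_exp_mul s
  have e : (fun ω => Real.exp (s * (r t ω c a - μ c a) - s ^ 2 / 8)) =
      fun ω => Real.exp (s * (r t ω c a - μ c a)) * Real.exp (-(s ^ 2 / 8)) := by
    funext ω
    rw [← Real.exp_add, sub_eq_add_neg]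
  have h3 : Integrable (fun ω => Real.exp (s * (r t ω c a - μ c a) - s ^ 2 / 8)) P := by
    rw [e]; exact h2.mul_const _
  rw [← ofReal_integral_eq_lintegral_ofReal h3 (ae_of_all _ fun _ => (Real.exp_pos _).le), e,
    integral_mul_const]
  have h4 : Real.exp (s ^ 2 / 8) * Real.exp (-(s ^ 2 / 8)) = 1 := by
    rw [← Real.exp_add]; simp
  rw [ENNReal.ofReal_le_one, ← h4]
  refine mul_le_mul_of_nonneg_right ?_ (Real.exp_pos _).le
  refine h1.trans (Real.exp_le_exp.mpr (le_of_eq ?_))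
  simp
  ring

theorem expWeight_cons (s m : ℝ) (c : Fin M) (a : Fin K) (x : Round M K)
    (h : List (Round M K)) :
    expWeight G s m c a (x :: h) = if G.Adj x.act a then
      expWeight G s m c a h * ENNReal.ofReal (Real.exp (s * (x.obs c a - m) - s ^ 2 / 8))
      else expWeight G s m c a h := by
  unfold expWeight
  rw [obsSum_cons, obsCount_cons]
  split_ifs
  · rw [← ENNReal.ofReal_mul (Real.exp_pos _).le, ← Real.exp_add]
    congr 2
    push_cast
    ring
  · rfl

theorem MeasRounds.measurable_expWeight {X : Type*} [MeasurableSpace X]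
    {H : X → List (Round M K)} (hH : MeasRounds H) (s m : ℝ) (c : Fin M) (a : Fin K) :
    Measurable fun x => expWeight G s m c a (H x) := by
  unfold expWeight
  obtain ⟨n, hn⟩ := hH.obsCount_eq (G := G) a
  simp only [hn]
  exact (Real.measurable_exp.comp
    (((hH.measurable_obsSum m c a).const_mul s).sub_const _)).ennreal_ofReal

/-- The supermartingale property, proved without conditional expectations: the event that the round
reveals `a` depends on earlier rewards only, and on it the weight gains an independent factor of
expectation at most 1; off it nothing changes. -/
theorem lintegral_expWeight_le [IsProbabilityMeasure P] (hr : StochasticRewards P r μ)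
    {π : Policy M K} (hπ : MeasPolicy π) (ctx : Fin T → Fin M) (s : ℝ) (c : Fin M) (a : Fin K)
    (t : ℕ) (ht : t ≤ T) :
    ∫⁻ ω, expWeight G s (μ c a) c a (history π G ctx (fun u => r u ω) t ht) ∂P ≤ 1 := by
  induction t with
  | zero => simp [history, expWeight, obsSum, obsCount]
  | succ t ih =>
    have ht' := Nat.le_of_succ_le ht
    set u : Fin T := ⟨t, ht⟩ with hu
    have hrm : Measurable fun ω (v : Fin T) => r v ω := measurable_pi_lambda _ hr.measurable
    set W : (Fin T → Fin M → Fin K → ℝ) → ENNReal := fun ρ =>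
      expWeight G s (μ c a) c a (history π G ctx ρ t ht') with hW
    have hWm : Measurable W := measurable_history hπ ctx t ht' _ fun H hH =>
      hH.measurable_expWeight s (μ c a) c a
    set E : Set (Fin T → Fin M → Fin K → ℝ) := {ρ | G.Adj (action π G ctx ρ u) a} with hE
    have hEm : MeasurableSet E := by
      have := ((countableMeas_action (G := G) hπ ctx u).comp fun b => G.Adj b a).2 True
      convert this using 1
      ext ρ
      simp [hE]
    set F : (Fin T → Fin M → Fin K → ℝ) → ENNReal := E.indicator W with hF
    have hFm : Measurable F := hWm.indicator hEm
    set F' : (Fin T → Fin M → Fin K → ℝ) → ENNReal := Eᶜ.indicator W with hF'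
    have hFm' : Measurable F' := hWm.indicator hEm.compl
    set Y : (Fin M → Fin K → ℝ) → ENNReal := fun x =>
      ENNReal.ofReal (Real.exp (s * (x c a - μ c a) - s ^ 2 / 8)) with hY
    have hYm : Measurable Y := by
      have : Measurable fun x : Fin M → Fin K → ℝ => x c a :=
        (measurable_pi_apply a).comp (measurable_pi_apply c)
      exact (Real.measurable_exp.comp
        (((this.sub_const _).const_mul s).sub_const _)).ennreal_ofReal
    have hstep : ∀ ω, expWeight G s (μ c a) c a (history π G ctx (fun v => r v ω) (t + 1) ht) =
        F (fun v => r v ω) * Y (r u ω) + F' (fun v => r v ω) := by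
      intro ω
      have e : history π G ctx (fun v => r v ω) (t + 1) ht =
        ⟨ctx u, action π G ctx (fun v => r v ω) u,
          reveal G (action π G ctx (fun v => r v ω) u) (r u ω)⟩ ::
            history π G ctx (fun v => r v ω) t ht' := rfl
      rw [e, expWeight_cons]
      by_cases hadj : G.Adj (action π G ctx (fun v => r v ω) u) a
      · have h1 : (fun v => r v ω) ∈ E := hadj
        rw [if_pos hadj, hF, hF', Set.indicator_of_mem h1,
          Set.indicator_of_notMem (by simpa using h1), add_zero]
        simp only [reveal, hadj, if_true, hW, hY]
      · have h1 : (fun v => r v ω) ∉ E := hadj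
        rw [if_neg hadj, hF, hF', Set.indicator_of_notMem h1,
          Set.indicator_of_mem (by simpa using h1), zero_mul, zero_add]
    -- Restricting to the rounds before `t` and extending by zero shows that `F` is a function of
    -- the earlier rewards, so independence of disjoint blocks applies.
    set A : Finset (Fin T) := Finset.univ.filter fun v => v.1 < t with hA
    set ext : (A → Fin M → Fin K → ℝ) → Fin T → Fin M → Fin K → ℝ := fun q v =>
      if hv : v ∈ A then q ⟨v, hv⟩ else 0 with hext
    have hextm : Measurable ext := by
      refine measurable_pi_lambda _ fun v => ?_
      simp only [hext]
      split_ifs with hv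
      · exact measurable_pi_apply _
      · exact measurable_const
    have hFext : ∀ ρ : Fin T → Fin M → Fin K → ℝ, F ρ = F (ext fun v => ρ v) := by
      intro ρ
      have hag : ∀ v : Fin T, v.1 < t → ρ v = ext (fun v => ρ v) v := by
        intro v hv
        have : v ∈ A := by simpa [hA] using hv
        simp [hext, this]
      have h1 := history_congr (G := G) π ctx t ht' hag
      have h2 : action π G ctx ρ u = action π G ctx (ext fun v => ρ v) u := by
        unfold action
        rw [show history π G ctx ρ u _ = history π G ctx (ext fun v => ρ v) u _ from h1]
      have h3 : W ρ = W (ext fun v => ρ v) := by simp only [hW, h1]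
      have h4 : ρ ∈ E ↔ (ext fun v => ρ v) ∈ E := by
        simp only [hE, Set.mem_ofPred_eq, h2]
      by_cases hρ : ρ ∈ E
      · rw [hF, Set.indicator_of_mem hρ, Set.indicator_of_mem (h4.mp hρ), h3]
      · rw [hF, Set.indicator_of_notMem hρ, Set.indicator_of_notMem fun h => hρ (h4.mpr h)]
    have hind : IndepFun (fun ω => F fun v => r v ω) (fun ω => Y (r u ω)) P := by
      have := hr.indep.indepFun_finset A {u} (by
        rw [Finset.disjoint_singleton_right]
        simp [hA, hu]) hr.measurable
      have hψ : Measurable fun q : ({u} : Finset (Fin T)) → Fin M → Fin K → ℝ =>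
          Y (q ⟨u, Finset.mem_singleton_self u⟩) :=
        hYm.comp (measurable_pi_apply (X := fun _ : ({u} : Finset (Fin T)) => Fin M → Fin K → ℝ)
          ⟨u, Finset.mem_singleton_self u⟩)
      have := this.comp (hFm.comp hextm) hψ
      have e : (fun ω => F fun v => r v ω) = (F ∘ ext) ∘ fun ω (i : A) => r i ω :=
        funext fun ω => hFext _
      rw [e]
      exact this
    simp only [hstep]
    have m1 : Measurable fun ω => F fun v => r v ω := hFm.comp hrm
    have m2 : Measurable fun ω => Y (r u ω) := hYm.comp (hr.measurable u)
    have m3 : Measurable fun ω => F' fun v => r v ω := hFm'.comp hrm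
    rw [lintegral_add_right _ m3,
      lintegral_mul_eq_lintegral_mul_lintegral_of_indepFun'' m1.aemeasurable m2.aemeasurable hind]
    calc _ ≤ (∫⁻ ω, F (fun v => r v ω) ∂P) * 1 + ∫⁻ ω, F' (fun v => r v ω) ∂P := by
            gcongr
            exact lintegral_exp_reward_le hr s u c a
      _ = ∫⁻ ω, (F (fun v => r v ω) + F' (fun v => r v ω)) ∂P := by
            rw [mul_one, lintegral_add_right _ m3]
      _ = ∫⁻ ω, W (fun v => r v ω) ∂P := by
            refine lintegral_congr fun ω => ?_
            exact Set.indicator_self_add_compl_apply E W _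
      _ ≤ 1 := ih ht'

theorem measure_obsSum_gt_le [IsProbabilityMeasure P] (hr : StochasticRewards P r μ)
    {π : Policy M K} (hπ : MeasPolicy π) (ctx : Fin T → Fin M) (c : Fin M) (a : Fin K)
    (t : ℕ) (ht : t ≤ T) {n : ℕ} (hn : 0 < n) {w : ℝ} (hw : 0 ≤ w) {σ : ℝ}
    (hσ : σ = 1 ∨ σ = -1) :
    P {ω | obsCount G (history π G ctx (fun u => r u ω) t ht) a = n ∧
      √(n * w) < σ * obsSum G (μ c a) (history π G ctx (fun u => r u ω) t ht) c a} ≤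
      ENNReal.ofReal (Real.exp (-(2 * w))) := by
  have hn' : (0 : ℝ) < n := by exact_mod_cast hn
  -- The optimal Chernoff parameter for deviation `√(n w)`: the linear term is at least `4 w` and
  -- the compensator is `2 w`.
  set s : ℝ := 4 * √(w / n) with hs
  have hrm : Measurable fun ω (v : Fin T) => r v ω := measurable_pi_lambda _ hr.measurable
  have hWm : Measurable fun ω => expWeight G (s * σ) (μ c a) c a
      (history π G ctx (fun u => r u ω) t ht) :=
    (measurable_history hπ ctx t ht _ fun H hH =>
      hH.measurable_expWeight (s * σ) (μ c a) c a).comp hrm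
  have hmk := mul_meas_ge_le_lintegral (μ := P) hWm (ENNReal.ofReal (Real.exp (2 * w)))
  have h1 := hmk.trans (lintegral_expWeight_le hr hπ ctx (s * σ) c a t ht)
  have hsub : {ω | obsCount G (history π G ctx (fun u => r u ω) t ht) a = n ∧
      √(n * w) < σ * obsSum G (μ c a) (history π G ctx (fun u => r u ω) t ht) c a} ⊆
      {ω | ENNReal.ofReal (Real.exp (2 * w)) ≤ expWeight G (s * σ) (μ c a) c a
        (history π G ctx (fun u => r u ω) t ht)} := by
    rintro ω ⟨h2, h3⟩
    refine ENNReal.ofReal_le_ofReal (Real.exp_le_exp.mpr ?_)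
    rw [h2]
    have hs0 : 0 ≤ s := by positivity
    have e1 : s * √(n * w) = 4 * w := by
      rw [hs, mul_assoc, ← Real.sqrt_mul (by positivity)]
      rw [show w / n * (n * w) = w ^ 2 by field_simp, Real.sqrt_sq hw]
    have e2 : s ^ 2 * n = 16 * w := by
      rw [hs, mul_pow, Real.sq_sqrt (by positivity)]
      field_simp
      ring
    have e3 : σ ^ 2 = 1 := by rcases hσ with rfl | rfl <;> norm_num
    have h4 := mul_le_mul_of_nonneg_left h3.le hs0
    have e4 : (s * σ) ^ 2 / 8 * n = 2 * w := by
      rw [mul_pow, e3, mul_one]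
      linarith
    rw [e4]
    linarith
  refine (measure_mono hsub).trans ?_
  have hpos : ENNReal.ofReal (Real.exp (2 * w)) ≠ 0 := by
    simpa using Real.exp_pos _
  rw [Real.exp_neg, ENNReal.ofReal_inv_of_pos (Real.exp_pos _)]
  rw [ENNReal.le_inv_iff_mul_le, mul_comm]
  exact h1

/-- With high probability all empirical rewards are accurate in all rounds. -/
theorem measure_not_accurate_le [IsProbabilityMeasure P] (hr : StochasticRewards P r μ)
    {π : Policy M K} (hπ : MeasPolicy π) (ctx : Fin T → Fin M) {w : ℝ} (hw : 0 ≤ w) :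
    P {ω | ¬ ∀ t : Fin T, Accurate G μ w (history π G ctx (fun u => r u ω) t t.isLt.le)} ≤
      ENNReal.ofReal (2 * T ^ 2 * M * K * Real.exp (-(2 * w))) := by
  -- Union over the round, the number of observations (stored minus one), the context, the action
  -- and the sign. Fixing the count is needed because it is random.
  set bad : (Fin T × Fin T × Fin M × Fin K) × Bool → Set Ω := fun i =>
    {ω | obsCount G (history π G ctx (fun u => r u ω) i.1.1 i.1.1.isLt.le) i.1.2.2.2 =
        i.1.2.1.1 + 1 ∧
      √((i.1.2.1.1 + 1 : ℕ) * w) < (if i.2 then 1 else -1) * obsSum G (μ i.1.2.2.1 i.1.2.2.2)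
        (history π G ctx (fun u => r u ω) i.1.1 i.1.1.isLt.le) i.1.2.2.1 i.1.2.2.2} with hbad
  have hsub : {ω | ¬ ∀ t : Fin T, Accurate G μ w (history π G ctx (fun u => r u ω) t t.isLt.le)} ⊆
      ⋃ i, bad i := by
    intro ω hω
    rw [Set.mem_ofPred_eq] at hω
    push Not at hω
    obtain ⟨t, hω⟩ := hω
    unfold Accurate at hω
    push Not at hω
    obtain ⟨c, a, h0, hω⟩ := hω
    set h := history π G ctx (fun u => r u ω) t t.isLt.le with hh
    have hlt : obsCount G h a < T + 1 := by
      have h1 : obsCount G h a ≤ h.length := List.length_filter_le _ _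
      have h2 : h.length = t := length_history _ _ _ _ _ _
      have := t.2
      omega
    obtain ⟨n, hn⟩ := Nat.exists_eq_add_of_lt h0
    rw [Nat.zero_add] at hn
    have hn' : (0 : ℝ) < obsCount G h a := by exact_mod_cast h0
    have h1 : √(obsCount G h a * w) < |obsSum G (μ c a) h c a| := by
      have e1 : empMean G h c a - μ c a = obsSum G (μ c a) h c a / obsCount G h a := by
        rw [empMean_eq, obsSum_eq (μ c a)]
        field_simp
      rw [e1, abs_div, abs_of_pos hn', lt_div_iff₀ hn'] at hω
      refine lt_of_eq_of_lt ?_ hω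
      rw [show (obsCount G h a : ℝ) * w = w / obsCount G h a * obsCount G h a ^ 2 by field_simp,
        Real.sqrt_mul (by positivity), Real.sqrt_sq hn'.le]
    rw [Set.mem_iUnion]
    rcases abs_cases (obsSum G (μ c a) h c a) with ⟨h2, -⟩ | ⟨h2, -⟩
    · refine ⟨((t, ⟨n, by omega⟩, c, a), true), hn, ?_⟩
      rw [hn, h2] at h1
      simpa using h1
    · refine ⟨((t, ⟨n, by omega⟩, c, a), false), hn, ?_⟩
      rw [hn, h2] at h1
      simpa using h1
  refine (measure_mono hsub).trans ((measure_iUnion_fintype_le P bad).trans ?_)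
  calc ∑ i, P (bad i) ≤ ∑ _i : (Fin T × Fin T × Fin M × Fin K) × Bool,
        ENNReal.ofReal (Real.exp (-(2 * w))) := by
          refine Finset.sum_le_sum fun i _ => ?_
          refine measure_obsSum_gt_le hr hπ ctx _ _ _ _ (Nat.succ_pos _) hw ?_
          by_cases h : i.2 <;> simp [h]
    _ = ENNReal.ofReal (2 * T ^ 2 * M * K * Real.exp (-(2 * w))) := by
          rw [Finset.sum_const, nsmul_eq_mul, ENNReal.ofReal_mul (by positivity)]
          congr 1
          simp only [Finset.card_univ, Fintype.card_prod, Fintype.card_fin, Fintype.card_bool]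
          rw [← ENNReal.ofReal_natCast]
          congr 1
          push_cast
          ring

end Concentration

/-! ### Regret bounds -/

section Regret
variable {T M K : ℕ} {G : Digraph (Fin K)}

theorem exists_of_mem_history (π : Policy M K) (c : Fin T → Fin M)
    (r : Fin T → Fin M → Fin K → ℝ) (t : ℕ) (ht : t ≤ T) {y : Round M K}
    (hy : y ∈ history π G c r t ht) : ∃ s : Fin T, s.1 < t ∧ y.ctx = c s := by
  induction t with
  | zero => simp [history] at hy
  | succ t ih =>
    rcases List.mem_cons.mp hy with rfl | hy
    · exact ⟨⟨t, ht⟩, by simp, rfl⟩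
    · obtain ⟨s, hs, h⟩ := ih _ hy
      exact ⟨s, by omega, h⟩

theorem valid_history [NeZero K] {μ : Fin M → Fin K → ℝ} {δ : ℝ} {c : Fin T → Fin M}
    (hc : SelfAvoiding c) {r : Fin T → Fin M → Fin K → ℝ}
    (hacc : ∀ t : Fin T, Accurate G μ (Real.log (2 * M * K * T / δ))
      (history (armElim dominate T M K G δ) G c r t t.isLt.le)) (t : ℕ) (ht : t ≤ T) :
    Valid G μ T δ (history (armElim dominate T M K G δ) G c r t ht) := by
  induction t with
  | zero => exact Valid.nil
  | succ t ih =>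
    refine Valid.cons _ _ (ih (Nat.le_of_succ_le ht)) (hacc ⟨t, ht⟩) rfl ?_
    by_cases hex : ∀ y ∈ history (armElim dominate T M K G δ) G c r t (Nat.le_of_succ_le ht),
        y.ctx ≠ c ⟨t, ht⟩
    · exact Or.inr hex
    · left
      push Not at hex
      obtain ⟨y, hy, hyc⟩ := hex
      obtain ⟨s, hs, hys⟩ := exists_of_mem_history _ _ _ _ _ hy
      cases t with
      | zero => omega
      | succ t =>
        refine ⟨_, _, rfl, ?_⟩
        have e : c s = c ⟨t + 1, ht⟩ := hys.symm.trans hyc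
        -- The previous round lies between an earlier occurrence of the context and the current
        -- round, so it has the same context.
        have := hc s ⟨t + 1, ht⟩ hs e ⟨t, by omega⟩ (Nat.lt_succ_iff.mp hs) (by
          simp [Fin.le_def])
        exact this.trans e

theorem regret_eq_sum_gap (π : Policy M K) (c : Fin T → Fin M) (μ : Fin M → Fin K → ℝ)
    (r : Fin T → Fin M → Fin K → ℝ) :
    regret π G c μ r = ((history π G c r T le_rfl).map fun x => gap μ x.ctx x.act).sum := by
  have key : ∀ t (ht : t ≤ T), ((history π G c r t ht).map fun x => gap μ x.ctx x.act).sum =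
      ∑ s : Fin t, gap μ (c (s.castLE ht)) (action π G c r (s.castLE ht)) := by
    intro t
    induction t with
    | zero => intro ht; simp [history]
    | succ t ih =>
      intro ht
      rw [Fin.sum_univ_castSucc]
      have e : ((history π G c r (t + 1) ht).map fun x => gap μ x.ctx x.act).sum =
        gap μ (c ⟨t, ht⟩) (action π G c r ⟨t, ht⟩) +
          ((history π G c r t (Nat.le_of_succ_le ht)).map fun x => gap μ x.ctx x.act).sum := rfl
      rw [e, ih, add_comm]
      rfl
  rw [key T le_rfl]
  rfl

theorem regret_le_of_accurate [NeZero K] (hK : 2 ≤ K) (hself : ∀ a, G.Adj a a)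
    {μ : Fin M → Fin K → ℝ} (hμ : ∀ c a, μ c a ∈ Set.Icc (0 : ℝ) 1) {δ : ℝ}
    (hw : 1 / 36 ≤ Real.log (2 * M * K * T / δ)) {c : Fin T → Fin M} (hc : SelfAvoiding c)
    (hβ : 1 ≤ beta M G) {r : Fin T → Fin M → Fin K → ℝ}
    (hacc : ∀ t : Fin T, Accurate G μ (Real.log (2 * M * K * T / δ))
      (history (armElim dominate T M K G δ) G c r t t.isLt.le)) :
    regret (armElim dominate T M K G δ) G c μ r ≤
      18 * √(Real.log (2 * M * K * T / δ) * (domRatio K * beta M G * T)) := by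
  rw [regret_eq_sum_gap]
  have := (valid_history hc hacc T le_rfl).regret_le hK hself hμ hw hβ
  rwa [length_history] at this

theorem gap_mem_Icc {μ : Fin M → Fin K → ℝ} (hμ : ∀ c a, μ c a ∈ Set.Icc (0 : ℝ) 1) (c : Fin M)
    (a : Fin K) : gap μ c a ∈ Set.Icc (0 : ℝ) 1 := by
  have : NeZero K := ⟨by have := a.2; omega⟩
  obtain ⟨b, hb⟩ := exists_best μ c
  rw [gap_eq hb]
  have h1 := hb a
  have h2 := (hμ c b).2
  have h3 := (hμ c a).1
  exact ⟨by linarith, by linarith⟩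

theorem regret_mem_Icc {μ : Fin M → Fin K → ℝ} (hμ : ∀ c a, μ c a ∈ Set.Icc (0 : ℝ) 1)
    (π : Policy M K) (c : Fin T → Fin M) (r : Fin T → Fin M → Fin K → ℝ) :
    regret π G c μ r ∈ Set.Icc (0 : ℝ) T := by
  refine ⟨Finset.sum_nonneg fun t _ => (gap_mem_Icc hμ _ _).1, ?_⟩
  have := Finset.sum_le_sum fun (t : Fin T) (_ : t ∈ Finset.univ) =>
    (gap_mem_Icc hμ (c t) (action π G c r t)).2
  simp only [Finset.sum_const, Finset.card_univ, Fintype.card_fin, nsmul_eq_mul, mul_one] at this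
  exact this

variable {Ω : Type*} [MeasurableSpace Ω] {P : Measure Ω}
  {r : Fin T → Ω → Fin M → Fin K → ℝ} {μ : Fin M → Fin K → ℝ}

theorem StochasticRewards.mean_mem_Icc [IsProbabilityMeasure P] (hr : StochasticRewards P r μ) (t : Fin T) (c : Fin M)
    (a : Fin K) : μ c a ∈ Set.Icc (0 : ℝ) 1 := by
  have hi := Integrable.of_mem_Icc 0 1 (measurable_reward hr t c a).aemeasurable
    (hr.mem_Icc t c a)
  rw [← hr.mean t c a]
  refine ⟨integral_nonneg_of_ae ?_, ?_⟩
  · filter_upwards [hr.mem_Icc t c a] with ω h using h.1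
  · have := integral_mono_ae hi (integrable_const (1 : ℝ)) (by
      filter_upwards [hr.mem_Icc t c a] with ω h using h.2)
    simpa using this

theorem measurable_regret_rewards [NeZero K] (hr : StochasticRewards P r μ) (c : Fin T → Fin M)
    (δ : ℝ) :
    Measurable fun ω => regret (armElim dominate T M K G δ) G c μ fun t => r t ω :=
  (measurable_regret (measPolicy_armElim dominate T δ) c μ).comp
    (measurable_pi_lambda _ hr.measurable)

/-- Outside the inaccurate event the regret bound is deterministic, and that event has probability
at most `2 T² M K exp(-2w) = δ² / (2 M K) ≤ δ`. -/
theorem measure_regret_gt_le [IsProbabilityMeasure P] [NeZero K] (hK : 2 ≤ K) (hT : 1 ≤ T) (hM : 1 ≤ M)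
    (hself : ∀ a, G.Adj a a)
    (hr : StochasticRewards P r μ) {c : Fin T → Fin M} (hc : SelfAvoiding c) {δ : ℝ} (hδ : 0 < δ)
    (hδ1 : δ < 1) :
    P.real {ω | ¬ regret (armElim dominate T M K G δ) G c μ (fun t => r t ω) ≤
      18 * √(Real.log (2 * M * K * T / δ) * (domRatio K * beta M G * T))} ≤ δ := by
  have hK' : (2 : ℝ) ≤ K := by exact_mod_cast hK
  have hT' : (1 : ℝ) ≤ T := by exact_mod_cast hT
  have hM' : (1 : ℝ) ≤ M := by exact_mod_cast hM
  have hMK : (2 : ℝ) ≤ M * K := by nlinarith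
  have hMKT : (2 : ℝ) ≤ M * K * T := by nlinarith
  have harg : 4 ≤ 2 * M * K * T / δ := by
    rw [le_div_iff₀ hδ]; nlinarith
  have hw : 1 / 36 ≤ Real.log (2 * M * K * T / δ) := by
    have h1 := Real.log_two_gt_d9
    have h2 : Real.log 2 ≤ Real.log (2 * M * K * T / δ) :=
      Real.log_le_log (by norm_num) (by linarith)
    linarith
  have hw0 : 0 ≤ Real.log (2 * M * K * T / δ) := by linarith
  have hβ : 1 ≤ beta M G := one_le_beta (c ⟨0, hT⟩)
  have hsub : {ω | ¬ regret (armElim dominate T M K G δ) G c μ (fun t => r t ω) ≤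
      18 * √(Real.log (2 * M * K * T / δ) * (domRatio K * beta M G * T))} ⊆
      {ω | ¬ ∀ t : Fin T, Accurate G μ (Real.log (2 * M * K * T / δ))
        (history (armElim dominate T M K G δ) G c (fun u => r u ω) t t.isLt.le)} := by
    intro ω hω hacc
    exact hω (regret_le_of_accurate hK hself (hr.mean_mem_Icc ⟨0, hT⟩) hw hc hβ hacc)
  have h1 := (measure_mono hsub).trans (measure_not_accurate_le (G := G) hr
    (measPolicy_armElim dominate T δ) c hw0)
  refine ENNReal.toReal_le_of_le_ofReal hδ.le (h1.trans (ENNReal.ofReal_le_ofReal ?_))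
  have hpos : 0 < 2 * M * K * T / δ := by linarith
  have e : Real.exp (-(2 * Real.log (2 * M * K * T / δ))) = (δ / (2 * M * K * T)) ^ 2 := by
    rw [Real.exp_neg, two_mul, Real.exp_add, Real.exp_log hpos]
    field_simp
  rw [e]
  have e2 : 2 * T ^ 2 * M * K * (δ / (2 * M * K * T)) ^ 2 = δ * (δ / (2 * (M * K))) := by
    field_simp
  rw [e2]
  refine mul_le_of_le_one_right hδ.le ?_
  rw [div_le_one (by linarith)]
  linarith

theorem log_const_le {x δ : ℝ} (hx : 2 ≤ x) (hδ : 0 < δ) (hδ1 : δ < 1) :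
    Real.log (2 * x / δ) ≤ 2 * Real.log (x / δ) := by
  have h2 : 2 ≤ x / δ := by rw [le_div_iff₀ hδ]; nlinarith
  have e : 2 * x / δ = 2 * (x / δ) := by ring
  rw [e, Real.log_mul (by norm_num) (by linarith), two_mul]
  exact add_le_add_left (Real.log_le_log (by norm_num) h2) _

theorem regret_bound_le {n b w w' k : ℝ} (hn : 0 ≤ n) (hb : 0 ≤ b)
    (hk : 0 ≤ k) (hww : w ≤ k * w') :
    18 * √(w * (domRatio K * b * n)) ≤ 18 * √(30 * k) * √(n * b * Real.log K ^ 2 * w') := by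
  rw [mul_assoc 18 √(30 * k), ← Real.sqrt_mul (by positivity)]
  refine mul_le_mul_of_nonneg_left (Real.sqrt_le_sqrt ?_) (by norm_num)
  unfold domRatio
  have h := mul_le_mul_of_nonneg_right hww
    (show 0 ≤ 30 * Real.log K ^ 2 * b * n by positivity)
  refine h.trans (le_of_eq ?_)
  ring

/-- For `δ = 1 / (2 t)` the argument is `4 x t²`, which is at most `(x t)³` because `4 ≤ x²` and `1
≤ t`. -/
theorem log_horizon_le {x t : ℝ} (hx : 2 ≤ x) (ht : 1 ≤ t) :
    Real.log (2 * (x * t) / (1 / (2 * t))) ≤ 3 * Real.log (x * t) := by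
  have e : 2 * (x * t) / (1 / (2 * t)) = 4 * x * t ^ 2 := by field_simp; ring
  have e3 : 3 * Real.log (x * t) = Real.log ((x * t) ^ 3) := by
    rw [Real.log_pow]; norm_num
  rw [e, e3]
  refine Real.log_le_log (by positivity) ?_
  have h1 : (4 : ℝ) ≤ x ^ 2 := by nlinarith
  have h2 : t ^ 2 ≤ t ^ 3 := pow_le_pow_right₀ ht (by norm_num)
  calc 4 * x * t ^ 2 ≤ x ^ 2 * x * t ^ 3 := by gcongr
    _ = (x * t) ^ 3 := by ring

/-- There is no regret if there is only one action or no round. -/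
theorem regret_eq_zero (h : K ≤ 1 ∨ T = 0) (π : Policy M K) (c : Fin T → Fin M)
    (μ : Fin M → Fin K → ℝ) (r : Fin T → Fin M → Fin K → ℝ) : regret π G c μ r = 0 := by
  refine Finset.sum_eq_zero fun t _ => ?_
  rcases h with h | rfl
  · have : Subsingleton (Fin K) := ⟨fun a b => Fin.ext (by have := a.2; have := b.2; omega)⟩
    exact (gap_eq (fun b => (congrArg (μ (c t)) (Subsingleton.elim b _)).le)
      (action π G c r t)).trans (sub_self _)
  · exact t.elim0

theorem regret_highProb [IsProbabilityMeasure P] [NeZero K] (hself : ∀ a, G.Adj a a)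
    (hr : StochasticRewards P r μ) {c : Fin T → Fin M} (hc : SelfAvoiding c) {δ : ℝ} (hδ : 0 < δ)
    (hδ1 : δ < 1) :
    1 - δ ≤ P.real {ω | regret (armElim dominate T M K G δ) G c μ (fun t => r t ω) ≤
      200 * √(T * beta M G * Real.log K ^ 2 * Real.log (M * K * T / δ))} := by
  -- For `K = 1` the bound vanishes with `log K`, but so does the regret.
  by_cases hdeg : K ≤ 1 ∨ T = 0
  · have : {ω | regret (armElim dominate T M K G δ) G c μ (fun t => r t ω) ≤
        200 * √(T * beta M G * Real.log K ^ 2 * Real.log (M * K * T / δ))} = Set.univ := by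
      refine Set.eq_univ_of_forall fun ω => ?_
      rw [Set.mem_ofPred_eq, regret_eq_zero hdeg]
      positivity
    rw [this]
    simp [hδ.le]
  obtain ⟨hK, hT⟩ := not_or.mp hdeg
  replace hK : 2 ≤ K := by omega
  replace hT : 1 ≤ T := by omega
  have hM : 1 ≤ M := by have := (c ⟨0, hT⟩).2; omega
  have hK' : (2 : ℝ) ≤ K := by exact_mod_cast hK
  have hT' : (1 : ℝ) ≤ T := by exact_mod_cast hT
  have hM' : (1 : ℝ) ≤ M := by exact_mod_cast hM
  have hMK : (2 : ℝ) ≤ M * K := by nlinarith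
  have hMKT : (2 : ℝ) ≤ M * K * T := by nlinarith
  have h1 := measure_regret_gt_le hK hT hM hself hr hc hδ hδ1
  set b := 18 * √(Real.log (2 * M * K * T / δ) * (domRatio K * beta M G * T)) with hb
  set S := {ω | regret (armElim dominate T M K G δ) G c μ (fun t => r t ω) ≤ b} with hS
  have hSm : MeasurableSet S := measurable_regret_rewards hr c δ measurableSet_Iic
  have h2 : P.real Sᶜ ≤ δ := h1
  rw [probReal_compl_eq_one_sub hSm] at h2
  refine le_trans (by linarith) (measureReal_mono (s₁ := S) fun ω hω => ?_)
  have hω' : regret (armElim dominate T M K G δ) G c μ (fun t => r t ω) ≤ b := hω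
  refine hω'.trans ?_
  have hlog : 0 ≤ Real.log (M * K * T / δ) := by
    refine Real.log_nonneg ?_
    rw [le_div_iff₀ hδ]; linarith
  have h3 := regret_bound_le (K := K) (n := T) (b := beta M G) (w := Real.log (2 * M * K * T / δ))
    (by positivity) (by positivity) (by norm_num : (0 : ℝ) ≤ 2) (by
      have := log_const_le hMKT hδ hδ1
      rwa [← mul_assoc, ← mul_assoc] at this)
  refine h3.trans (mul_le_mul_of_nonneg_right ?_ (Real.sqrt_nonneg _))
  -- The constant is `18 · 8 = 144`, below `200`.
  have : √(30 * 2 : ℝ) ≤ 8 := Real.sqrt_le_iff.mpr ⟨by norm_num, by norm_num⟩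
  linarith

theorem regret_expectation [IsProbabilityMeasure P] [NeZero K] (hself : ∀ a, G.Adj a a)
    (hr : StochasticRewards P r μ) {c : Fin T → Fin M} (hc : SelfAvoiding c) :
    Integrable (fun ω => regret (armElim dominate T M K G (1 / (2 * T))) G c μ
      (fun t => r t ω)) P ∧
    ∫ ω, regret (armElim dominate T M K G (1 / (2 * T))) G c μ (fun t => r t ω) ∂P ≤
      200 * √(T * beta M G * Real.log K ^ 2 * Real.log (M * K * T)) := by
  by_cases hdeg : K ≤ 1 ∨ T = 0
  · simp only [regret_eq_zero hdeg, integral_zero]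
    exact ⟨integrable_zero _ _ _, by positivity⟩
  obtain ⟨hK, hT⟩ := not_or.mp hdeg
  replace hK : 2 ≤ K := by omega
  replace hT : 1 ≤ T := by omega
  have hM : 1 ≤ M := by have := (c ⟨0, hT⟩).2; omega
  have hK' : (2 : ℝ) ≤ K := by exact_mod_cast hK
  have hT' : (1 : ℝ) ≤ T := by exact_mod_cast hT
  have hM' : (1 : ℝ) ≤ M := by exact_mod_cast hM
  have hMK : (2 : ℝ) ≤ M * K := by nlinarith
  have hMKT : (2 : ℝ) ≤ M * K * T := by nlinarith
  have hμ := hr.mean_mem_Icc ⟨0, hT⟩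
  have hδ : (0 : ℝ) < 1 / (2 * T) := by positivity
  have hδ1 : (1 : ℝ) / (2 * T) < 1 := by rw [div_lt_one (by positivity)]; linarith
  have h1 := measure_regret_gt_le hK hT hM hself hr hc hδ hδ1
  set δ : ℝ := 1 / (2 * T) with hδdef
  set R : Ω → ℝ := fun ω => regret (armElim dominate T M K G δ) G c μ (fun t => r t ω) with hR
  have hRm : Measurable R := measurable_regret_rewards hr c δ
  have hRi : Integrable R P := Integrable.of_mem_Icc 0 T hRm.aemeasurable
    (ae_of_all _ fun ω => regret_mem_Icc hμ _ _ _)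
  refine ⟨hRi, ?_⟩
  set b := 18 * √(Real.log (2 * M * K * T / δ) * (domRatio K * beta M G * T)) with hb
  have hb0 : 0 ≤ b := by positivity
  set S := {ω | ¬ R ω ≤ b} with hS
  have hSm : MeasurableSet S := (hRm measurableSet_Iic).compl
  -- On the failure event the regret is at most `T`; with failure probability at most `1 / (2 T)`
  -- this costs `1 / 2`.
  have h2 : ∫ ω, R ω ∂P ≤ ∫ ω, (b + S.indicator (fun _ => (T : ℝ)) ω) ∂P := by
    refine integral_mono hRi ((integrable_const b).add ((integrable_const _).indicator hSm))
      fun ω => ?_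
    by_cases hω : ω ∈ S
    · rw [Set.indicator_of_mem hω]
      have : R ω ≤ T := (regret_mem_Icc hμ _ _ _).2
      linarith
    · rw [Set.indicator_of_notMem hω, add_zero]
      exact not_not.mp hω
  rw [integral_add (integrable_const b) ((integrable_const _).indicator hSm),
    integral_indicator_const _ hSm] at h2
  have h3 : P.real S * T ≤ 1 / 2 := by
    have h4 : P.real S ≤ δ := h1
    have := mul_le_mul_of_nonneg_right h4 (show (0 : ℝ) ≤ T by positivity)
    refine this.trans (le_of_eq ?_)
    rw [hδdef]
    field_simp
  have h5 : ∫ ω, R ω ∂P ≤ b + 1 / 2 := by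
    refine h2.trans ?_
    simp only [integral_const, probReal_univ, smul_eq_mul, one_mul]
    linarith
  refine h5.trans ?_
  have hlog2 := Real.log_two_gt_d9
  have hlogK : Real.log 2 ≤ Real.log K := Real.log_le_log (by norm_num) hK'
  have hlogX : Real.log 2 ≤ Real.log (M * K * T) := Real.log_le_log (by norm_num) hMKT
  have h6 := regret_bound_le (K := K) (n := T) (b := beta M G) (w := Real.log (2 * M * K * T / δ))
    (by positivity) (by positivity) (by norm_num : (0 : ℝ) ≤ 3) (by
      have := log_horizon_le hMK hT'
      rw [hδdef]
      rwa [← mul_assoc, ← mul_assoc] at this)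
  have h7 : √(30 * 3 : ℝ) ≤ 10 := Real.sqrt_le_iff.mpr ⟨by norm_num, by norm_num⟩
  -- The additive `1 / 2` is absorbed into the main term, giving constant `180 + 1`.
  have h8 : 1 / 2 ≤ √(T * beta M G * Real.log K ^ 2 * Real.log (M * K * T)) := by
    refine Real.le_sqrt_of_sq_le ?_
    have hβ : (1 : ℝ) ≤ beta M G := by exact_mod_cast one_le_beta (c ⟨0, hT⟩)
    have e1 : (1 : ℝ) ≤ T * beta M G := one_le_mul_of_one_le_of_one_le hT' hβ
    have e2 : (0.69 : ℝ) ^ 2 ≤ Real.log K ^ 2 := by gcongr; linarith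
    calc ((1 : ℝ) / 2) ^ 2 ≤ 1 * 0.69 ^ 2 * 0.69 := by norm_num
      _ ≤ T * beta M G * Real.log K ^ 2 * Real.log (M * K * T) := by gcongr; linarith
  have h9 := mul_le_mul_of_nonneg_right h7
    (Real.sqrt_nonneg (T * beta M G * Real.log K ^ 2 * Real.log (M * K * T)))
  rw [← hb, mul_assoc] at h6
  linarith

end Regret

end GraphBandit

theorem theorem3 :
    ∃ C : ℝ, 0 < C ∧ ∃ 𝒜 : GameAlg,
      -- the subroutine is a strategy for the sequential game with cost `O(β_M(G) log² K)`
      𝒜.Legal ∧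
      (∀ (K : ℕ) (G : Digraph (Fin K)) (M : ℕ), 2 ≤ K → (∀ a, G.Adj a a) →
        𝒜.CostLE G M (C * (beta M G * Real.log K ^ 2))) ∧
      -- the arm-elimination policy that uses it runs in polynomial time
      PolicyFamily.PolyTime (fun T M K _ G δ => armElim 𝒜 T M K G δ) ∧
      -- regret under self-avoiding contexts
      ∀ (T M K : ℕ) [NeZero K] (G : Digraph (Fin K)), (∀ a, G.Adj a a) →
      ∀ c : Fin T → Fin M, SelfAvoiding c →
      ∀ (Ω : Type*) [MeasurableSpace Ω] (P : MeasureTheory.Measure Ω)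
        [MeasureTheory.IsProbabilityMeasure P]
        (r : Fin T → Ω → Fin M → Fin K → ℝ) (μ : Fin M → Fin K → ℝ),
        StochasticRewards P r μ →
        -- with probability at least `1 - δ`
        (∀ δ : ℝ, 0 < δ → δ < 1 →
          1 - δ ≤ P.real {ω | regret (armElim 𝒜 T M K G δ) G c μ (fun t => r t ω) ≤
            C * √(T * beta M G * Real.log K ^ 2 * Real.log (M * K * T / δ))}) ∧
        -- in expectation, with `δ = 1 / (2 T)`
        MeasureTheory.Integrable
          (fun ω => regret (armElim 𝒜 T M K G (1 / (2 * T))) G c μ (fun t => r t ω)) P ∧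
        ∫ ω, regret (armElim 𝒜 T M K G (1 / (2 * T))) G c μ (fun t => r t ω) ∂P ≤
          C * √(T * beta M G * Real.log K ^ 2 * Real.log (M * K * T)) := by
  refine ⟨200, by norm_num, dominate, dominate_legal, ?_, armElim_polyTime, ?_⟩
  · intro K G M hK hself A hA
    refine (dominate_costLE hK hself M A hA).trans ?_
    unfold domRatio
    have : 0 ≤ Real.log K ^ 2 * beta M G := by positivity
    nlinarith
  · intro T M K _ G hself c hc Ω _ P _ r μ hr
    exact ⟨fun δ hδ hδ1 => regret_highProb hself hr hc hδ hδ1, regret_expectation hself hr hc⟩
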